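/- **Theorem 1.1.** Let $M$ be a Stein manifold (second countable and Hausdorff, of pure dimension) and let $A\subset M$ be a closed subset. Let $\{U_i\}$ be a locally finite open cover of $M$, and suppose that for each $i$ there is a plurisubharmonic function $\varphi_i:U_i\to[-\infty,\infty)$ that is (finite and) smooth on $U_i\setminus A$, such that $\partial\bar\partial\varphi_i$ is a Kähler metric on $U_i\setminus A$ (that is, its Levi form is positive definite there) which is complete along $A\cap U_i$. Here *complete along $A\cap U_i$* means that every $C^1$ curve $\gamma:[0,1)\to U_i\setminus A$ whose image lies in a compact subset of $U_i$ but in no compact subset of $U_i\setminus A$ has infinite length with respect to $\partial\bar\partial\varphi_i$. Plurisubharmonic functions are allowed to be identically $-\infty$. Then there is a function $\varphi:M\to\mathbb R$, plurisubharmonic on $M$, bounded from below on $M$ and smooth on $M\setminus A$, such that $\partial\bar\partial\varphi$ is a complete Kähler metric on $M\setminus A$, that is, its Levi form is positive definite on $M\setminus A$ and $M\setminus A$ is complete with respect to the geodesic distance of $\partial\bar\partial\varphi$ (which is infinite between points in different connected components). Moreover, if every $\varphi_i$ is continuous on $U_i$ (as a map to $[-\infty,\infty)$), then $\varphi$ can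 be chosen continuous on $M$ in addition to all these properties. -/

import Mathlib

open scoped Manifold ContDiff ENNReal Topology

noncomputable section

/-- A complex manifold `M` modelled on `E` is Stein if it is holomorphically convex (the
holomorphic hull of every compact set is compact), global holomorphic functions separate points,
and around every point global holomorphic functions give local coordinates.  (Countability at
infinity is imposed separately, as second countability.) -/
structure IsStein (E : Type*) [NormedAddCommGroup E] [NormedSpace ℂ E]
    (M : Type*) [TopologicalSpace M] [ChartedSpace E M] : Prop where
  holConvex : ∀ K : Set M, IsCompact K →
    IsCompact {x : M | ∀ f : M → ℂ, MDifferentiable 𝓘(ℂ, E) 𝓘(ℂ, ℂ) f →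
      ∀ C : ℝ, (∀ y ∈ K, ‖f y‖ ≤ C) → ‖f x‖ ≤ C}
  separates : ∀ x y : M, x ≠ y →
    ∃ f : M → ℂ, MDifferentiable 𝓘(ℂ, E) 𝓘(ℂ, ℂ) f ∧ f x ≠ f y
  coordinates : ∀ x : M, ∃ F : M → E, MDifferentiable 𝓘(ℂ, E) 𝓘(ℂ, E) F ∧
    Function.Bijective (mfderiv 𝓘(ℂ, E) 𝓘(ℂ, E) F x)

/-- The mean `∫₀¹ u(a + e^{2πiθ} b) dθ ∈ [-∞, ∞]` of an extended-real function over the circle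
with centre `a` in the direction `b`: integral of the positive part minus integral of the negative
part.  (For upper semicontinuous `u < ∞` the first of them is finite.) -/
def circleMean {E : Type*} [NormedAddCommGroup E] [NormedSpace ℂ E]
    (u : E → EReal) (a b : E) : EReal :=
  ((∫⁻ θ in Set.Ioc (0 : ℝ) 1,
      (u (a + Complex.exp (2 * Real.pi * θ * Complex.I) • b)).toENNReal : ℝ≥0∞) : EReal) -
  ((∫⁻ θ in Set.Ioc (0 : ℝ) 1,
      (-u (a + Complex.exp (2 * Real.pi * θ * Complex.I) • b)).toENNReal : ℝ≥0∞) : EReal)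

/-- Plurisubharmonic functions `U → [-∞, ∞)` on an open subset `U` of a complex manifold: upper
semicontinuous, and in every chart of the atlas satisfying the sub-mean value inequality on all
closed discs in complex lines.  The function that is identically `-∞` is admitted. -/
def IsPSHOn (E : Type*) [NormedAddCommGroup E] [NormedSpace ℂ E]
    {M : Type*} [TopologicalSpace M] [ChartedSpace E M] (f : M → EReal) (U : Set M) : Prop :=
  UpperSemicontinuousOn f U ∧ (∀ x ∈ U, f x ≠ ⊤) ∧
  ∀ c ∈ atlas E M, ∀ a b : E,
    (∀ ζ : ℂ, ‖ζ‖ ≤ 1 → a + ζ • b ∈ c.target ∧ c.symm (a + ζ • b) ∈ U) →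
    f (c.symm a) ≤ circleMean (fun z => f (c.symm z)) a b

/-- The Levi form `∑ ∂²f/∂z_j∂z̄_k · v_j v̄_k` of a real function at `x` on a tangent vector
`v ∈ T_x M`, i.e. the value at `v` of the Hermitian form `∂∂̄f`.  It is written here as
`(D²f(v,v) + D²f(iv,iv)) / 4` in the chart at `x`, the chart by which Mathlib identifies `T_x M`
with `E`. -/
def leviForm {E : Type*} [NormedAddCommGroup E] [NormedSpace ℂ E]
    {M : Type*} [TopologicalSpace M] [ChartedSpace E M] (f : M → ℝ) (x : M) (v : E) : ℝ :=
  let F : E → ℝ := fun z => f ((chartAt E x).symm z)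
  let p : E := chartAt E x x
  (fderiv ℝ (fderiv ℝ F) p v v +
    fderiv ℝ (fderiv ℝ F) p (Complex.I • v) (Complex.I • v)) / 4

/-- On the open set `S`, `f` is smooth and `∂∂̄f` is a Kähler metric, i.e. the Hermitian form
`∂∂̄f` is positive definite (the associated form `i∂∂̄f` is always closed). -/
def IsKahlerPotentialOn (E : Type*) [NormedAddCommGroup E] [NormedSpace ℂ E]
    {M : Type*} [TopologicalSpace M] [ChartedSpace E M] (f : M → ℝ) (S : Set M) : Prop :=
  ContMDiffOn 𝓘(ℝ, E) 𝓘(ℝ, ℝ) ∞ f S ∧ ∀ x ∈ S, ∀ v : E, v ≠ 0 → 0 < leviForm f x v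

/-- Length, with respect to `∂∂̄f`, of the curve `γ` on the interval from `a` to `b`. -/
def leviLength (E : Type*) [NormedAddCommGroup E] [NormedSpace ℂ E]
    {M : Type*} [TopologicalSpace M] [ChartedSpace E M] (f : M → ℝ) (γ : ℝ → M) (a b : ℝ) :
    ℝ≥0∞ :=
  ∫⁻ t in Set.Ioo a b,
    ENNReal.ofReal (Real.sqrt (leviForm (E := E) f (γ t)
      (mfderiv 𝓘(ℝ, ℝ) 𝓘(ℝ, E) γ t (1 : ℝ))))

/-- The geodesic distance of the metric `∂∂̄f` on `S`: infimum of the lengths of the `C¹` curves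
in `S` from `x` to `y` (infinite if there are none). -/
def leviEDist (E : Type*) [NormedAddCommGroup E] [NormedSpace ℂ E]
    {M : Type*} [TopologicalSpace M] [ChartedSpace E M] (f : M → ℝ) (S : Set M) (x y : M) :
    ℝ≥0∞ :=
  ⨅ (γ : ℝ → M) (_ : ContMDiffOn 𝓘(ℝ, ℝ) 𝓘(ℝ, E) 1 γ (Set.Icc 0 1) ∧
      Set.MapsTo γ (Set.Icc 0 1) S ∧ γ 0 = x ∧ γ 1 = y), leviLength E f γ 0 1

/-- The metric `∂∂̄f` on `S` is complete: every Cauchy sequence for its geodesic distance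
converges in `S`. -/
def IsLeviComplete (E : Type*) [NormedAddCommGroup E] [NormedSpace ℂ E]
    {M : Type*} [TopologicalSpace M] [ChartedSpace E M] (f : M → ℝ) (S : Set M) : Prop :=
  ∀ u : ℕ → M, (∀ n, u n ∈ S) →
    (∀ ε : ℝ≥0∞, 0 < ε → ∃ N, ∀ m ≥ N, ∀ n ≥ N, leviEDist E f S (u m) (u n) < ε) →
    ∃ x ∈ S, Filter.Tendsto (fun n => leviEDist E f S (u n) x) Filter.atTop (𝓝 0)

/-- The metric `∂∂̄f` on `U \ A` is complete along `A ∩ U`: every `C¹` curve `[0,1) → U \ A` that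
stays in a compact subset of `U`, but in no compact subset of `U \ A`, has infinite length. -/
def IsLeviCompleteAlong (E : Type*) [NormedAddCommGroup E] [NormedSpace ℂ E]
    {M : Type*} [TopologicalSpace M] [ChartedSpace E M] (f : M → ℝ) (U A : Set M) : Prop :=
  ∀ γ : ℝ → M, ContMDiffOn 𝓘(ℝ, ℝ) 𝓘(ℝ, E) 1 γ (Set.Ico 0 1) →
    Set.MapsTo γ (Set.Ico 0 1) (U \ A) →
    (∃ K : Set M, IsCompact K ∧ K ⊆ U ∧ Set.MapsTo γ (Set.Ico 0 1) K) →
    (¬ ∃ K : Set M, IsCompact K ∧ K ⊆ U \ A ∧ Set.MapsTo γ (Set.Ico 0 1) K) →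
    leviLength E f γ 0 1 = ⊤

end

/-! The potential is Φ = Ψ + ∑ θⱼ² / log (3 + mⱼ - fⱼ). The fⱼ < mⱼ are restrictions of the given
local functions, and the θⱼ are smooth cutoffs supported in their domains, one of them equal to 1
near each point. Ψ is smooth with very large Levi form; it exists because the manifold is Stein. A
quotient is read as 0 where fⱼ = -∞, so Φ is real and nonnegative, and it is continuous if the fⱼ
are.

Write L = log (3 + m - f) > 1, so that -L is plurisubharmonic. The quotient θ²/L is the supremum
over τ of 2τθ - τ²L, attained at τ = θ/L. Hence off A its Levi form is at least 2τ times that of θ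
plus τ² times that of -L (`le_levi_sq_mul_inv_log`). Since 0 ≤ τ ≤ 1, the only possibly negative
contribution is at least -2|levi θ|, however f behaves near A, and Ψ absorbs it
(`IsStein.exists_psh_dominating`, `LocalPotentials.exists_dominating`).

Across A the fⱼ are only upper semicontinuous. The same tangents, with the logarithm linearized too,
support Φ from below at a given point by a function of positive Levi form plus nonnegative multiples
of those fⱼ that are finite there. This gives a strict sub-mean value inequality on small circles
(`eventually_lt_integral_of_support`), and a maximum principle extends it to all discs
(`le_integral_unitExp_of_local`).

For completeness, Ψ is made to dominate also the coordinate norms and dρ² for an exhaustion ρ, so a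
Cauchy sequence stays in a compact set and converges in M. If the limit lay in A, short curves
between its terms would join to a curve of finite length that accumulates there and stays where some
θⱼ = 1. There the metric is at least L⁻² times that of -L, whose Levi form controls (dL)²; so log L
is Lipschitz for it. Then L is bounded along the curve, the metric of fⱼ is at most a constant times
that of Φ, and completeness of fⱼ along A is contradicted (`LocalPotentials.leviLength_eq_top`). -/

open scoped Manifold ContDiff ENNReal Topology

/-! ### Calculus of the Levi form on a complex normed space. -/

section Calculus

open Set Filter

variable {E : Type*} [NormedAddCommGroup E] [NormedSpace ℂ E]

/-- The Levi form of a real function on a complex normed space. -/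
noncomputable def levi (F : E → ℝ) (p v : E) : ℝ :=
  (fderiv ℝ (fderiv ℝ F) p v v +
    fderiv ℝ (fderiv ℝ F) p (Complex.I • v) (Complex.I • v)) / 4

theorem levi_congr {F G : E → ℝ} {p : E} (h : F =ᶠ[𝓝 p] G) (v : E) : levi F p v = levi G p v := by
  simp only [levi, h.fderiv.fderiv_eq]

theorem ContDiffAt.differentiableAt_fderiv_of_two {X Y : Type*} [NormedAddCommGroup X]
    [NormedSpace ℝ X] [NormedAddCommGroup Y] [NormedSpace ℝ Y] {F : X → Y} {p : X}
    (h : ContDiffAt ℝ 2 F p) : DifferentiableAt ℝ (fderiv ℝ F) p :=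
  (h.fderiv_right (m := 1) (by norm_num)).differentiableAt one_ne_zero

theorem ContDiffAt.eventually_differentiableAt_of_two {X Y : Type*} [NormedAddCommGroup X]
    [NormedSpace ℝ X] [NormedAddCommGroup Y] [NormedSpace ℝ Y] {F : X → Y} {p : X}
    (h : ContDiffAt ℝ 2 F p) : ∀ᶠ z in 𝓝 p, DifferentiableAt ℝ F z :=
  (h.eventually (by simp)).mono fun _ hz => hz.differentiableAt two_ne_zero

theorem levi_add {F G : E → ℝ} {p : E} (hF : ContDiffAt ℝ 2 F p) (hG : ContDiffAt ℝ 2 G p)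
    (v : E) : levi (fun z => F z + G z) p v = levi F p v + levi G p v := by
  have h : fderiv ℝ (fun z => F z + G z) =ᶠ[𝓝 p] fun z => fderiv ℝ F z + fderiv ℝ G z := by
    filter_upwards [hF.eventually_differentiableAt_of_two, hG.eventually_differentiableAt_of_two]
      with z h1 h2 using fderiv_fun_add h1 h2
  simp only [levi, h.fderiv_eq]
  rw [fderiv_fun_add hF.differentiableAt_fderiv_of_two hG.differentiableAt_fderiv_of_two]
  simp only [add_apply]
  ring

theorem levi_const_mul (c : ℝ) {F : E → ℝ} {p : E} (hF : ContDiffAt ℝ 2 F p) (v : E) :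
    levi (fun z => c * F z) p v = c * levi F p v := by
  have h : fderiv ℝ (fun z => c * F z) =ᶠ[𝓝 p] fun z => c • fderiv ℝ F z := by
    filter_upwards [hF.eventually_differentiableAt_of_two] with z h1 using fderiv_const_mul h1 c
  simp only [levi, h.fderiv_eq]
  rw [fderiv_fun_const_smul hF.differentiableAt_fderiv_of_two]
  simp only [smul_apply, smul_eq_mul]
  ring

theorem levi_const (c : ℝ) (p v : E) : levi (fun _ => c) p v = 0 := by
  have : fderiv ℝ (fun _ : E => c) = fun _ => 0 := by ext; simp
  simp [levi, this]

theorem levi_sum {ι : Type*} (s : Finset ι) {F : ι → E → ℝ} {p : E}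
    (hF : ∀ i ∈ s, ContDiffAt ℝ 2 (F i) p) (v : E) :
    levi (fun z => ∑ i ∈ s, F i z) p v = ∑ i ∈ s, levi (F i) p v := by
  classical
  induction s using Finset.induction_on with
  | empty => simpa using levi_const 0 p v
  | insert i s hi ih =>
    simp only [Finset.sum_insert hi]
    rw [levi_add (hF i (by simp)) (ContDiffAt.sum fun j hj => hF j (by simp [hj])),
      ih fun j hj => hF j (by simp [hj])]

theorem fderiv_fderiv_comp {X Y Z : Type*} [NormedAddCommGroup X] [NormedSpace ℝ X]
    [NormedAddCommGroup Y] [NormedSpace ℝ Y] [NormedAddCommGroup Z] [NormedSpace ℝ Z]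
    {u : Y → Z} {G : X → Y} {p : X} (hu : ContDiffAt ℝ 2 u (G p)) (hG : ContDiffAt ℝ 2 G p)
    (v w : X) :
    fderiv ℝ (fderiv ℝ (fun z => u (G z))) p v w =
      fderiv ℝ (fderiv ℝ u) (G p) (fderiv ℝ G p v) (fderiv ℝ G p w) +
        fderiv ℝ u (G p) (fderiv ℝ (fderiv ℝ G) p v w) := by
  have h : fderiv ℝ (fun z => u (G z)) =ᶠ[𝓝 p]
      fun z => (fderiv ℝ u (G z)).comp (fderiv ℝ G z) := by
    filter_upwards [hG.eventually_differentiableAt_of_two,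
      hG.continuousAt.eventually hu.eventually_differentiableAt_of_two] with z h1 h2
    exact fderiv_comp z h2 h1
  have hG1 := (hG.differentiableAt two_ne_zero).hasFDerivAt
  have h1 : HasFDerivAt (fun z => fderiv ℝ u (G z))
      ((fderiv ℝ (fderiv ℝ u) (G p)).comp (fderiv ℝ G p)) p :=
    (hu.differentiableAt_fderiv_of_two.hasFDerivAt).comp p hG1
  have h2 := hG.differentiableAt_fderiv_of_two.hasFDerivAt
  rw [h.fderiv_eq, (h1.clm_comp h2).fderiv]
  simp [add_comm]

theorem fderiv_I_smul {X Y : Type*} [NormedAddCommGroup X] [NormedSpace ℂ X]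
    [NormedAddCommGroup Y] [NormedSpace ℂ Y] {G : X → Y} {p : X} (hG : DifferentiableAt ℂ G p)
    (v : X) : fderiv ℝ G p (Complex.I • v) = Complex.I • fderiv ℝ G p v := by
  rw [hG.fderiv_restrictScalars ℝ]
  simp

/-- The real second derivative of a holomorphic map is complex bilinear and I² = -1. Hence the
second-order term of a composition with a holomorphic map cancels in the Levi form. -/
theorem fderiv_fderiv_I_smul {X Y : Type*} [NormedAddCommGroup X] [NormedSpace ℂ X]
    [NormedAddCommGroup Y] [NormedSpace ℂ Y] {G : X → Y} {p : X} (hG : ContDiffAt ℂ 2 G p)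
    (v : X) : fderiv ℝ (fderiv ℝ G) p (Complex.I • v) (Complex.I • v) =
      - fderiv ℝ (fderiv ℝ G) p v v := by
  have hR : DifferentiableAt ℝ (fderiv ℝ G) p :=
    (hG.restrict_scalars ℝ).differentiableAt_fderiv_of_two
  have hC : DifferentiableAt ℂ (fderiv ℂ G) p :=
    (hG.fderiv_right (m := 1) (by norm_num)).differentiableAt one_ne_zero
  have hev : ∀ᶠ z in 𝓝 p, DifferentiableAt ℂ G z :=
    (hG.eventually (by simp)).mono fun _ hz => hz.differentiableAt two_ne_zero
  have key : ∀ w x : X, fderiv ℝ (fderiv ℝ G) p x w = fderiv ℂ (fderiv ℂ G) p x w := by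
    intro w x
    have h1 : (fun z => fderiv ℝ G z w) =ᶠ[𝓝 p] fun z => fderiv ℂ G z w := by
      filter_upwards [hev] with z hz
      rw [hz.fderiv_restrictScalars ℝ]; rfl
    have h2 : DifferentiableAt ℂ (fun z => fderiv ℂ G z w) p :=
      hC.clm_apply (differentiableAt_const w)
    have h3 := h1.fderiv_eq (𝕜 := ℝ)
    rw [h2.fderiv_restrictScalars ℝ, fderiv_clm_apply hR (differentiableAt_const w),
      fderiv_clm_apply hC (differentiableAt_const w)] at h3
    simpa using DFunLike.congr_fun h3 x
  rw [key, key]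
  simp [smul_smul]

/-- Functoriality of the Levi form under holomorphic maps. -/
theorem levi_comp_holomorphic {V : Type*} [NormedAddCommGroup V] [NormedSpace ℂ V] {u : V → ℝ}
    {G : E → V} {p : E} (hu : ContDiffAt ℝ 2 u (G p)) (hG : ContDiffAt ℂ 2 G p) (v : E) :
    levi (fun z => u (G z)) p v = levi u (G p) (fderiv ℂ G p v) := by
  have hd := hG.differentiableAt two_ne_zero
  have hv : fderiv ℂ G p v = fderiv ℝ G p v := by rw [hd.fderiv_restrictScalars ℝ]; rfl
  simp only [levi, fderiv_fderiv_comp hu (hG.restrict_scalars ℝ), fderiv_fderiv_I_smul hG,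
    fderiv_I_smul hd, hv, map_neg]
  ring

/-- This is ∂∂̄(χ∘h) = χ' ∂∂̄h + χ'' ∂h ∂̄h; the two squares come from |∂h(v)|² = (dh(v)² + dh(iv)²)
/ 4. -/
theorem levi_comp_real {χ χ' : ℝ → ℝ} {c : ℝ} {h : E → ℝ} {p : E} (hh : ContDiffAt ℝ 2 h p)
    (h1 : ∀ᶠ y in 𝓝 (h p), HasDerivAt χ (χ' y) y) (h2 : HasDerivAt χ' c (h p)) (v : E) :
    levi (fun z => χ (h z)) p v = χ' (h p) * levi h p v +
      c / 4 * ((fderiv ℝ h p v) ^ 2 + (fderiv ℝ h p (Complex.I • v)) ^ 2) := by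
  have e : fderiv ℝ (fun z => χ (h z)) =ᶠ[𝓝 p] fun z => χ' (h z) • fderiv ℝ h z := by
    filter_upwards [hh.eventually_differentiableAt_of_two, hh.continuousAt.eventually h1]
      with z hz1 hz2
    exact (hz2.comp_hasFDerivAt z hz1.hasFDerivAt).fderiv
  have e2 := (h2.comp_hasFDerivAt p (hh.differentiableAt two_ne_zero).hasFDerivAt).smul
    hh.differentiableAt_fderiv_of_two.hasFDerivAt
  have e3 := e.fderiv_eq.trans e2.fderiv
  simp only [levi, e3]
  simp
  ring

theorem levi_norm_sq {V : Type*} [NormedAddCommGroup V] [InnerProductSpace ℂ V] (p v : V) :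
    levi (fun z : V => ‖z‖ ^ 2) p v = ‖v‖ ^ 2 := by
  let _ : InnerProductSpace ℝ V := InnerProductSpace.complexToReal
  have h : fderiv ℝ (fun z : V => ‖z‖ ^ 2) = fun z => (2 • innerSL ℝ (E := V)) z := by
    ext1 z
    rw [(hasStrictFDerivAt_norm_sq z).hasFDerivAt.fderiv]
    rfl
  rw [levi, h]
  have h2 := (2 • innerSL ℝ (E := V)).hasFDerivAt (x := p)
  rw [h2.fderiv]
  have hr : ∀ w : V, innerSL ℝ w w = ‖w‖ ^ 2 := fun w => real_inner_self_eq_norm_sq w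
  simp [hr, norm_smul]
  ring

theorem levi_norm_sq_comp {V : Type*} [NormedAddCommGroup V] [InnerProductSpace ℂ V]
    {G : E → V} {p : E} (hG : ContDiffAt ℂ 2 G p) (v : E) :
    levi (fun z => ‖G z‖ ^ 2) p v = ‖fderiv ℂ G p v‖ ^ 2 := by
  let _ : InnerProductSpace ℝ V := InnerProductSpace.complexToReal
  rw [levi_comp_holomorphic (u := fun z : V => ‖z‖ ^ 2) (contDiff_norm_sq ℝ).contDiffAt hG,
    levi_norm_sq]

theorem abs_levi_le (F : E → ℝ) (p v : E) :
    |levi F p v| ≤ ‖fderiv ℝ (fderiv ℝ F) p‖ * ‖v‖ ^ 2 := by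
  have h : ∀ w : E, |fderiv ℝ (fderiv ℝ F) p w w| ≤ ‖fderiv ℝ (fderiv ℝ F) p‖ * ‖w‖ ^ 2 := by
    intro w
    have := (fderiv ℝ (fderiv ℝ F) p).le_opNorm₂ w w
    rw [Real.norm_eq_abs] at this
    linarith
  have h1 := h v
  have h2 := h (Complex.I • v)
  rw [norm_smul, Complex.norm_I, one_mul] at h2
  rw [levi, abs_div, abs_of_pos (by norm_num : (0 : ℝ) < 4)]
  have h3 := abs_add_le (fderiv ℝ (fderiv ℝ F) p v v)
    (fderiv ℝ (fderiv ℝ F) p (Complex.I • v) (Complex.I • v))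
  have h4 : 0 ≤ ‖fderiv ℝ (fderiv ℝ F) p‖ * ‖v‖ ^ 2 := by positivity
  linarith

theorem levi_smul (F : E → ℝ) (p v : E) (c : ℝ) : levi F p (c • v) = c ^ 2 * levi F p v := by
  simp only [levi, smul_comm Complex.I c v, map_smul, smul_apply, smul_eq_mul]
  ring

/-- Second order Taylor expansion. -/
theorem isLittleO_taylor_two {X : Type*} [NormedAddCommGroup X] [NormedSpace ℝ X] {F : X → ℝ}
    {p : X} (hF : ContDiffAt ℝ 2 F p) :
    (fun h => F (p + h) - F p - fderiv ℝ F p h - fderiv ℝ (fderiv ℝ F) p h h / 2) =o[𝓝 0]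
      fun h => ‖h‖ ^ 2 := by
  set B := fderiv ℝ (fderiv ℝ F) p with hB
  have hsymm : ∀ v w, B v w = B w v := by
    intro v w
    have := hF.isSymmSndFDerivAt (by simp)
    exact this v w
  rw [Asymptotics.isLittleO_iff]
  intro ε hε
  have hd := hF.differentiableAt_fderiv_of_two.hasFDerivAt
  rw [hasFDerivAt_iff_isLittleO_nhds_zero, Asymptotics.isLittleO_iff] at hd
  have hcont : Tendsto (fun h : X => p + h) (𝓝 0) (𝓝 p) := by
    exact (continuous_const.add continuous_id).tendsto' (0 : X) p (by simp)
  have hev := (hd hε).and (hcont.eventually hF.eventually_differentiableAt_of_two)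
  obtain ⟨δ, hδ, hball⟩ := Metric.eventually_nhds_iff_ball.1 hev
  filter_upwards [Metric.ball_mem_nhds (0 : X) hδ] with h hh
  rw [Metric.mem_ball, dist_zero_right] at hh
  -- The derivative of the remainder g has norm at most ε‖h‖ on the ball of radius ‖h‖, so the mean
  -- value inequality bounds g by ε‖h‖².
  set g : X → ℝ := fun h => F (p + h) - F p - fderiv ℝ F p h - B h h / 2
  have hder : ∀ x ∈ Metric.closedBall (0 : X) ‖h‖, HasFDerivWithinAt g
      (fderiv ℝ F (p + x) - fderiv ℝ F p - B x) (Metric.closedBall (0 : X) ‖h‖) x := by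
    intro x hx
    have hx' : x ∈ Metric.ball (0 : X) δ := by
      rw [Metric.mem_closedBall, dist_zero_right] at hx
      rw [Metric.mem_ball, dist_zero_right]; linarith
    have h1 : HasFDerivAt (fun h => F (p + h)) (fderiv ℝ F (p + x)) x := by
      exact (hball x hx').2.hasFDerivAt.comp x ((hasFDerivAt_id x).const_add p)
    have h2 : HasFDerivAt (fun h => B h h / 2) (B x) x := by
      have h3 := ((B.hasFDerivAt (x := x)).clm_apply (hasFDerivAt_id x)).mul_const (2 : ℝ)⁻¹
      refine h3.congr_fderiv ?_
      ext w
      simp [hsymm w x]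
      ring
    exact (((h1.sub_const (F p)).sub (fderiv ℝ F p).hasFDerivAt).sub h2).hasFDerivWithinAt
  have hbound : ∀ x ∈ Metric.closedBall (0 : X) ‖h‖,
      ‖fderiv ℝ F (p + x) - fderiv ℝ F p - B x‖ ≤ ε * ‖h‖ := by
    intro x hx
    rw [Metric.mem_closedBall, dist_zero_right] at hx
    have hx' : x ∈ Metric.ball (0 : X) δ := by rw [Metric.mem_ball, dist_zero_right]; linarith
    exact (hball x hx').1.trans (by gcongr)
  have := (convex_closedBall (0 : X) ‖h‖).norm_image_sub_le_of_norm_hasFDerivWithin_le hder hbound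
    (Metric.mem_closedBall_self (norm_nonneg h)) (by simp : h ∈ Metric.closedBall (0 : X) ‖h‖)
  have hg0 : g 0 = 0 := by simp [g]
  rw [hg0, sub_zero, sub_zero] at this
  calc ‖g h‖ ≤ ε * ‖h‖ * ‖h‖ := this
    _ = ε * ‖‖h‖ ^ 2‖ := by simp; ring

theorem IsLocalMin.fderiv_fderiv_nonneg {X : Type*} [NormedAddCommGroup X] [NormedSpace ℝ X]
    {F : X → ℝ} {p : X} (hF : ContDiffAt ℝ 2 F p) (hmin : IsLocalMin F p) (v : X) :
    0 ≤ fderiv ℝ (fderiv ℝ F) p v v := by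
  by_contra! hneg
  set B := fderiv ℝ (fderiv ℝ F) p v v
  have hv : v ≠ 0 := by rintro rfl; simp [B] at hneg
  have hvn : 0 < ‖v‖ ^ 2 := by positivity
  have hT := isLittleO_taylor_two hF
  rw [Asymptotics.isLittleO_iff] at hT
  -- With this constant the Taylor error along t v is at most half of the negative main term B t² /
  -- 2.
  have hc : (0 : ℝ) < -B / 4 / ‖v‖ ^ 2 := by apply div_pos _ hvn; linarith
  have hline : Tendsto (fun t : ℝ => t • v) (𝓝 0) (𝓝 0) := by
    exact (continuous_id.smul continuous_const).tendsto' (0 : ℝ) (0 : X) (by simp)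
  have hline' : Tendsto (fun t : ℝ => p + t • v) (𝓝 0) (𝓝 p) := by
    simpa using hline.const_add p
  have h1 := hline.eventually (hT hc)
  have h2 := hline'.eventually hmin
  have h3 : ∀ᶠ t in 𝓝[≠] (0 : ℝ), False := by
    filter_upwards [h1.filter_mono nhdsWithin_le_nhds, h2.filter_mono nhdsWithin_le_nhds,
      self_mem_nhdsWithin] with t ht1 ht2 ht0
    rw [hmin.fderiv_eq_zero] at ht1
    simp only [zero_apply, map_smul, smul_apply,
      smul_eq_mul, norm_smul, Real.norm_eq_abs, mul_pow, abs_mul, abs_pow,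
      sq_abs, abs_norm] at ht1
    have ht : 0 < t ^ 2 := by have : t ≠ 0 := ht0; positivity
    have e : -B / 4 / ‖v‖ ^ 2 * (t ^ 2 * ‖v‖ ^ 2) = -B / 4 * t ^ 2 := by field_simp
    rw [e] at ht1
    have := (abs_le.1 ht1).2
    change F (p + t • v) - F p - t * 0 - t * (t * B) / 2 ≤ _ at this
    nlinarith
  exact (h3.exists).elim fun _ h => h

theorem IsLocalMin.levi_nonneg {F : E → ℝ} {p : E} (hF : ContDiffAt ℝ 2 F p)
    (hmin : IsLocalMin F p) (v : E) : 0 ≤ levi F p v := by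
  have h1 := hmin.fderiv_fderiv_nonneg hF v
  have h2 := hmin.fderiv_fderiv_nonneg hF (Complex.I • v)
  unfold levi
  positivity

/-- A function with positive Levi form in the direction `v` is, on the complex line through `p`
in direction `v`, bounded below by the real part of a holomorphic polynomial plus a multiple of the squared
distance. -/
theorem eventually_re_add_le_of_levi_pos {F : E → ℝ} {p v : E} (hF : ContDiffAt ℝ 2 F p)
    (hv : 0 < levi F p v) :
    ∃ (α β : ℂ) (c : ℝ), 0 < c ∧ ∀ᶠ ζ in 𝓝 (0 : ℂ),
      F p + (α * ζ + β * ζ ^ 2).re + c * ‖ζ‖ ^ 2 ≤ F (p + ζ • v) := by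
  set B := fderiv ℝ (fderiv ℝ F) p with hB
  have hsymm : ∀ v w, B v w = B w v := fun v w => hF.isSymmSndFDerivAt (by simp) v w
  have hv0 : v ≠ 0 := by rintro rfl; simp [levi] at hv
  have hvn : 0 < ‖v‖ ^ 2 := by positivity
  -- On the line, Re (αζ) is the linear part, and half the Hessian splits as Re (βζ²) + levi · |ζ|².
  -- Half of the last term pays for the Taylor error.
  refine ⟨⟨fderiv ℝ F p v, -fderiv ℝ F p (Complex.I • v)⟩,
    ⟨(B v v - B (Complex.I • v) (Complex.I • v)) / 4, - B v (Complex.I • v) / 2⟩, levi F p v / 2, half_pos hv, ?_⟩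
  have hT := isLittleO_taylor_two hF
  rw [Asymptotics.isLittleO_iff] at hT
  have hc : (0 : ℝ) < levi F p v / 2 / ‖v‖ ^ 2 := by positivity
  have hline : Tendsto (fun t : ℂ => t • v) (𝓝 0) (𝓝 0) := by
    exact (continuous_id.smul continuous_const).tendsto' (0 : ℂ) (0 : E) (by simp)
  filter_upwards [hline.eventually (hT hc)] with ζ h1
  have e0 : ζ • v = ζ.re • v + ζ.im • (Complex.I • v) := by
    conv_lhs => rw [← Complex.re_add_im ζ]
    rw [add_smul, mul_smul]
    simp
  have e1 : levi F p v / 2 / ‖v‖ ^ 2 * ‖‖ζ • v‖ ^ 2‖ = levi F p v / 2 * ‖ζ‖ ^ 2 := by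
    rw [Real.norm_of_nonneg (by positivity), norm_smul]; field_simp
  rw [e1] at h1
  have h2 := (abs_le.1 h1).1
  have e2 : fderiv ℝ F p (ζ • v) = ζ.re * fderiv ℝ F p v + ζ.im * fderiv ℝ F p (Complex.I • v) := by
    rw [e0]; simp
  have e3 : B (ζ • v) (ζ • v) = ζ.re ^ 2 * B v v + 2 * ζ.re * ζ.im * B v (Complex.I • v) +
      ζ.im ^ 2 * B (Complex.I • v) (Complex.I • v) := by
    rw [e0]
    simp [hsymm (Complex.I • v) v]
    ring
  have e4 : ‖ζ‖ ^ 2 = ζ.re ^ 2 + ζ.im ^ 2 := by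
    rw [← Complex.normSq_eq_norm_sq, Complex.normSq_apply]; ring
  rw [← hB, e2, e3] at h2
  have e5 : levi F p v = (B v v + B (Complex.I • v) (Complex.I • v)) / 4 := rfl
  rw [e4, e5] at h2 ⊢
  simp only [Complex.add_re, Complex.mul_re, pow_two, Complex.mul_im] at h2 ⊢
  linarith

end Calculus

/-! ### Smoothness of holomorphic functions of several variables. -/

section Osgood

open Set Filter Metric MeasureTheory

variable {E : Type*} [NormedAddCommGroup E] [NormedSpace ℂ E]

variable [FiniteDimensional ℂ E]

/-- Directional derivatives of holomorphic functions of several variables are holomorphic. -/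
theorem differentiableOn_fderiv_apply_complex {f : E → ℂ} {U : Set E} (hU : IsOpen U)
    (hf : DifferentiableOn ℂ f U) (v : E) : DifferentiableOn ℂ (fun z => fderiv ℂ f z v) U := by
  have : ProperSpace E := FiniteDimensional.proper ℂ E
  intro z₀ hz₀
  obtain ⟨ρ', hρ', hball'⟩ := Metric.isOpen_iff.1 hU z₀ hz₀
  -- Nested radii: centres z lie within ρ of z₀, the circles around them within 2ρ, and the Cauchy
  -- estimates use balls within 3ρ, all inside U.
  set ρ := ρ' / 4 with hρdef
  have hρ : 0 < ρ := by positivity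
  have hball : closedBall z₀ (3 * ρ) ⊆ U :=
    (closedBall_subset_ball (by rw [hρdef]; linarith)).trans hball'
  obtain ⟨B, hB⟩ := (isCompact_closedBall z₀ (3 * ρ)).exists_bound_of_continuousOn
    (hf.continuousOn.mono hball)
  set r := ρ / (‖v‖ + 1) with hr
  have hr0 : 0 < r := by positivity
  have hrv : r * ‖v‖ ≤ ρ := by
    rw [hr, div_mul_eq_mul_div, div_le_iff₀ (by positivity)]
    nlinarith [norm_nonneg v]
  have hmem : ∀ z ∈ ball z₀ ρ, ∀ ζ : ℂ, ‖ζ‖ ≤ r → z + ζ • v ∈ closedBall z₀ (2 * ρ) := by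
    intro z hz ζ hζ
    rw [mem_closedBall]
    have h1 : dist (z + ζ • v) z ≤ ρ := by
      rw [dist_self_add_left, norm_smul]
      exact (by gcongr : ‖ζ‖ * ‖v‖ ≤ r * ‖v‖).trans hrv
    have := dist_triangle (z + ζ • v) z z₀
    rw [mem_ball] at hz
    linarith
  have h23 : closedBall z₀ (2 * ρ) ⊆ closedBall z₀ (3 * ρ) := closedBall_subset_closedBall (by linarith)
  have hdf : ∀ y ∈ closedBall z₀ (2 * ρ), HasFDerivAt f (fderiv ℂ f y) y := fun y hy =>
    ((hf _ (hball (h23 hy))).differentiableAt (hU.mem_nhds (hball (h23 hy)))).hasFDerivAt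
  have hdb : ∀ y ∈ closedBall z₀ (2 * ρ), ‖fderiv ℂ f y‖ ≤ 2 * B / ρ := by
    intro y hy
    have hsub : closedBall y ρ ⊆ closedBall z₀ (3 * ρ) := by
      apply closedBall_subset_closedBall'
      rw [mem_closedBall] at hy
      linarith
    have hBsub : ball y ρ ⊆ closedBall z₀ (3 * ρ) := ball_subset_closedBall.trans hsub
    refine Complex.norm_fderiv_le_div_of_mapsTo_ball (hf.mono (hBsub.trans hball)) ?_ hρ
    intro z hz
    rw [mem_closedBall, dist_eq_norm]
    have h1 := hB z (hBsub hz)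
    have h2 := hB y (hsub (mem_closedBall_self hρ.le))
    linarith [norm_sub_le (f z) (f y)]
  -- The kernel of Cauchy's formula for the derivative of ζ ↦ f (z + ζ v) at 0. It does not depend
  -- on z, so the formula can be differentiated under the integral.
  set k : ℝ → ℂ := fun θ => (2 * Real.pi * Complex.I : ℂ)⁻¹ *
    (deriv (circleMap 0 r) θ * ((circleMap 0 r θ) ^ 2)⁻¹) with hk
  have hkc : Continuous k := by
    rw [hk]
    simp only [deriv_circleMap]
    have h0 : ∀ θ, (circleMap 0 r θ) ^ 2 ≠ 0 := fun θ => pow_ne_zero _ (circleMap_ne_center hr0.ne')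
    have := continuous_circleMap 0 r
    fun_prop (disch := assumption)
  have hcauchy : ∀ z ∈ ball z₀ ρ, fderiv ℂ f z v =
      ∫ θ in (0 : ℝ)..2 * Real.pi, k θ * f (z + circleMap 0 r θ • v) := by
    intro z hz
    have hline : Continuous fun ζ : ℂ => z + ζ • v := by fun_prop
    have hg : DifferentiableOn ℂ (fun ζ : ℂ => f (z + ζ • v)) ((fun ζ : ℂ => z + ζ • v) ⁻¹' U) :=
      hf.comp (by fun_prop) (fun _ h => h)
    have h1 := Complex.two_pi_I_inv_smul_circleIntegral_sub_sq_inv_smul_of_differentiable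
      (hU.preimage hline) (c := 0) (R := r) (fun ζ hζ => hball (h23 (hmem z hz ζ (by simpa using hζ))))
      hg (mem_ball_self hr0)
    have h2 : HasDerivAt (fun ζ : ℂ => f (z + ζ • v)) (fderiv ℂ f z v) 0 := by
      have h3 : HasDerivAt (fun ζ : ℂ => z + ζ • v) v 0 := by
        simpa using ((hasDerivAt_id (0 : ℂ)).smul_const v).const_add z
      have h4 : HasFDerivAt f (fderiv ℂ f z) (z + (0 : ℂ) • v) := by
        simpa using hdf _ (hmem z hz 0 (by simpa using hr0.le))
      exact h4.comp_hasDerivAt (0 : ℂ) h3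
    rw [h2.deriv] at h1
    rw [← h1, circleIntegral, smul_eq_mul, ← intervalIntegral.integral_const_mul]
    congr 1
    ext θ
    simp only [hk, smul_eq_mul, sub_zero]
    ring
  have hint : DifferentiableAt ℂ
      (fun z => ∫ θ in (0 : ℝ)..2 * Real.pi, k θ * f (z + circleMap 0 r θ • v)) z₀ := by
    have hcm := continuous_circleMap 0 r
    have hcn : ∀ θ, ‖circleMap 0 r θ‖ ≤ r := fun θ => by simp [abs_of_pos hr0]
    have hcont : ∀ z ∈ ball z₀ ρ, Continuous fun θ => k θ * f (z + circleMap 0 r θ • v) := by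
      intro z hz
      refine hkc.mul (hf.continuousOn.comp_continuous (by fun_prop) fun θ =>
        hball (h23 (hmem z hz _ (hcn θ))))
    borelize E
    refine (intervalIntegral.hasFDerivAt_integral_of_dominated_of_fderiv_le (𝕜 := ℂ)
      (F' := fun z θ => k θ • fderiv ℂ f (z + circleMap 0 r θ • v))
      (bound := fun θ => ‖k θ‖ * (2 * B / ρ)) (ball_mem_nhds z₀ hρ) ?_ ?_ ?_ ?_ ?_ ?_).differentiableAt
    · filter_upwards [ball_mem_nhds z₀ hρ] with z hz using (hcont z hz).aestronglyMeasurable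
    · exact (hcont z₀ (mem_ball_self hρ)).intervalIntegrable _ _
    · apply AEStronglyMeasurable.smul hkc.aestronglyMeasurable
      exact ((measurable_fderiv ℂ f).comp
        (by fun_prop : Measurable fun θ => z₀ + circleMap 0 r θ • v)).aestronglyMeasurable
    · refine Eventually.of_forall fun θ _ z hz => ?_
      rw [norm_smul]
      gcongr
      exact hdb _ (hmem z hz _ (hcn θ))
    · exact (by fun_prop : Continuous fun θ => ‖k θ‖ * (2 * B / ρ)).intervalIntegrable _ _
    · refine Eventually.of_forall fun θ _ z hz => ?_
      have := (hdf _ (hmem z hz _ (hcn θ))).comp z ((hasFDerivAt_id z).add_const (circleMap 0 r θ • v))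
      exact this.const_mul (k θ)
  refine (hint.congr_of_eventuallyEq ?_).differentiableWithinAt
  filter_upwards [ball_mem_nhds z₀ hρ] with z hz using hcauchy z hz

/-- Induction on the order of differentiability: directional derivatives are again holomorphic, and
in finite dimension they determine the regularity of the full derivative. -/
theorem contDiffOn_complex_of_differentiableOn {f : E → ℂ} {U : Set E} (hU : IsOpen U)
    (hf : DifferentiableOn ℂ f U) : ContDiffOn ℂ ∞ f U := by
  rw [contDiffOn_infty]
  intro n
  induction n generalizing f with
  | zero => exact contDiffOn_zero.2 hf.continuousOn
  | succ n ih =>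
    rw [Nat.cast_add, Nat.cast_one, contDiffOn_succ_iff_fderiv_of_isOpen hU]
    exact ⟨hf, by simp, contDiffOn_clm_apply.2 fun v => ih (differentiableOn_fderiv_apply_complex hU hf v)⟩

end Osgood

/-! ### From local to global sub-mean value inequalities on the unit disc. -/

section Subharmonic

open Set Filter Metric MeasureTheory

/-- The parametrization of the unit circle by `[0, 1]`. -/
noncomputable def unitExp (θ : ℝ) : ℂ := Complex.exp (2 * Real.pi * θ * Complex.I)

theorem continuous_unitExp : Continuous unitExp := by unfold unitExp; fun_prop

theorem unitExp_eq (θ : ℝ) : unitExp θ = Complex.exp ((2 * Real.pi * θ : ℝ) * Complex.I) := by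
  simp [unitExp]

theorem norm_unitExp (θ : ℝ) : ‖unitExp θ‖ = 1 := by
  rw [unitExp_eq, Complex.norm_exp_ofReal_mul_I]

theorem exists_unitExp_eq {z : ℂ} (hz : ‖z‖ = 1) : ∃ θ, unitExp θ = z := by
  refine ⟨z.arg / (2 * Real.pi), ?_⟩
  rw [unitExp_eq, mul_div_cancel₀ _ (by positivity)]
  have := Complex.norm_mul_exp_arg_mul_I z
  rwa [hz, Complex.ofReal_one, one_mul] at this

theorem integral_unitExp_pow {n : ℕ} (hn : n ≠ 0) :
    ∫ θ in Ioc (0 : ℝ) 1, unitExp θ ^ n = 0 := by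
  have hc : (2 * Real.pi * Complex.I * n : ℂ) ≠ 0 := by
    simp [hn, Real.pi_ne_zero, Complex.I_ne_zero]
  have h : ∀ θ : ℝ, unitExp θ ^ n = Complex.exp ((2 * Real.pi * Complex.I * n) * θ) := by
    intro θ
    rw [unitExp, ← Complex.exp_nat_mul]
    ring_nf
  simp only [h]
  rw [← intervalIntegral.integral_of_le zero_le_one, integral_exp_mul_complex hc]
  have : (2 * Real.pi * Complex.I * n * ((1 : ℝ) : ℂ) : ℂ) = n * (2 * Real.pi * Complex.I) := by
    push_cast; ring
  rw [this, Complex.exp_nat_mul_two_pi_mul_I]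
  simp

theorem integrable_unitExp_of_continuous {F : Type*} [NormedAddCommGroup F]
    {f : ℝ → F} (hf : Continuous f) : IntegrableOn f (Ioc (0 : ℝ) 1) :=
  (hf.continuousOn.integrableOn_Icc).mono_set Ioc_subset_Icc_self

theorem integral_eval_unitExp (p : Polynomial ℂ) :
    ∫ θ in Ioc (0 : ℝ) 1, p.eval (unitExp θ) = p.eval 0 := by
  have hc := continuous_unitExp
  induction p using Polynomial.induction_on' with
  | add p q hp hq =>
    simp only [Polynomial.eval_add]
    rw [integral_add, hp, hq] <;> exact integrable_unitExp_of_continuous (by fun_prop)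
  | monomial n a =>
    simp only [Polynomial.eval_monomial]
    rw [integral_const_mul]
    rcases eq_or_ne n 0 with rfl | hn
    · simp
    · rw [integral_unitExp_pow hn, zero_pow hn]

theorem integral_re_eval_unitExp (p : Polynomial ℂ) (z r : ℂ) :
    ∫ θ in Ioc (0 : ℝ) 1, (p.eval (z + r * unitExp θ)).re = (p.eval z).re := by
  have hc := continuous_unitExp
  have h := integral_eval_unitExp (p.comp (Polynomial.C z + Polynomial.C r * Polynomial.X))
  simp only [Polynomial.eval_comp, Polynomial.eval_add, Polynomial.eval_C, Polynomial.eval_mul,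
    Polynomial.eval_X, mul_zero, add_zero] at h
  rw [← h]
  exact integral_re (integrable_unitExp_of_continuous
    (f := fun θ => p.eval (z + r * unitExp θ)) (by fun_prop))

/-- Trigonometric polynomials are dense in the continuous functions on the circle. Each has the form
p + conj q there, with the same real part as p + q. The gain is that Re (p + q) extends harmonically
to the disc. -/
theorem exists_polynomial_re_near {g : ℂ → ℝ} (hg : Continuous g) {ε : ℝ} (hε : 0 < ε) :
    ∃ p : Polynomial ℂ, ∀ θ, |g (unitExp θ) - (p.eval (unitExp θ)).re| ≤ ε := by
  let f : C(AddCircle (1 : ℝ), ℂ) :=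
    ⟨fun x => (g (AddCircle.toCircle x : ℂ) : ℂ), by
      have := AddCircle.continuous_toCircle (T := 1)
      fun_prop⟩
  have hmem : f ∈ (Submodule.span ℂ (range (fourier (T := (1 : ℝ))))).topologicalClosure := by
    rw [span_fourier_closure_eq_top]; trivial
  rw [← SetLike.mem_coe, Submodule.topologicalClosure_coe, Metric.mem_closure_iff] at hmem
  obtain ⟨h, hh, hdist⟩ := hmem ε hε
  have key : ∃ p q : Polynomial ℂ, ∀ θ : ℝ, h (θ : AddCircle (1 : ℝ)) =
      p.eval (unitExp θ) + (starRingEnd ℂ) (q.eval (unitExp θ)) := by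
    refine Submodule.span_induction (p := fun h _ => ∃ p q : Polynomial ℂ, ∀ θ : ℝ,
      h (θ : AddCircle (1 : ℝ)) = p.eval (unitExp θ) + (starRingEnd ℂ) (q.eval (unitExp θ)))
      ?_ ?_ ?_ ?_ hh
    · rintro _ ⟨n, rfl⟩
      have e : ∀ (m : ℕ) (θ : ℝ), fourier (m : ℤ) (θ : AddCircle (1 : ℝ)) = unitExp θ ^ m := by
        intro m θ
        rw [fourier_coe_apply, unitExp, ← Complex.exp_nat_mul]
        congr 1
        push_cast
        ring
      obtain ⟨m, rfl | rfl⟩ := n.eq_nat_or_neg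
      · exact ⟨Polynomial.X ^ m, 0, fun θ => by simp only [e]; simp⟩
      · refine ⟨0, Polynomial.X ^ m, fun θ => ?_⟩
        rw [fourier_neg, e]
        simp
    · exact ⟨0, 0, by simp⟩
    · rintro x y - - ⟨p, q, h1⟩ ⟨p', q', h2⟩
      refine ⟨p + p', q + q', fun θ => ?_⟩
      simp [h1, h2]
      ring
    · rintro a x - ⟨p, q, h1⟩
      refine ⟨Polynomial.C a * p, Polynomial.C ((starRingEnd ℂ) a) * q, fun θ => ?_⟩
      simp [h1]
      ring
  obtain ⟨p, q, hpq⟩ := key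
  refine ⟨p + q, fun θ => ?_⟩
  have h1 : dist (f (θ : AddCircle (1 : ℝ))) (h (θ : AddCircle (1 : ℝ))) ≤ ε :=
    (ContinuousMap.dist_apply_le_dist _).trans hdist.le
  have h2 : f (θ : AddCircle (1 : ℝ)) = (g (unitExp θ) : ℂ) := by
    simp only [f, ContinuousMap.coe_mk, AddCircle.toCircle_apply_mk, Circle.coe_exp, unitExp_eq]
    norm_num
  rw [h2, hpq, dist_eq_norm] at h1
  refine le_trans (le_of_eq ?_) ((Complex.abs_re_le_norm _).trans h1)
  simp

/-- A bounded upper semicontinuous function on the unit circle is approximated from above by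
continuous functions, in mean. -/
theorem exists_continuous_ge_integral_le {u : ℂ → ℝ}
    (hu : UpperSemicontinuousOn u (sphere 0 1)) {m M : ℝ} (hm : ∀ z ∈ sphere (0 : ℂ) 1, m ≤ u z)
    (hM : ∀ z ∈ sphere (0 : ℂ) 1, u z ≤ M) {ε : ℝ} (hε : 0 < ε) :
    ∃ g : ℂ → ℝ, Continuous g ∧ (∀ z ∈ sphere (0 : ℂ) 1, u z ≤ g z) ∧
      ∫ θ in Ioc (0 : ℝ) 1, g (unitExp θ) ≤ (∫ θ in Ioc (0 : ℝ) 1, u (unitExp θ)) + ε := by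
  have hne : Nonempty (sphere (0 : ℂ) 1) := ⟨⟨1, by simp⟩⟩
  -- Sup-convolution: f n is n-Lipschitz, lies above u on the circle, and converges there pointwise
  -- to u by upper semicontinuity.
  let f : ℕ → ℂ → ℝ := fun n x => ⨆ y : sphere (0 : ℂ) 1, (u y - n * dist x y)
  have hbdd : ∀ (n : ℕ) (x : ℂ), BddAbove (range fun y : sphere (0 : ℂ) 1 => u y - n * dist x y) := by
    intro n x
    refine ⟨M, ?_⟩
    rintro _ ⟨y, rfl⟩
    have := hM y y.2
    have : 0 ≤ (n : ℝ) * dist x y := by positivity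
    dsimp only
    linarith
  have hfM : ∀ n x, f n x ≤ M := fun n x => ciSup_le fun y => by
    have := hM y y.2
    have : 0 ≤ (n : ℝ) * dist x y := by positivity
    linarith
  have hle : ∀ n, ∀ z ∈ sphere (0 : ℂ) 1, u z ≤ f n z := by
    intro n z hz
    have := le_ciSup (hbdd n z) ⟨z, hz⟩
    simpa using this
  have hcont : ∀ n, Continuous (f n) := by
    intro n
    refine (LipschitzWith.of_le_add_mul (n : NNReal) fun x y => ciSup_le fun w => ?_).continuous
    have h1 := le_ciSup (hbdd n y) w
    have h2 := dist_triangle y x w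
    rw [dist_comm y x] at h2
    have h3 := mul_le_mul_of_nonneg_left h2 (Nat.cast_nonneg (α := ℝ) n)
    have h4 : u w - n * dist y w ≤ f n y := h1
    simp only [NNReal.coe_natCast]
    linarith
  have hlim : ∀ z ∈ sphere (0 : ℂ) 1, Tendsto (fun n => f n z) atTop (𝓝 (u z)) := by
    intro z hz
    refine tendsto_order.2 ⟨fun a ha => Eventually.of_forall fun n => ha.trans_le (hle n z hz), ?_⟩
    intro a ha
    obtain ⟨b, hb1, hb2⟩ := exists_between ha
    obtain ⟨δ, hδ, hδb⟩ := Metric.mem_nhdsWithin_iff.1 (hu z hz b hb1)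
    obtain ⟨N, hN⟩ := exists_nat_gt ((M - b) / δ)
    filter_upwards [eventually_ge_atTop N] with n hn
    refine (ciSup_le fun y => ?_).trans_lt hb2
    by_cases hy : dist (y : ℂ) z < δ
    · have h1 : u y < b := hδb ⟨hy, y.2⟩
      have : 0 ≤ (n : ℝ) * dist z y := by positivity
      linarith
    · rw [not_lt, dist_comm] at hy
      have h1 := hM y y.2
      have h2 : (M - b) < n * δ := by
        rw [div_lt_iff₀ hδ] at hN
        have : (N : ℝ) ≤ n := by exact_mod_cast hn
        nlinarith
      have h3 : (n : ℝ) * δ ≤ n * dist z y := by gcongr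
      linarith
  have hlimint : Tendsto (fun n => ∫ θ in Ioc (0 : ℝ) 1, f n (unitExp θ)) atTop
      (𝓝 (∫ θ in Ioc (0 : ℝ) 1, u (unitExp θ))) := by
    refine tendsto_integral_of_dominated_convergence (fun _ => |m| + |M|) ?_ ?_ ?_ ?_
    · exact fun n => ((hcont n).comp continuous_unitExp).aestronglyMeasurable
    · exact integrable_unitExp_of_continuous continuous_const
    · refine fun n => Eventually.of_forall fun θ => ?_
      have hs : unitExp θ ∈ sphere (0 : ℂ) 1 := by simp [norm_unitExp]
      have h1 := hle n _ hs
      have h2 := hm _ hs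
      have h3 := hfM n (unitExp θ)
      rw [Real.norm_eq_abs, abs_le]
      constructor
      · linarith [neg_abs_le m, abs_nonneg M]
      · linarith [le_abs_self M, abs_nonneg m]
    · exact Eventually.of_forall fun θ => hlim _ (by simp [norm_unitExp])
  obtain ⟨n, hn⟩ := (hlimint.eventually (gt_mem_nhds (lt_add_of_pos_right _ hε))).exists
  exact ⟨f n, hcont n, hle n, hn.le⟩

theorem UpperSemicontinuousOn.integrableOn_comp {X : Type*} [TopologicalSpace X] {u : X → ℝ}
    {s : Set X} (hu : UpperSemicontinuousOn u s) {m M : ℝ} (hm : ∀ z ∈ s, m ≤ u z)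
    (hM : ∀ z ∈ s, u z ≤ M) {c : ℝ → X} (hc : Continuous c) (hcs : ∀ θ, c θ ∈ s) :
    IntegrableOn (fun θ => u (c θ)) (Ioc (0 : ℝ) 1) := by
  have husc : UpperSemicontinuous fun θ => u (c θ) := by
    rw [← upperSemicontinuousOn_univ_iff]
    exact hu.comp hc.continuousOn fun θ _ => hcs θ
  refine Measure.integrableOn_of_bounded (M := |m| + |M|) (by simp) husc.measurable.aestronglyMeasurable ?_
  refine Eventually.of_forall fun θ => ?_
  have h1 := hm _ (hcs θ)
  have h2 := hM _ (hcs θ)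
  rw [Real.norm_eq_abs, abs_le]
  constructor
  · linarith [neg_abs_le m, abs_nonneg M]
  · linarith [le_abs_self M, abs_nonneg m]

/-- A bounded upper semicontinuous function on the closed unit disc that is strictly below its mean
over some circle around each interior point satisfies the sub-mean value inequality on the disc. -/
theorem le_integral_unitExp_of_local {u : ℂ → ℝ} (hu : UpperSemicontinuousOn u (closedBall 0 1))
    {m : ℝ} (hm : ∀ z ∈ closedBall (0 : ℂ) 1, m ≤ u z)
    (hloc : ∀ ζ : ℂ, ‖ζ‖ < 1 → ∃ r : ℝ, 0 < r ∧ ‖ζ‖ + r ≤ 1 ∧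
      u ζ < ∫ θ in Ioc (0 : ℝ) 1, u (ζ + r * unitExp θ)) :
    u 0 ≤ ∫ θ in Ioc (0 : ℝ) 1, u (unitExp θ) := by
  have hexp := continuous_unitExp
  obtain ⟨M, hM⟩ := hu.bddAbove_of_isCompact (isCompact_closedBall 0 1)
  replace hM : ∀ z ∈ closedBall (0 : ℂ) 1, u z ≤ M := fun z hz => hM ⟨z, hz, rfl⟩
  refine le_of_forall_pos_le_add fun ε hε => ?_
  obtain ⟨g, hgc, hug, hgi⟩ := exists_continuous_ge_integral_le
    (hu.mono sphere_subset_closedBall) (fun z hz => hm z (sphere_subset_closedBall hz))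
    (fun z hz => hM z (sphere_subset_closedBall hz)) (ε := ε / 3) (by positivity)
  obtain ⟨p, hp⟩ := exists_polynomial_re_near hgc (ε := ε / 3) (by positivity)
  have hpc : Continuous fun z => (p.eval z).re := by fun_prop
  -- Subtracting a harmonic function preserves the strict local inequality, so v has no interior
  -- maximum point. On the circle v ≤ ε/3; the other two thirds of ε go into comparing Re p with g
  -- and g with u in mean.
  set v : ℂ → ℝ := fun z => u z + -(p.eval z).re with hv
  have hvu : UpperSemicontinuousOn v (closedBall 0 1) :=
    hu.add (hpc.neg.upperSemicontinuous.upperSemicontinuousOn _)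
  obtain ⟨z₀, hz₀, hmax⟩ := hvu.exists_isMaxOn (nonempty_closedBall.2 zero_le_one)
    (isCompact_closedBall 0 1)
  have hz1 : ‖z₀‖ = 1 := by
    refine le_antisymm (by simpa using hz₀) (not_lt.1 fun hlt => ?_)
    obtain ⟨r, hr0, hr1, hr⟩ := hloc z₀ hlt
    have hmem : ∀ θ, z₀ + r * unitExp θ ∈ closedBall (0 : ℂ) 1 := by
      intro θ
      rw [mem_closedBall_zero_iff]
      refine (norm_add_le _ _).trans ?_
      rw [norm_mul, norm_unitExp, Complex.norm_real, Real.norm_of_nonneg hr0.le, mul_one]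
      exact hr1
    have hi1 : IntegrableOn (fun θ => u (z₀ + r * unitExp θ)) (Ioc (0 : ℝ) 1) :=
      hu.integrableOn_comp hm hM (by fun_prop) hmem
    have hi2 : IntegrableOn (fun θ => -(p.eval (z₀ + r * unitExp θ)).re) (Ioc (0 : ℝ) 1) :=
      integrable_unitExp_of_continuous (by fun_prop)
    have h1 : v z₀ < ∫ θ in Ioc (0 : ℝ) 1, v (z₀ + r * unitExp θ) := by
      simp only [hv]
      rw [integral_add hi1 hi2, integral_neg, integral_re_eval_unitExp]
      linarith
    have h2 : ∫ θ in Ioc (0 : ℝ) 1, v (z₀ + r * unitExp θ) ≤ ∫ θ in Ioc (0 : ℝ) 1, v z₀ :=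
      integral_mono (hi1.add hi2) (integrable_unitExp_of_continuous continuous_const)
        fun θ => hmax (hmem θ)
    simp only [integral_const, measureReal_restrict_apply_univ, Real.volume_real_Ioc, smul_eq_mul] at h2
    norm_num at h2
    linarith
  obtain ⟨θ₀, rfl⟩ := exists_unitExp_eq hz1
  have h0 : v 0 ≤ v (unitExp θ₀) := hmax (mem_closedBall_self zero_le_one)
  have h1 := hug (unitExp θ₀) (by simp [norm_unitExp])
  have h2 := (abs_le.1 (hp θ₀)).2
  have h3 : (p.eval 0).re ≤ (∫ θ in Ioc (0 : ℝ) 1, g (unitExp θ)) + ε / 3 := by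
    have e := integral_re_eval_unitExp p 0 1
    simp only [zero_add, one_mul] at e
    have hgi' : IntegrableOn (fun θ => g (unitExp θ)) (Ioc (0 : ℝ) 1) :=
      integrable_unitExp_of_continuous (by fun_prop)
    have hci : IntegrableOn (fun _ => ε / 3) (Ioc (0 : ℝ) 1) :=
      integrable_unitExp_of_continuous continuous_const
    have : ∫ θ in Ioc (0 : ℝ) 1, (p.eval (unitExp θ)).re ≤
        ∫ θ in Ioc (0 : ℝ) 1, (g (unitExp θ) + ε / 3) :=
      integral_mono (integrable_unitExp_of_continuous (by fun_prop)) (hgi'.add hci)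
        fun θ => by have := (abs_le.1 (hp θ)).1; dsimp only; linarith
    rw [integral_add hgi' hci, e] at this
    simpa using this
  simp only [hv] at h0
  linarith

end Subharmonic

/-! ### Circle means of extended-real functions and support from below. -/

section CircleMean

open Set Filter Metric MeasureTheory

variable {E : Type*} [NormedAddCommGroup E] [NormedSpace ℂ E]

theorem circleMean_eq (u : E → EReal) (a b : E) : circleMean u a b =
    ((∫⁻ θ in Ioc (0 : ℝ) 1, (u (a + unitExp θ • b)).toENNReal : ℝ≥0∞) : EReal) -
      ((∫⁻ θ in Ioc (0 : ℝ) 1, (-u (a + unitExp θ • b)).toENNReal : ℝ≥0∞) : EReal) := rfl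

theorem circleMean_coe {u : E → ℝ} {a b : E}
    (hu : IntegrableOn (fun θ => u (a + unitExp θ • b)) (Ioc (0 : ℝ) 1)) :
    circleMean (fun z => (u z : EReal)) a b =
      ((∫ θ in Ioc (0 : ℝ) 1, u (a + unitExp θ • b) : ℝ) : EReal) := by
  have h1 := hu.lintegral_lt_top
  have h2 := hu.neg.lintegral_lt_top
  simp only [Pi.neg_apply] at h2
  rw [circleMean_eq, integral_eq_lintegral_pos_part_sub_lintegral_neg_part hu]
  simp only [← EReal.coe_neg, EReal.real_coe_toENNReal]
  rw [EReal.coe_sub, EReal.coe_ennreal_toReal h1.ne, EReal.coe_ennreal_toReal h2.ne]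

/-- The sub-mean value inequality at a point where the function is finite, in terms of real
integrals. -/
theorem toReal_le_integral_of_le_circleMean {f : E → EReal} {a b : E} {M : ℝ}
    (hmeas : Measurable fun θ => f (a + unitExp θ • b))
    (hM : ∀ θ, f (a + unitExp θ • b) ≤ M) (ha : f a ≠ ⊥) (h : f a ≤ circleMean f a b) :
    (∀ᵐ θ ∂(volume.restrict (Ioc (0 : ℝ) 1)), f (a + unitExp θ • b) ≠ ⊥) ∧
    IntegrableOn (fun θ => (f (a + unitExp θ • b)).toReal) (Ioc (0 : ℝ) 1) ∧
    (f a).toReal ≤ ∫ θ in Ioc (0 : ℝ) 1, (f (a + unitExp θ • b)).toReal := by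
  set g : ℝ → EReal := fun θ => f (a + unitExp θ • b)
  have hg_top : ∀ θ, g θ ≠ ⊤ := fun θ => ((hM θ).trans_lt (EReal.coe_lt_top M)).ne
  rw [circleMean_eq] at h
  set P := ∫⁻ θ in Ioc (0 : ℝ) 1, (g θ).toENNReal
  set N := ∫⁻ θ in Ioc (0 : ℝ) 1, (-g θ).toENNReal
  have hP : P ≠ ⊤ := by
    refine ne_top_of_le_ne_top (b := ENNReal.ofReal M) ENNReal.ofReal_ne_top ?_
    calc P ≤ ∫⁻ θ in Ioc (0 : ℝ) 1, ENNReal.ofReal M :=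
          lintegral_mono fun θ => by
            simpa using EReal.toENNReal_le_toENNReal (hM θ)
      _ = ENNReal.ofReal M := by simp
  -- An infinite negative part would make the mean -∞, which the finite value at the centre
  -- excludes.
  have hN : N ≠ ⊤ := by
    intro hN
    rw [hN, EReal.coe_ennreal_top, EReal.sub_top, le_bot_iff] at h
    exact ha h
  have hae : ∀ᵐ θ ∂(volume.restrict (Ioc (0 : ℝ) 1)), g θ ≠ ⊥ := by
    have := ae_lt_top (hmeas.neg.ereal_toENNReal) hN
    filter_upwards [this] with θ hθ hbot
    simp [hbot] at hθ
  have e1 : ∫⁻ θ in Ioc (0 : ℝ) 1, ENNReal.ofReal (g θ).toReal = P :=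
    lintegral_congr fun θ => (EReal.toENNReal_of_ne_top (hg_top θ)).symm
  have e2 : ∫⁻ θ in Ioc (0 : ℝ) 1, ENNReal.ofReal (-(g θ).toReal) = N := by
    refine lintegral_congr_ae ?_
    filter_upwards [hae] with θ hθ
    rw [EReal.toENNReal_of_ne_top (by simpa [EReal.neg_eq_top_iff] using hθ), EReal.toReal_neg_eq]
  have hint : IntegrableOn (fun θ => (g θ).toReal) (Ioc (0 : ℝ) 1) := by
    refine ⟨hmeas.ereal_toReal.aestronglyMeasurable, ?_⟩
    rw [hasFiniteIntegral_iff_norm]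
    have hb : ∀ x : ℝ, ENNReal.ofReal ‖x‖ ≤ ENNReal.ofReal x + ENNReal.ofReal (-x) := by
      intro x
      rcases le_total 0 x with hx | hx
      · rw [Real.norm_of_nonneg hx]; exact le_self_add
      · rw [Real.norm_of_nonpos hx]; exact le_add_self
    refine (lintegral_mono fun θ => hb _).trans_lt ?_
    rw [lintegral_add_left (hmeas.ereal_toReal.ennreal_ofReal), e1, e2]
    exact ENNReal.add_lt_top.2 ⟨hP.lt_top, hN.lt_top⟩
  refine ⟨hae, hint, ?_⟩
  rw [integral_eq_lintegral_pos_part_sub_lintegral_neg_part hint, e1, e2]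
  rw [← EReal.coe_ennreal_toReal hP, ← EReal.coe_ennreal_toReal hN, ← EReal.coe_sub] at h
  have ha' : f a ≠ ⊤ := (h.trans_lt (EReal.coe_lt_top _)).ne
  rwa [← EReal.coe_toReal ha' ha, EReal.coe_le_coe_iff] at h

theorem norm_mul_unitExp {r : ℝ} (hr : 0 ≤ r) (θ : ℝ) : ‖(r * unitExp θ : ℂ)‖ = r := by
  rw [norm_mul, norm_unitExp, Complex.norm_real, Real.norm_of_nonneg hr, mul_one]

/-- Strict sub-mean value inequality at `a`, on small circles, for a function that lies above the
sum of a function with positive Levi form and of functions satisfying the sub-mean value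
inequality, with equality at `a`. -/
theorem eventually_lt_integral_of_support {ι : Type*} (J : Finset ι) {u S : E → ℝ}
    {f : ι → E → EReal} {κ M : ι → ℝ} {a b : E} {O : Set E} (hO : O ∈ 𝓝 a)
    (hu : UpperSemicontinuousOn u O) {m : ℝ} (hm : ∀ z ∈ O, m ≤ u z)
    (hS : ContDiffAt ℝ 2 S a) (hSb : 0 < levi S a b) (hκ : ∀ j ∈ J, 0 ≤ κ j)
    (hf : ∀ j ∈ J, UpperSemicontinuousOn (f j) O) (hfM : ∀ j ∈ J, ∀ z ∈ O, f j z ≤ M j)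
    (hfa : ∀ j ∈ J, f j a ≠ ⊥)
    (hfmean : ∀ j ∈ J, ∀ᶠ r : ℝ in 𝓝[>] 0, f j a ≤ circleMean (f j) a ((r : ℂ) • b))
    (hle : ∀ z ∈ O, (∀ j ∈ J, f j z ≠ ⊥) → S z + ∑ j ∈ J, κ j * (f j z).toReal ≤ u z)
    (heq : u a = S a + ∑ j ∈ J, κ j * (f j a).toReal) :
    ∀ᶠ r : ℝ in 𝓝[>] 0, u a < ∫ θ in Ioc (0 : ℝ) 1, u (a + (r * unitExp θ : ℂ) • b) := by
  have hexp := continuous_unitExp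
  obtain ⟨α, β, c, hc, hT⟩ := eventually_re_add_le_of_levi_pos hS hSb
  obtain ⟨M', hM'⟩ : ∃ M', ∀ᶠ z in 𝓝 a, u z ≤ M' := by
    refine ⟨u a + 1, ?_⟩
    have h1 := hu a (mem_of_mem_nhds hO) (u a + 1) (by linarith)
    rw [nhdsWithin_eq_nhds.2 hO] at h1
    exact h1.mono fun _ h => h.le
  have hline : Tendsto (fun ζ : ℂ => a + ζ • b) (𝓝 0) (𝓝 a) := by
    have : Continuous fun ζ : ℂ => a + ζ • b := by fun_prop
    simpa using this.tendsto 0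
  obtain ⟨δ, hδ, hball⟩ := Metric.eventually_nhds_iff_ball.1
    (hT.and ((hline.eventually hO).and (hline.eventually hM')))
  have hfmean' := (Finset.eventually_all J).2 hfmean
  filter_upwards [self_mem_nhdsWithin, hfmean', mem_nhdsWithin_of_mem_nhds (Iio_mem_nhds hδ)]
    with r hr0 hr hrδ
  replace hr0 : 0 < r := hr0
  have hmemball : ∀ θ, (r * unitExp θ : ℂ) ∈ ball (0 : ℂ) δ := fun θ => by
    rw [mem_ball_zero_iff, norm_mul_unitExp hr0.le]; exact hrδ
  have hcont : Continuous fun θ => a + (r * unitExp θ : ℂ) • b := by fun_prop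
  have hmemO : ∀ θ, a + (r * unitExp θ : ℂ) • b ∈ O := fun θ => (hball _ (hmemball θ)).2.1
  have hsm : ∀ θ, unitExp θ • ((r : ℂ) • b) = (r * unitExp θ : ℂ) • b := fun θ => by
    rw [smul_smul, mul_comm]
  have key : ∀ j ∈ J, _ := fun j hj => toReal_le_integral_of_le_circleMean (f := f j) (a := a)
    (b := (r : ℂ) • b) (M := M j) (by
      have : UpperSemicontinuous fun θ => f j (a + unitExp θ • ((r : ℂ) • b)) := by
        rw [← upperSemicontinuousOn_univ_iff]
        simp only [hsm]
        exact (hf j hj).comp hcont.continuousOn fun θ _ => hmemO θ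
      exact this.measurable)
    (fun θ => by rw [hsm]; exact hfM j hj _ (hmemO θ)) (hfa j hj) (hr j hj)
  simp only [hsm] at key
  have hui : IntegrableOn (fun θ => u (a + (r * unitExp θ : ℂ) • b)) (Ioc (0 : ℝ) 1) := by
    have := (hu.mono (inter_subset_left (t := {z | u z ≤ M'}))).integrableOn_comp
      (fun z hz => hm z hz.1) (fun z hz => hz.2) hcont
      fun θ => ⟨hmemO θ, (hball _ (hmemball θ)).2.2⟩
    exact this
  -- The real part of q has mean zero on circles around 0, so of the lower bound for S only S a + c
  -- r² survives; c r² is the source of strictness.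
  let q : Polynomial ℂ := Polynomial.C α * Polynomial.X + Polynomial.C β * Polynomial.X ^ 2
  have hq : ∫ θ in Ioc (0 : ℝ) 1, (q.eval (r * unitExp θ)).re = 0 := by
    have := integral_re_eval_unitExp q 0 r
    simpa [q] using this
  have hqc : Continuous fun z => (q.eval z).re := by fun_prop
  have hqi : IntegrableOn (fun θ => (q.eval (r * unitExp θ)).re) (Ioc (0 : ℝ) 1) :=
    integrable_unitExp_of_continuous (by fun_prop)
  have hsi : IntegrableOn (fun θ => ∑ j ∈ J, κ j * (f j (a + (r * unitExp θ : ℂ) • b)).toReal)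
      (Ioc (0 : ℝ) 1) :=
    integrable_finsetSum _ fun j hj => (key j hj).2.1.const_mul _
  have hci : IntegrableOn (fun _ => S a + c * r ^ 2) (Ioc (0 : ℝ) 1) :=
    integrable_unitExp_of_continuous continuous_const
  have hmono : ∫ θ in Ioc (0 : ℝ) 1, ((S a + c * r ^ 2) + (q.eval (r * unitExp θ)).re +
      ∑ j ∈ J, κ j * (f j (a + (r * unitExp θ : ℂ) • b)).toReal) ≤
      ∫ θ in Ioc (0 : ℝ) 1, u (a + (r * unitExp θ : ℂ) • b) := by
    refine integral_mono_ae ((hci.add hqi).add hsi) hui ?_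
    -- The support inequality is available only where every `f j` is finite, which is almost
    -- everywhere on the circle.
    have hall := (ae_ball_iff J.countable_toSet).2 fun j hj => (key j hj).1
    filter_upwards [hall] with θ hθ
    have h1 := hle _ (hmemO θ) hθ
    have h2 := (hball _ (hmemball θ)).1
    rw [norm_mul_unitExp hr0.le] at h2
    simp only [q, Polynomial.eval_add, Polynomial.eval_mul, Polynomial.eval_C, Polynomial.eval_X,
      Polynomial.eval_pow]
    linarith
  have e1 := integral_add (hci.add hqi) hsi
  have e2 := integral_add hci hqi
  have e3 := integral_finsetSum (μ := volume.restrict (Ioc (0 : ℝ) 1)) J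
    (f := fun j θ => κ j * (f j (a + (r * unitExp θ : ℂ) • b)).toReal)
    fun j hj => (key j hj).2.1.const_mul _
  simp only [Pi.add_apply, integral_const_mul] at e1 e2 e3
  rw [e1, e2, e3, hq] at hmono
  simp only [integral_const, measureReal_restrict_apply_univ, Real.volume_real_Ioc, smul_eq_mul]
    at hmono
  norm_num at hmono
  have h4 : ∑ j ∈ J, κ j * (f j a).toReal ≤ ∑ j ∈ J, κ j * ∫ θ in Ioc (0 : ℝ) 1,
      (f j (a + (r * unitExp θ : ℂ) • b)).toReal :=
    Finset.sum_le_sum fun j hj => mul_le_mul_of_nonneg_left (key j hj).2.2 (hκ j hj)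
  have h5 : 0 < c * r ^ 2 := by positivity
  linarith

end CircleMean

/-! ### Levi forms, differentials and curve velocities under change of charts. -/

section Charts

open Set Filter

theorem eventuallyEq_transition {E M F : Type*} [TopologicalSpace E] [TopologicalSpace M] (f : M → F) {c c' : OpenPartialHomeomorph M E} {x : M}
    (hx : x ∈ c.source) (hx' : x ∈ c'.source) :
    (fun z => f (c.symm z)) =ᶠ[𝓝 (c x)] fun z => f (c'.symm (c' (c.symm z))) := by
  have h1 : ContinuousAt c.symm (c x) := c.continuousAt_symm (c.map_source hx)
  have h2 : ∀ᶠ y in 𝓝 (c.symm (c x)), y ∈ c'.source := by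
    rw [c.left_inv hx]; exact c'.open_source.mem_nhds hx'
  filter_upwards [h1.eventually h2] with z hz
  rw [c'.left_inv hz]

variable {E : Type*} [NormedAddCommGroup E] [NormedSpace ℂ E]
  {M : Type*} [TopologicalSpace M] [ChartedSpace E M]

/-- The differential of a real function at `x`, in the chart at `x`. -/
noncomputable def dform (f : M → ℝ) (x : M) (v : E) : ℝ :=
  fderiv ℝ (fun z => f ((chartAt E x).symm z)) (chartAt E x x) v

/-- The coordinates, in the chart at `p`, of a tangent vector at `x`. -/
noncomputable def tcoord (p x : M) (v : E) : E :=
  fderiv ℂ (fun z => chartAt E p ((chartAt E x).symm z)) (chartAt E x x) v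

section Curves

variable {γ : ℝ → M} {t : ℝ}

theorem mfderiv_curve (hγ : MDifferentiableAt 𝓘(ℝ, ℝ) 𝓘(ℝ, E) γ t) :
    (mfderiv 𝓘(ℝ, ℝ) 𝓘(ℝ, E) γ t (1 : ℝ) : E) = deriv (fun s => chartAt E (γ t) (γ s)) t := by
  rw [hγ.mfderiv]
  simp only [mfld_simps, fderivWithin_univ]
  rfl

theorem differentiableAt_chart_comp_curve (hγ : MDifferentiableAt 𝓘(ℝ, ℝ) 𝓘(ℝ, E) γ t) :
    DifferentiableAt ℝ (fun s => chartAt E (γ t) (γ s)) t := by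
  have := hγ.differentiableWithinAt_writtenInExtChartAt
  simp only [mfld_simps, differentiableWithinAt_univ, writtenInExtChartAt, Function.comp_def,
    chartAt_self_eq] at this
  exact this

theorem deriv_comp_curve {F : Type*} [NormedAddCommGroup F] [NormedSpace ℝ F] {f : M → F}
    (hγ : MDifferentiableAt 𝓘(ℝ, ℝ) 𝓘(ℝ, E) γ t)
    (hf : DifferentiableAt ℝ (fun z => f ((chartAt E (γ t)).symm z)) (chartAt E (γ t) (γ t))) :
    HasDerivAt (fun s => f (γ s)) (fderiv ℝ (fun z => f ((chartAt E (γ t)).symm z))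
      (chartAt E (γ t) (γ t)) (mfderiv 𝓘(ℝ, ℝ) 𝓘(ℝ, E) γ t (1 : ℝ) : E)) t := by
  rw [mfderiv_curve hγ]
  have h1 := (differentiableAt_chart_comp_curve hγ).hasDerivAt
  have h2 := hf.hasFDerivAt.comp_hasDerivAt t h1
  refine h2.congr_of_eventuallyEq ?_
  filter_upwards [hγ.continuousAt.eventually ((chartAt E (γ t)).open_source.mem_nhds
    (mem_chart_source E (γ t)))] with s hs
  simp [(chartAt E (γ t)).left_inv hs]

end Curves

variable [IsManifold 𝓘(ℂ, E) ω M]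

theorem contDiffAt_transition {c c' : OpenPartialHomeomorph M E} (hc : c ∈ atlas E M)
    (hc' : c' ∈ atlas E M) {x : M} (hx : x ∈ c.source) (hx' : x ∈ c'.source) :
    ContDiffAt ℂ ω (fun z => c' (c.symm z)) (c x) := by
  rw [← contMDiffAt_iff_contDiffAt]
  have h1 := contMDiffAt_symm_of_mem_maximalAtlas (I := 𝓘(ℂ, E)) (n := ω)
    (IsManifold.subset_maximalAtlas hc) (c.map_source hx)
  have h2 := contMDiffAt_of_mem_maximalAtlas (I := 𝓘(ℂ, E)) (n := ω)
    (IsManifold.subset_maximalAtlas hc') hx'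
  rw [← c.left_inv hx] at h2
  exact h2.comp (c x) h1

variable (E M) in
theorem isManifold_real : IsManifold 𝓘(ℝ, E) ∞ M := by
  refine isManifold_of_contDiffOn _ _ _ fun c c' hc hc' z hz => ?_
  simp only [mfld_simps] at hz
  have h := contDiffAt_transition hc hc' (c.map_target hz.1) hz.2
  rw [c.right_inv hz.1] at h
  exact ((h.restrict_scalars ℝ).of_le le_top).contDiffWithinAt

theorem ContMDiffAt.contDiffAt_chart {F : Type*} [NormedAddCommGroup F] [NormedSpace ℝ F]
    {f : M → F} {n : ℕ∞ω} (hn : n ≤ (∞ : ℕ∞ω)) {x : M} (hf : ContMDiffAt 𝓘(ℝ, E) 𝓘(ℝ, F) n f x)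
    {c : OpenPartialHomeomorph M E} (hc : c ∈ atlas E M) (hx : x ∈ c.source) :
    ContDiffAt ℝ n (fun z => f (c.symm z)) (c x) := by
  have := isManifold_real E M
  rw [← contMDiffAt_iff_contDiffAt]
  have h1 := (contMDiffAt_symm_of_mem_maximalAtlas (I := 𝓘(ℝ, E)) (n := ∞)
    (IsManifold.subset_maximalAtlas hc) (c.map_source hx)).of_le hn
  rw [← c.left_inv hx] at hf
  exact hf.comp (c x) h1

theorem contMDiffAt_of_contDiffAt_chart {F : Type*} [NormedAddCommGroup F] [NormedSpace ℝ F]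
    {f : M → F} {n : ℕ∞ω} (hn : n ≤ (∞ : ℕ∞ω)) {x : M}
    {c : OpenPartialHomeomorph M E} (hc : c ∈ atlas E M) (hx : x ∈ c.source)
    (hf : ContDiffAt ℝ n (fun z => f (c.symm z)) (c x)) :
    ContMDiffAt 𝓘(ℝ, E) 𝓘(ℝ, F) n f x := by
  have := isManifold_real E M
  have h1 := (contMDiffAt_of_mem_maximalAtlas (I := 𝓘(ℝ, E)) (n := ∞)
    (IsManifold.subset_maximalAtlas hc) hx).of_le hn
  refine (hf.contMDiffAt.comp x h1).congr_of_eventuallyEq ?_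
  filter_upwards [c.open_source.mem_nhds hx] with y hy
  simp [c.left_inv hy]

theorem levi_transition {f : M → ℝ} {x : M} (hf : ContMDiffAt 𝓘(ℝ, E) 𝓘(ℝ, ℝ) 2 f x)
    {c c' : OpenPartialHomeomorph M E} (hc : c ∈ atlas E M) (hc' : c' ∈ atlas E M)
    (hx : x ∈ c.source) (hx' : x ∈ c'.source) (w : E) :
    levi (fun z => f (c.symm z)) (c x) w =
      levi (fun z => f (c'.symm z)) (c' x) (fderiv ℂ (fun z => c' (c.symm z)) (c x) w) := by
  have h2 : (2 : ℕ∞ω) ≤ (∞ : ℕ∞ω) := WithTop.coe_le_coe.2 (le_top (a := (2 : ℕ∞)))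
  rw [levi_congr (eventuallyEq_transition f hx hx')]
  have h := hf.contDiffAt_chart h2 hc' hx'
  have e : c' (c.symm (c x)) = c' x := by rw [c.left_inv hx]
  rw [← e] at h ⊢
  exact levi_comp_holomorphic (u := fun z => f (c'.symm z)) (G := fun z => c' (c.symm z)) h
    ((contDiffAt_transition hc hc' hx hx').of_le le_top) w

theorem fderiv_transition {f : M → ℝ} {x : M} (hf : ContMDiffAt 𝓘(ℝ, E) 𝓘(ℝ, ℝ) 1 f x)
    {c c' : OpenPartialHomeomorph M E} (hc : c ∈ atlas E M) (hc' : c' ∈ atlas E M)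
    (hx : x ∈ c.source) (hx' : x ∈ c'.source) (w : E) :
    fderiv ℝ (fun z => f (c.symm z)) (c x) w =
      fderiv ℝ (fun z => f (c'.symm z)) (c' x) (fderiv ℂ (fun z => c' (c.symm z)) (c x) w) := by
  have h1 : (1 : ℕ∞ω) ≤ (∞ : ℕ∞ω) := by exact_mod_cast le_top (a := (1 : ℕ∞))
  rw [(eventuallyEq_transition f hx hx').fderiv_eq]
  have h := (hf.contDiffAt_chart h1 hc' hx').differentiableAt one_ne_zero
  have ht := (contDiffAt_transition hc hc' hx hx').differentiableAt (by simp)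
  have e : c' (c.symm (c x)) = c' x := by rw [c.left_inv hx]
  rw [← e] at h ⊢
  have := fderiv_comp (c x) h (ht.restrictScalars ℝ)
  rw [Function.comp_def] at this
  rw [this, ht.fderiv_restrictScalars ℝ]
  rfl

theorem fderiv_transition_comp {c c' : OpenPartialHomeomorph M E} (hc : c ∈ atlas E M)
    (hc' : c' ∈ atlas E M) {x : M} (hx : x ∈ c.source) (hx' : x ∈ c'.source) (w : E) :
    fderiv ℂ (fun z => c (c'.symm z)) (c' x) (fderiv ℂ (fun z => c' (c.symm z)) (c x) w) = w := by
  have h1 := (contDiffAt_transition hc hc' hx hx').differentiableAt (by simp)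
  have h2 := (contDiffAt_transition hc' hc hx' hx).differentiableAt (by simp)
  have e : c' (c.symm (c x)) = c' x := by rw [c.left_inv hx]
  rw [← e] at h2 ⊢
  have := fderiv_comp (c x) h2 h1
  rw [← ContinuousLinearMap.comp_apply, ← this]
  have h3 : ((fun z => c (c'.symm z)) ∘ fun z => c' (c.symm z)) =ᶠ[𝓝 (c x)] id := by
    filter_upwards [eventuallyEq_transition c hx hx', c.open_target.mem_nhds (c.map_source hx)]
      with z hz1 hz2
    simp only [Function.comp_apply, id_eq]
    rw [← hz1, c.right_inv hz2]
  rw [h3.fderiv_eq]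
  simp

/-- The chart at x, in which `leviForm` is computed, need not depend continuously on x. Estimates
that are uniform near a point therefore use one fixed chart and transport the vector to it. -/
theorem leviForm_eq_tcoord {f : M → ℝ} {x : M} (hf : ContMDiffAt 𝓘(ℝ, E) 𝓘(ℝ, ℝ) 2 f x) {p : M}
    (hx : x ∈ (chartAt E p).source) (v : E) :
    leviForm f x v = levi (fun z => f ((chartAt E p).symm z)) (chartAt E p x) (tcoord p x v) :=
  levi_transition hf (chart_mem_atlas E x) (chart_mem_atlas E p) (mem_chart_source E x) hx v

theorem dform_eq_tcoord {f : M → ℝ} {x : M} (hf : ContMDiffAt 𝓘(ℝ, E) 𝓘(ℝ, ℝ) 1 f x) {p : M}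
    (hx : x ∈ (chartAt E p).source) (v : E) :
    dform f x v = fderiv ℝ (fun z => f ((chartAt E p).symm z)) (chartAt E p x) (tcoord p x v) :=
  fderiv_transition hf (chart_mem_atlas E x) (chart_mem_atlas E p) (mem_chart_source E x) hx v

theorem tcoord_ne_zero {p x : M} (hx : x ∈ (chartAt E p).source) {v : E} (hv : v ≠ 0) :
    tcoord p x v ≠ 0 := by
  intro h
  have := fderiv_transition_comp (chart_mem_atlas E x) (chart_mem_atlas E p)
    (mem_chart_source E x) hx v
  rw [show fderiv ℂ (fun z => chartAt E p ((chartAt E x).symm z)) (chartAt E x x) v = 0 from h,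
    map_zero] at this
  exact hv this.symm

/-- Local bounds for the Levi form and the differential of a `C²` function. -/
theorem exists_leviForm_bound {f : M → ℝ} {q : M} (hf : ContMDiffAt 𝓘(ℝ, E) 𝓘(ℝ, ℝ) 2 f q) {p : M}
    (hq : q ∈ (chartAt E p).source) : ∃ B : ℝ, 0 ≤ B ∧ ∀ᶠ x in 𝓝 q, ∀ v : E,
      |leviForm f x v| ≤ B * ‖tcoord p x v‖ ^ 2 ∧ |dform f x v| ≤ B * ‖tcoord p x v‖ := by
  have := isManifold_real E M
  have h2 : (2 : ℕ∞ω) ≤ (∞ : ℕ∞ω) := WithTop.coe_le_coe.2 (le_top (a := (2 : ℕ∞)))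
  have : IsManifold 𝓘(ℝ, E) 2 M := .of_le h2
  have hf2 : ∀ᶠ x in 𝓝 q, ContMDiffAt 𝓘(ℝ, E) 𝓘(ℝ, ℝ) 2 f x :=
    (contMDiffAt_iff_contMDiffAt_nhds (by simp)).1 hf
  set F : E → ℝ := fun z => f ((chartAt E p).symm z)
  have hF : ContDiffAt ℝ 2 F (chartAt E p q) := hf.contDiffAt_chart h2 (chart_mem_atlas E p) hq
  have hc : ContinuousAt (chartAt E p) q := (chartAt E p).continuousAt hq
  have hF1 : ContDiffAt ℝ 1 (fderiv ℝ F) (chartAt E p q) := hF.fderiv_right (by norm_num)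
  have hc1 : ContinuousAt (fun x => ‖fderiv ℝ F (chartAt E p x)‖) q :=
    (hF1.continuousAt.norm).comp (f := chartAt E p) (g := fun z => ‖fderiv ℝ F z‖) hc
  have hc2 : ContinuousAt (fun x => ‖fderiv ℝ (fderiv ℝ F) (chartAt E p x)‖) q :=
    ((hF1.fderiv_right (m := 0) (by norm_num)).continuousAt.norm).comp (f := chartAt E p)
      (g := fun z => ‖fderiv ℝ (fderiv ℝ F) z‖) hc
  set B1 := ‖fderiv ℝ F (chartAt E p q)‖ + 1
  set B2 := ‖fderiv ℝ (fderiv ℝ F) (chartAt E p q)‖ + 1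
  have e1 := hc1.eventually (gt_mem_nhds (lt_add_one _))
  have e2 := hc2.eventually (gt_mem_nhds (lt_add_one _))
  refine ⟨max B1 B2, le_max_of_le_left (by positivity), ?_⟩
  filter_upwards [e1, e2, hf2, (chartAt E p).open_source.mem_nhds hq]
    with x hx1 hx2 hx3 hx4 v
  rw [leviForm_eq_tcoord hx3 hx4, dform_eq_tcoord (ContMDiffAt.of_le hx3 (by norm_num)) hx4]
  constructor
  · exact (abs_levi_le _ _ _).trans (by gcongr; exact hx2.le.trans (le_max_right _ _))
  · refine ((Real.norm_eq_abs _).symm.le.trans (ContinuousLinearMap.le_opNorm _ _)).trans ?_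
    gcongr
    exact hx1.le.trans (le_max_left _ _)

section Curves

variable {γ : ℝ → M} {t : ℝ}

theorem hasDerivAt_comp_curve {f : M → ℝ} (hγ : MDifferentiableAt 𝓘(ℝ, ℝ) 𝓘(ℝ, E) γ t)
    (hf : ContMDiffAt 𝓘(ℝ, E) 𝓘(ℝ, ℝ) 1 f (γ t)) :
    HasDerivAt (fun s => f (γ s)) (dform (E := E) f (γ t) (mfderiv 𝓘(ℝ, ℝ) 𝓘(ℝ, E) γ t (1 : ℝ))) t :=
  deriv_comp_curve hγ ((hf.contDiffAt_chart (by exact_mod_cast le_top (a := (1 : ℕ∞)))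
    (chart_mem_atlas E _) (mem_chart_source E _)).differentiableAt one_ne_zero)

theorem hasDerivAt_chart_comp_curve (hγ : MDifferentiableAt 𝓘(ℝ, ℝ) 𝓘(ℝ, E) γ t) {p : M}
    (hp : γ t ∈ (chartAt E p).source) :
    HasDerivAt (fun s => chartAt E p (γ s))
      (tcoord (E := E) p (γ t) (mfderiv 𝓘(ℝ, ℝ) 𝓘(ℝ, E) γ t (1 : ℝ))) t := by
  have h := (contDiffAt_transition (chart_mem_atlas E (γ t)) (chart_mem_atlas E p)
    (mem_chart_source E (γ t)) hp).differentiableAt (by simp)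
  have := deriv_comp_curve (f := chartAt E p) hγ (h.restrictScalars ℝ)
  rw [h.fderiv_restrictScalars ℝ] at this
  exact this

end Curves

end Charts

/-! ### A smooth convex function that vanishes on the negative half-line. -/

section ConvexGlue

/-- A smooth nonnegative nondecreasing function, vanishing exactly on `(-∞, 0]`. -/
noncomputable def convexGlueDeriv (t : ℝ) : ℝ := ∫ s in (0 : ℝ)..t, expNegInvGlue s

/-- A smooth convex nonnegative function, vanishing on `(-∞, 0]`. -/
noncomputable def convexGlue (t : ℝ) : ℝ := ∫ s in (0 : ℝ)..t, convexGlueDeriv s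

theorem hasDerivAt_convexGlueDeriv (t : ℝ) : HasDerivAt convexGlueDeriv (expNegInvGlue t) t :=
  (expNegInvGlue.contDiff (n := 0)).continuous.integral_hasStrictDerivAt 0 t |>.hasDerivAt

theorem contDiff_convexGlueDeriv : ContDiff ℝ ∞ convexGlueDeriv := by
  rw [contDiff_infty_iff_deriv]
  refine ⟨fun t => (hasDerivAt_convexGlueDeriv t).differentiableAt, ?_⟩
  rw [show deriv convexGlueDeriv = expNegInvGlue from
    funext fun t => (hasDerivAt_convexGlueDeriv t).deriv]
  exact expNegInvGlue.contDiff

theorem hasDerivAt_convexGlue (t : ℝ) : HasDerivAt convexGlue (convexGlueDeriv t) t :=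
  contDiff_convexGlueDeriv.continuous.integral_hasStrictDerivAt 0 t |>.hasDerivAt

theorem contDiff_convexGlue : ContDiff ℝ ∞ convexGlue := by
  rw [contDiff_infty_iff_deriv]
  refine ⟨fun t => (hasDerivAt_convexGlue t).differentiableAt, ?_⟩
  rw [show deriv convexGlue = convexGlueDeriv from
    funext fun t => (hasDerivAt_convexGlue t).deriv]
  exact contDiff_convexGlueDeriv

theorem monotone_convexGlueDeriv : Monotone convexGlueDeriv :=
  monotone_of_deriv_nonneg (fun t => (hasDerivAt_convexGlueDeriv t).differentiableAt) fun t => by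
    rw [(hasDerivAt_convexGlueDeriv t).deriv]; exact expNegInvGlue.nonneg t

theorem convexGlueDeriv_of_nonpos {t : ℝ} (ht : t ≤ 0) : convexGlueDeriv t = 0 := by
  rw [convexGlueDeriv, intervalIntegral.integral_zero_ae]
  refine Filter.Eventually.of_forall fun s hs => expNegInvGlue.zero_of_nonpos ?_
  rw [Set.uIoc_of_ge ht] at hs
  exact hs.2

theorem convexGlueDeriv_nonneg (t : ℝ) : 0 ≤ convexGlueDeriv t := by
  rcases le_total t 0 with ht | ht
  · rw [convexGlueDeriv_of_nonpos ht]
  · exact (convexGlueDeriv_of_nonpos le_rfl).symm.le.trans (monotone_convexGlueDeriv ht)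

theorem convexGlueDeriv_pos {t : ℝ} (ht : 0 < t) : 0 < convexGlueDeriv t :=
  intervalIntegral.intervalIntegral_pos_of_pos_on
    ((expNegInvGlue.contDiff (n := 0)).continuous.intervalIntegrable _ _)
    (fun _ hs => expNegInvGlue.pos_of_pos hs.1) ht

theorem convexGlue_of_nonpos {t : ℝ} (ht : t ≤ 0) : convexGlue t = 0 := by
  rw [convexGlue, intervalIntegral.integral_zero_ae]
  refine Filter.Eventually.of_forall fun s hs => convexGlueDeriv_of_nonpos ?_
  rw [Set.uIoc_of_ge ht] at hs
  exact hs.2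

theorem convexGlue_nonneg (t : ℝ) : 0 ≤ convexGlue t := by
  rcases le_total t 0 with ht | ht
  · rw [convexGlue_of_nonpos ht]
  · exact intervalIntegral.integral_nonneg ht fun s _ => convexGlueDeriv_nonneg s

end ConvexGlue

/-! ### Smooth plurisubharmonic functions with prescribed zeros on a Stein manifold. -/

section Stein

open Set Filter

variable {E : Type*} [NormedAddCommGroup E] [NormedSpace ℂ E]

theorem contDiffOn_of_differentiableOn_complex [FiniteDimensional ℂ E] {V : Type*}
    [NormedAddCommGroup V] [NormedSpace ℂ V] [FiniteDimensional ℂ V] {G : E → V} {U : Set E}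
    (hU : IsOpen U) (hG : DifferentiableOn ℂ G U) : ContDiffOn ℂ ∞ G U := by
  let e : V ≃L[ℂ] (Fin (Module.finrank ℂ V) → ℂ) :=
    ContinuousLinearEquiv.ofFinrankEq (by simp)
  rw [← e.comp_contDiffOn_iff, contDiffOn_pi]
  intro i
  exact contDiffOn_complex_of_differentiableOn hU
    (differentiableOn_pi.1 (e.comp_differentiableOn_iff.2 hG) i)

/-- An injective linear map in finite dimension is bounded below by some 1/K, and half of this bound
survives perturbations of norm below 1/(2K). -/
theorem exists_fderiv_lower_bound [FiniteDimensional ℂ E] {V : Type*} [NormedAddCommGroup V]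
    [NormedSpace ℂ V] {G : E → V} {q : E} (hG : ContDiffAt ℂ 1 G q)
    (hinj : Function.Injective (fderiv ℂ G q)) :
    ∃ δ : ℝ, 0 < δ ∧ ∀ᶠ z in 𝓝 q, ∀ w, δ * ‖w‖ ^ 2 ≤ ‖fderiv ℂ G z w‖ ^ 2 := by
  obtain ⟨K, hK0, hK⟩ := (fderiv ℂ G q).exists_antilipschitzWith
    (LinearMap.ker_eq_bot.2 hinj)
  have hK0' : (0 : ℝ) < K := hK0
  have hcont : ContinuousAt (fderiv ℂ G) q :=
    (hG.fderiv_right (m := 0) (by norm_num)).continuousAt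
  refine ⟨((2 * K : ℝ)⁻¹) ^ 2, by positivity, ?_⟩
  filter_upwards [Metric.tendsto_nhds.1 hcont (2 * K : ℝ)⁻¹ (by positivity)] with z hz w
  rw [dist_eq_norm] at hz
  have h1 : ‖w‖ ≤ K * ‖fderiv ℂ G q w‖ := by
    simpa using hK.le_mul_dist w 0
  have h2 : ‖fderiv ℂ G z w - fderiv ℂ G q w‖ ≤ (2 * K : ℝ)⁻¹ * ‖w‖ := by
    rw [← sub_apply]
    exact (ContinuousLinearMap.le_opNorm _ _).trans (by gcongr)
  have h3 : (K : ℝ)⁻¹ * ‖w‖ ≤ ‖fderiv ℂ G q w‖ := by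
    rw [inv_mul_le_iff₀ hK0']; exact h1
  have h4 : ‖fderiv ℂ G q w‖ ≤ ‖fderiv ℂ G z w‖ + ‖fderiv ℂ G z w - fderiv ℂ G q w‖ := by
    have := norm_sub_norm_le (fderiv ℂ G q w) (fderiv ℂ G z w)
    rw [norm_sub_rev] at this
    linarith
  have h5 : (K : ℝ)⁻¹ = 2 * (2 * K : ℝ)⁻¹ := by field_simp
  rw [← mul_pow]
  gcongr
  rw [h5] at h3
  linarith

variable {M : Type*} [TopologicalSpace M] [ChartedSpace E M]

variable (E) in
/-- The hull of a set with respect to the holomorphic functions on the manifold. -/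
def holHull (K : Set M) : Set M :=
  {x : M | ∀ f : M → ℂ, MDifferentiable 𝓘(ℂ, E) 𝓘(ℂ, ℂ) f →
      ∀ C : ℝ, (∀ y ∈ K, ‖f y‖ ≤ C) → ‖f x‖ ≤ C}

theorem subset_holHull (K : Set M) : K ⊆ holHull E K := fun x hx _ _ _ h => h x hx

theorem holHull_empty : holHull E (∅ : Set M) = ∅ := by
  ext x
  simp only [holHull, mem_ofPred_eq, mem_empty_iff_false, iff_false]
  intro h
  have := h (fun _ => 0) (fun _ => mdifferentiableAt_const) (-1) (by simp)
  norm_num at this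

variable [FiniteDimensional ℂ E] [IsManifold 𝓘(ℂ, E) ω M]

theorem MDifferentiable.contDiffAt_chart_complex {V : Type*} [NormedAddCommGroup V]
    [NormedSpace ℂ V] [FiniteDimensional ℂ V] {G : M → V}
    (hG : MDifferentiable 𝓘(ℂ, E) 𝓘(ℂ, V) G) {c : OpenPartialHomeomorph M E}
    (hc : c ∈ atlas E M) {x : M} (hx : x ∈ c.source) :
    ContDiffAt ℂ ∞ (fun z => G (c.symm z)) (c x) := by
  have h1 := (contMDiffOn_symm_of_mem_maximalAtlas (I := 𝓘(ℂ, E)) (n := ω)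
    (IsManifold.subset_maximalAtlas hc)).mdifferentiableOn (by simp)
  have h2 : DifferentiableOn ℂ (fun z => G (c.symm z)) c.target := by
    rw [← mdifferentiableOn_iff_differentiableOn]
    exact hG.comp_mdifferentiableOn h1
  exact (contDiffOn_of_differentiableOn_complex c.open_target h2).contDiffAt
    (c.open_target.mem_nhds (c.map_source hx))

/-- On a Stein manifold, for a point `q` off the hull of a compact set `K` there is a smooth
plurisubharmonic function that vanishes on `K` and has arbitrarily large Levi form near `q`. -/
theorem IsStein.exists_smooth_psh (hM : IsStein E M) {K : Set M} (hK : IsCompact K) {q : M}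
    (hq : q ∉ holHull E K) (C : ℝ) : ∃ σ : M → ℝ, ContMDiff 𝓘(ℝ, E) 𝓘(ℝ, ℝ) ∞ σ ∧
      (∀ x, 0 ≤ σ x) ∧ (∀ x (v : E), 0 ≤ leviForm σ x v) ∧ (∀ x ∈ K, σ x = 0) ∧
      ∀ᶠ x in 𝓝 q, ∀ v : E, C * ‖tcoord q x v‖ ^ 2 ≤ leviForm σ x v := by
  simp only [holHull, mem_ofPred_eq, not_forall, not_le] at hq
  obtain ⟨f, hf, C₀, hC₀, hfq⟩ := hq
  obtain ⟨F, hF, hFq⟩ := hM.coordinates q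
  let e : E ≃L[ℂ] EuclideanSpace ℂ (Fin (Module.finrank ℂ E)) :=
    ContinuousLinearEquiv.ofFinrankEq (by simp)
  let G : M → EuclideanSpace ℂ (Fin (Module.finrank ℂ E)) := fun x => e (F x)
  have hG : MDifferentiable 𝓘(ℂ, E) 𝓘(ℂ, EuclideanSpace ℂ (Fin (Module.finrank ℂ E))) G :=
    e.mdifferentiable.comp hF
  -- The gap between |f|² on K and at q leaves room for a small multiple of |G|². That multiple
  -- makes the Levi form definite near q, where G is an immersion.
  obtain ⟨ε, hε, s, hs, hsK⟩ : ∃ ε : ℝ, 0 < ε ∧ ∃ s, s < ‖f q‖ ^ 2 ∧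
      ∀ y ∈ K, ‖f y‖ ^ 2 + ε * ‖G y‖ ^ 2 ≤ s := by
    rcases K.eq_empty_or_nonempty with rfl | ⟨y₀, hy₀⟩
    · exact ⟨1, one_pos, ‖f q‖ ^ 2 - 1, by linarith, by simp⟩
    · have h0 : 0 ≤ C₀ := (norm_nonneg _).trans (hC₀ y₀ hy₀)
      obtain ⟨B, hB⟩ := hK.exists_bound_of_continuousOn hG.continuous.continuousOn
      have hlt : C₀ ^ 2 < ‖f q‖ ^ 2 := by gcongr
      have hd : 0 < (‖f q‖ ^ 2 - C₀ ^ 2) / 2 := by linarith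
      refine ⟨(‖f q‖ ^ 2 - C₀ ^ 2) / 2 / (B ^ 2 + 1), by positivity,
        (‖f q‖ ^ 2 + C₀ ^ 2) / 2, by linarith, fun y hy => ?_⟩
      have h1 : ‖f y‖ ^ 2 ≤ C₀ ^ 2 := by gcongr; exact hC₀ y hy
      have h2 : ‖G y‖ ^ 2 ≤ B ^ 2 + 1 := by
        have : ‖G y‖ ^ 2 ≤ B ^ 2 := by gcongr; exact hB y hy
        linarith
      have h3 : (‖f q‖ ^ 2 - C₀ ^ 2) / 2 / (B ^ 2 + 1) * ‖G y‖ ^ 2 ≤ (‖f q‖ ^ 2 - C₀ ^ 2) / 2 := by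
        rw [div_mul_eq_mul_div, div_le_iff₀ (by positivity)]
        gcongr
      linarith
  set h : M → ℝ := fun x => (‖f x‖ ^ 2 + ε * ‖G x‖ ^ 2) + -s with hh
  have hinj : Function.Injective (fderiv ℂ (fun z => G ((chartAt E q).symm z)) (chartAt E q q)) := by
    have h1 : fderiv ℂ (fun z => G ((chartAt E q).symm z)) (chartAt E q q) =
        (e : E →L[ℂ] EuclideanSpace ℂ (Fin (Module.finrank ℂ E))).comp (fderiv ℂ (fun z => F ((chartAt E q).symm z)) (chartAt E q q)) :=
      e.comp_fderiv
    have h2 : mfderiv 𝓘(ℂ, E) 𝓘(ℂ, E) F q =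
        fderiv ℂ (fun z => F ((chartAt E q).symm z)) (chartAt E q q) := by
      rw [(hF q).mfderiv]
      simp only [mfld_simps, fderivWithin_univ]
      rfl
    rw [h1]
    rw [h2] at hFq
    exact e.injective.comp hFq.1
  obtain ⟨δ, hδ, hδq⟩ := exists_fderiv_lower_bound
    ((hG.contDiffAt_chart_complex (chart_mem_atlas E q) (mem_chart_source E q)).of_le
      (by exact_mod_cast le_top)) hinj
  -- h ≤ 0 on K, while h q ≥ 2d; so h > d near q and `convexGlueDeriv` is bounded below there.
  set d := (‖f q‖ ^ 2 - s) / 2 with hd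
  have hd0 : 0 < d := by rw [hd]; linarith
  have hc0 := convexGlueDeriv_pos hd0
  -- Chosen so that the guaranteed lower bound near q, A · `convexGlueDeriv d` · ε · δ, is exactly
  -- |C|.
  set A := |C| / (convexGlueDeriv d * (ε * δ)) with hA
  have hA0 : 0 ≤ A := by positivity
  have hchart : ∀ {c : OpenPartialHomeomorph M E}, c ∈ atlas E M → ∀ {x : M}, x ∈ c.source →
      ContDiffAt ℝ ∞ (fun z => h (c.symm z)) (c x) ∧
      ∀ w, ε * ‖fderiv ℂ (fun z => G (c.symm z)) (c x) w‖ ^ 2 ≤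
        levi (fun z => h (c.symm z)) (c x) w := by
    intro c hc x hx
    have hfc := hf.contDiffAt_chart_complex hc hx
    have hGc := hG.contDiffAt_chart_complex hc hx
    have h2 : (2 : ℕ∞ω) ≤ (∞ : ℕ∞ω) := WithTop.coe_le_coe.2 (le_top (a := (2 : ℕ∞)))
    let _ : InnerProductSpace ℝ (EuclideanSpace ℂ (Fin (Module.finrank ℂ E))) :=
      InnerProductSpace.complexToReal
    have hf1 : ContDiffAt ℝ ∞ (fun z => ‖f (c.symm z)‖ ^ 2) (c x) :=
      (hfc.restrict_scalars ℝ).norm_sq ℝ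
    have hG1 : ContDiffAt ℝ ∞ (fun z => ‖G (c.symm z)‖ ^ 2) (c x) :=
      (hGc.restrict_scalars ℝ).norm_sq ℝ
    have hG2 : ContDiffAt ℝ ∞ (fun z => ε * ‖G (c.symm z)‖ ^ 2) (c x) := contDiffAt_const.mul hG1
    refine ⟨(hf1.add hG2).add contDiffAt_const, fun w => ?_⟩
    simp only [hh]
    rw [levi_add ((hf1.add hG2).of_le h2) contDiffAt_const, levi_add (hf1.of_le h2) (hG2.of_le h2),
      levi_const, levi_const_mul _ (hG1.of_le h2), levi_norm_sq_comp (hfc.of_le h2),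
      levi_norm_sq_comp (hGc.of_le h2)]
    have : 0 ≤ ‖fderiv ℂ (fun z => f (c.symm z)) (c x) w‖ ^ 2 := by positivity
    linarith
  have hlevi : ∀ {c : OpenPartialHomeomorph M E}, c ∈ atlas E M → ∀ {x : M}, x ∈ c.source →
      ∀ w, A * (convexGlueDeriv (h x) * (ε * ‖fderiv ℂ (fun z => G (c.symm z)) (c x) w‖ ^ 2)) ≤
        levi (fun z => A * convexGlue (h (c.symm z))) (c x) w := by
    intro c hc x hx w
    obtain ⟨hs, hl⟩ := hchart hc hx
    have h2 : (2 : ℕ∞ω) ≤ (∞ : ℕ∞ω) := WithTop.coe_le_coe.2 (le_top (a := (2 : ℕ∞)))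
    rw [levi_const_mul (F := fun z => convexGlue (h (c.symm z))) _ ((contDiff_convexGlue.contDiffAt.comp _ hs).of_le h2),
      levi_comp_real (hs.of_le h2) (Eventually.of_forall hasDerivAt_convexGlue)
        (hasDerivAt_convexGlueDeriv _), c.left_inv hx]
    have h3 := mul_le_mul_of_nonneg_left (hl w) (convexGlueDeriv_nonneg (h x))
    have h4 := expNegInvGlue.nonneg (h x)
    refine mul_le_mul_of_nonneg_left (h3.trans (le_add_of_nonneg_right ?_)) hA0
    positivity
  have hsmooth : ContMDiff 𝓘(ℝ, E) 𝓘(ℝ, ℝ) ∞ fun x => A * convexGlue (h x) := fun x =>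
    contMDiffAt_of_contDiffAt_chart le_rfl (chart_mem_atlas E x) (mem_chart_source E x)
      (contDiffAt_const.mul (contDiff_convexGlue.contDiffAt.comp _
        (hchart (chart_mem_atlas E x) (mem_chart_source E x)).1))
  refine ⟨fun x => A * convexGlue (h x), hsmooth, fun x => mul_nonneg hA0 (convexGlue_nonneg _),
    fun x v => ?_, fun x hx => ?_, ?_⟩
  · refine le_trans ?_ (hlevi (chart_mem_atlas E x) (mem_chart_source E x) v)
    have := convexGlueDeriv_nonneg (h x)
    positivity
  · have : h x ≤ 0 := by have := hsK x hx; simp only [hh]; linarith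
    simp [convexGlue_of_nonpos this]
  · have hhc : Continuous h := by
      have := hf.continuous
      have := hG.continuous
      fun_prop
    have hhq : d < h q := by
      have : 0 ≤ ε * ‖G q‖ ^ 2 := by positivity
      simp only [hh, hd]; linarith
    filter_upwards [hhc.continuousAt.eventually (lt_mem_nhds hhq),
      ((chartAt E q).continuousAt (mem_chart_source E q)).eventually hδq,
      (chartAt E q).open_source.mem_nhds (mem_chart_source E q)] with x hx1 hx2 hx3 v
    have h2 : (2 : ℕ∞ω) ≤ (∞ : ℕ∞ω) := WithTop.coe_le_coe.2 (le_top (a := (2 : ℕ∞)))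
    rw [leviForm_eq_tcoord ((hsmooth x).of_le h2) hx3]
    refine le_trans ?_ (hlevi (chart_mem_atlas E q) hx3 _)
    calc C * ‖tcoord q x v‖ ^ 2 ≤ |C| * ‖tcoord q x v‖ ^ 2 := by gcongr; exact le_abs_self C
      _ = A * (convexGlueDeriv d * (ε * (δ * ‖tcoord q x v‖ ^ 2))) := by rw [hA]; field_simp
      _ ≤ _ := by
        gcongr
        · exact convexGlueDeriv_nonneg _
        · exact monotone_convexGlueDeriv hx1.le
        · exact hx2 _

end Stein

/-! ### Plurisubharmonic functions with arbitrarily large Levi form. -/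

section SteinExhaustion

open Set Filter

variable {E : Type*} [NormedAddCommGroup E] [NormedSpace ℂ E]
  {M : Type*} [TopologicalSpace M] [ChartedSpace E M]

theorem leviForm_congr {f g : M → ℝ} {x : M} (h : f =ᶠ[𝓝 x] g) (v : E) :
    leviForm f x v = leviForm g x v := by
  refine levi_congr ?_ v
  have : Tendsto (chartAt E x).symm (𝓝 (chartAt E x x)) (𝓝 x) := by
    have := (chartAt E x).continuousAt_symm (mem_chart_target E x)
    rwa [ContinuousAt, (chartAt E x).left_inv (mem_chart_source E x)] at this
  exact this.eventually h

/-- Hulls of compact sets are compact, so each next set can swallow the hull of the preceding one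
together with a set of an ordinary compact exhaustion. -/
theorem IsStein.exists_exhaustion [FiniteDimensional ℂ E] [SecondCountableTopology M] (hM : IsStein E M) : ∃ K : ℕ → Set M, K 0 = ∅ ∧
    (∀ n, IsCompact (K n)) ∧ (∀ n, holHull E (K n) ⊆ interior (K (n + 1))) ∧
    ⋃ n, K n = univ := by
  have : ProperSpace E := FiniteDimensional.proper ℂ E
  have : LocallyCompactSpace M := ChartedSpace.locallyCompactSpace E M
  let X : CompactExhaustion M := default
  have step : ∀ (n : ℕ) (K : {K : Set M // IsCompact K}), ∃ K' : {K : Set M // IsCompact K},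
      holHull E K.1 ∪ X n ⊆ interior K'.1 := by
    intro n K
    obtain ⟨K', h1, h2⟩ := exists_compact_superset
      ((hM.holConvex K.1 K.2).union (X.isCompact n))
    exact ⟨⟨K', h1⟩, h2⟩
  choose g hg using step
  let K : ℕ → {K : Set M // IsCompact K} := fun n => Nat.rec ⟨∅, isCompact_empty⟩ g n
  refine ⟨fun n => (K n).1, rfl, fun n => (K n).2,
    fun n => subset_union_left.trans (hg n (K n)), ?_⟩
  rw [eq_univ_iff_forall]
  intro x
  obtain ⟨n, hn⟩ := X.exists_mem x
  exact mem_iUnion.2 ⟨n + 1, interior_subset (hg n (K n) (Or.inr hn))⟩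

variable [IsManifold 𝓘(ℂ, E) ω M]

theorem leviForm_sum {ι : Type*} (s : Finset ι) {f : ι → M → ℝ} {x : M}
    (hf : ∀ i ∈ s, ContMDiffAt 𝓘(ℝ, E) 𝓘(ℝ, ℝ) 2 (f i) x) (v : E) :
    leviForm (fun y => ∑ i ∈ s, f i y) x v = ∑ i ∈ s, leviForm (f i) x v :=
  levi_sum s (fun i hi => (hf i hi).contDiffAt_chart (WithTop.coe_le_coe.2 (le_top (a := (2 : ℕ∞))))
    (chart_mem_atlas E x) (mem_chart_source E x)) v

theorem leviForm_add {f g : M → ℝ} {x : M} (hf : ContMDiffAt 𝓘(ℝ, E) 𝓘(ℝ, ℝ) 2 f x)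
    (hg : ContMDiffAt 𝓘(ℝ, E) 𝓘(ℝ, ℝ) 2 g x) (v : E) :
    leviForm (fun y => f y + g y) x v = leviForm f x v + leviForm g x v :=
  levi_add (hf.contDiffAt_chart (WithTop.coe_le_coe.2 (le_top (a := (2 : ℕ∞))))
    (chart_mem_atlas E x) (mem_chart_source E x))
    (hg.contDiffAt_chart (WithTop.coe_le_coe.2 (le_top (a := (2 : ℕ∞))))
    (chart_mem_atlas E x) (mem_chart_source E x)) v

theorem leviForm_const_mul (c : ℝ) {f : M → ℝ} {x : M} (hf : ContMDiffAt 𝓘(ℝ, E) 𝓘(ℝ, ℝ) 2 f x)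
    (v : E) : leviForm (fun y => c * f y) x v = c * leviForm f x v :=
  levi_const_mul c (hf.contDiffAt_chart (WithTop.coe_le_coe.2 (le_top (a := (2 : ℕ∞))))
    (chart_mem_atlas E x) (mem_chart_source E x)) v

variable [FiniteDimensional ℂ E] [SecondCountableTopology M]

/-- A Stein manifold carries smooth plurisubharmonic functions with arbitrarily large Levi form:
given a neighbourhood `N p` of each point `p` and constants `C p`, the Levi form can be made, near
each point, larger than `C p` times the squared norm in the chart at `p`, for some `p` such that
`N p` contains the point. -/
theorem IsStein.exists_psh_dominating (hM : IsStein E M) {N : M → Set M} (hN : ∀ p, N p ∈ 𝓝 p)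
    (C : M → ℝ) : ∃ Ψ : M → ℝ, ContMDiff 𝓘(ℝ, E) 𝓘(ℝ, ℝ) ∞ Ψ ∧ (∀ x, 0 ≤ Ψ x) ∧
      ∀ q, ∃ p, ∃ W ∈ 𝓝 q, W ⊆ N p ∩ (chartAt E p).source ∧
        ∀ x ∈ W, ∀ v : E, C p * ‖tcoord p x v‖ ^ 2 ≤ leviForm Ψ x v := by
  have h2 : (2 : ℕ∞ω) ≤ (∞ : ℕ∞ω) := WithTop.coe_le_coe.2 (le_top (a := (2 : ℕ∞)))
  obtain ⟨K, hK0, hKc, hKhull, hKU⟩ := hM.exists_exhaustion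
  have hKmono : Monotone K := monotone_nat_of_le_succ fun n =>
    ((subset_holHull (K n)).trans (hKhull n)).trans interior_subset
  -- Subtraction is truncated: for n = 0 the set is K 0 = ∅, whose hull is empty, so every point
  -- qualifies.
  have hex : ∀ (n : ℕ) (q : M), ∃ σ : M → ℝ, q ∉ holHull E (K (n - 1)) →
      (ContMDiff 𝓘(ℝ, E) 𝓘(ℝ, ℝ) ∞ σ ∧
      (∀ x, 0 ≤ σ x) ∧ (∀ x (v : E), 0 ≤ leviForm σ x v) ∧ (∀ x ∈ K (n - 1), σ x = 0) ∧
      ∀ᶠ x in 𝓝 q, ∀ v : E, C q * ‖tcoord q x v‖ ^ 2 ≤ leviForm σ x v) := by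
    intro n q
    by_cases hq : q ∈ holHull E (K (n - 1))
    · exact ⟨0, fun h => absurd hq h⟩
    · obtain ⟨σ, hσ⟩ := hM.exists_smooth_psh (hKc (n - 1)) hq (C q)
      exact ⟨σ, fun _ => hσ⟩
  choose σ hσ using hex
  have hshell : ∀ n, ∀ q ∈ K (n + 1) \ interior (K n), q ∉ holHull E (K (n - 1)) := by
    intro n q hq
    cases n with
    | zero => simp [hK0, holHull_empty]
    | succ m => exact fun h => hq.2 (hKhull m h)
  let W : ℕ → M → Set M := fun n q => interior (N q ∩ (chartAt E q).source ∩
    {x | ∀ v : E, C q * ‖tcoord q x v‖ ^ 2 ≤ leviForm (σ n q) x v})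
  have hW : ∀ n, ∀ q ∈ K (n + 1) \ interior (K n), W n q ∈ 𝓝 q := by
    intro n q hq
    refine interior_mem_nhds.2 (inter_mem (inter_mem (hN q)
      ((chartAt E q).open_source.mem_nhds (mem_chart_source E q))) ?_)
    exact (hσ n q (hshell n q hq)).2.2.2.2
  have hcov : ∀ n, ∃ t : Finset M, (∀ q ∈ t, q ∈ K (n + 1) \ interior (K n)) ∧
      K (n + 1) \ interior (K n) ⊆ ⋃ q ∈ t, W n q := fun n =>
    ((hKc (n + 1)).diff isOpen_interior).elim_nhds_subcover (W n) (hW n)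
  choose t ht htcov using hcov
  have hσt : ∀ n, ∀ q ∈ t n, _ := fun n q hq => hσ n q (hshell n q (ht n q hq))
  let Ψn : ℕ → M → ℝ := fun n x => ∑ q ∈ t n, σ n q x
  have hΨn : ∀ n, ContMDiff 𝓘(ℝ, E) 𝓘(ℝ, ℝ) ∞ (Ψn n) := fun n =>
    ContMDiff.sum fun q hq => (hσt n q hq).1
  -- The functions built for the n-th shell vanish on K (n - 1), so near any point only finitely
  -- many shells contribute and the constants may grow freely.
  have hΨn0 : ∀ m, ∀ x ∈ K m, ∀ n, m < n → Ψn n x = 0 := by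
    intro m x hx n hmn
    exact Finset.sum_eq_zero fun q hq => (hσt n q hq).2.2.2.1 x (hKmono (by omega) hx)
  have hKint : ∀ x, ∃ n, x ∈ interior (K n) := by
    intro x
    obtain ⟨n, hn⟩ := mem_iUnion.1 (hKU.symm ▸ mem_univ x : x ∈ ⋃ n, K n)
    exact ⟨n + 1, hKhull n (subset_holHull _ hn)⟩
  have hlf : LocallyFinite fun n => Function.support (Ψn n) := by
    intro x
    obtain ⟨m, hm⟩ := hKint x
    refine ⟨interior (K m), isOpen_interior.mem_nhds hm, (finite_Iic m).subset ?_⟩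
    rintro n ⟨y, hy1, hy2⟩
    by_contra hnm
    exact hy1 (hΨn0 m y (interior_subset hy2) n (not_le.1 hnm))
  have hloc : ∀ m, ∀ x ∈ K m, ∑ᶠ n, Ψn n x = ∑ n ∈ Finset.range (m + 1), Ψn n x := by
    intro m x hx
    refine finsum_eq_sum_of_support_subset _ fun n hn => ?_
    by_contra hnm
    simp only [Finset.coe_range, mem_Iio, not_lt] at hnm
    exact hn (hΨn0 m x hx n (by omega))
  refine ⟨fun x => ∑ᶠ n, Ψn n x, contMDiff_finsum hΨn hlf, fun x => finsum_nonneg fun n =>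
    Finset.sum_nonneg fun q hq => (hσt n q hq).2.1 x, fun q₀ => ?_⟩
  obtain ⟨n, hn⟩ : ∃ n, q₀ ∈ K (n + 1) \ interior (K n) := by
    classical
    have hex : ∃ n, q₀ ∈ interior (K n) := hKint q₀
    have hfind := Nat.find_spec hex
    obtain ⟨n, hn⟩ : ∃ n, Nat.find hex = n + 1 := by
      refine Nat.exists_eq_succ_of_ne_zero fun h0 => ?_
      rw [h0, hK0, interior_empty] at hfind
      exact hfind
    rw [hn] at hfind
    exact ⟨n, interior_subset hfind, Nat.find_min hex (by omega)⟩
  obtain ⟨p, hp, hqp⟩ := mem_iUnion₂.1 (htcov n hn)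
  refine ⟨p, W n p, isOpen_interior.mem_nhds hqp,
    fun x hx => (interior_subset hx).1, fun x hx v => ?_⟩
  obtain ⟨m, hm⟩ := hKint x
  -- The index m + n is at least n, so the finite sum valid near x contains the n-th shell, where
  -- the large Levi form sits.
  have hmn : x ∈ interior (K (m + n)) := interior_mono (hKmono (by omega)) hm
  have hev : (fun x => ∑ᶠ n, Ψn n x) =ᶠ[𝓝 x]
      fun x => ∑ k ∈ Finset.range (m + n + 1), Ψn k x := by
    filter_upwards [isOpen_interior.mem_nhds hmn] with y hy using hloc _ y (interior_subset hy)
  rw [leviForm_congr hev, leviForm_sum _ fun k _ => ((hΨn k) x).of_le h2]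
  have hΨl : ∀ k, leviForm (Ψn k) x v = ∑ q ∈ t k, leviForm (σ k q) x v := fun k =>
    leviForm_sum _ (fun q hq => ((hσt k q hq).1 x).of_le h2) v
  simp only [hΨl]
  have hnn : ∀ k, ∀ q ∈ t k, 0 ≤ leviForm (σ k q) x v := fun k q hq => (hσt k q hq).2.2.1 x v
  calc C p * ‖tcoord p x v‖ ^ 2 ≤ leviForm (σ n p) x v := (interior_subset hx).2 v
    _ ≤ ∑ q ∈ t n, leviForm (σ n q) x v := Finset.single_le_sum (hnn n) hp
    _ ≤ _ := Finset.single_le_sum (f := fun k => ∑ q ∈ t k, leviForm (σ k q) x v)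
      (fun k _ => Finset.sum_nonneg (hnn k)) (Finset.mem_range.2 (by omega : n < m + n + 1))

end SteinExhaustion

/-! ### The function θ² / log (3 + m - f) and its tangents. -/

section InverseLog

open Set Filter

/-- The function `t ↦ 1 / log (3 + m - t)` for `t ≤ m`, extended by its limit `0` to `-∞`
and as a constant for `t ≥ m`. -/
noncomputable def invLog (m : ℝ) (t : EReal) : ℝ :=
  if t = ⊥ then 0 else (Real.log (3 + m - (min t m).toReal))⁻¹

/-- The shift by 3 > e keeps every logarithm log (3 + m - s) with s ≤ m above 1; thus the
multipliers τ = θ / log (3 + m - s) with 0 ≤ θ ≤ 1 lie in [0, 1]. -/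
theorem one_lt_log_three : 1 < Real.log 3 := by
  rw [Real.lt_log_iff_exp_lt (by norm_num)]
  exact Real.exp_one_lt_d9.trans (by norm_num)

theorem one_lt_log_of_le {m s : ℝ} (h : s ≤ m) : 1 < Real.log (3 + m - s) :=
  one_lt_log_three.trans_le (Real.log_le_log (by norm_num) (by linarith))

theorem invLog_bot (m : ℝ) : invLog m ⊥ = 0 := by simp [invLog]

theorem invLog_of_le {m : ℝ} {t : EReal} (ht : t ≠ ⊥) (h : t ≤ m) :
    invLog m t = (Real.log (3 + m - t.toReal))⁻¹ := by
  rw [invLog, if_neg ht, min_eq_left h]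

theorem toReal_min_le (m : ℝ) {t : EReal} (ht : t ≠ ⊥) : (min t m).toReal ≤ m := by
  have h1 : min t (m : EReal) ≠ ⊥ := by
    rcases min_choice t (m : EReal) with h | h <;> rw [h]
    · exact ht
    · exact EReal.coe_ne_bot m
  simpa using EReal.toReal_le_toReal (min_le_right t (m : EReal)) h1 (EReal.coe_ne_top m)

theorem invLog_nonneg (m : ℝ) (t : EReal) : 0 ≤ invLog m t := by
  unfold invLog
  split_ifs with h
  · exact le_rfl
  · exact inv_nonneg.2 (zero_lt_one.trans (one_lt_log_of_le (toReal_min_le m h))).le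

theorem invLog_le_one (m : ℝ) (t : EReal) : invLog m t ≤ 1 := by
  unfold invLog
  split_ifs with h
  · exact zero_le_one
  · exact inv_le_one_of_one_le₀ (one_lt_log_of_le (toReal_min_le m h)).le

theorem monotone_invLog (m : ℝ) : Monotone (invLog m) := by
  intro s t hst
  rcases eq_or_ne s ⊥ with rfl | hs
  · rw [invLog_bot]; exact invLog_nonneg m t
  have ht : t ≠ ⊥ := fun h => hs (le_bot_iff.1 (h ▸ hst))
  rw [invLog, invLog, if_neg hs, if_neg ht]
  have h1 := toReal_min_le m hs
  have h2 := toReal_min_le m ht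
  have hne : min s (m : EReal) ≠ ⊥ := by
    rcases min_choice s (m : EReal) with h | h <;> rw [h]
    · exact hs
    · exact EReal.coe_ne_bot m
  have hne' : min t (m : EReal) ≠ ⊤ := ((min_le_right _ _).trans_lt (EReal.coe_lt_top m)).ne
  have h3 : (min s (m : EReal)).toReal ≤ (min t (m : EReal)).toReal :=
    EReal.toReal_le_toReal (min_le_min_right _ hst) hne hne'
  have h4 := one_lt_log_of_le h2
  exact inv_anti₀ (by linarith) (Real.log_le_log (by linarith) (by linarith))

/-- The logarithm tends to ∞ as t → -∞, so the value 0 at -∞ is the limit. This is what carries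
continuity of the local functions over to Φ across A. -/
theorem continuous_invLog (m : ℝ) : Continuous (invLog m) := by
  rw [continuous_iff_continuousAt]
  intro t
  rcases eq_or_ne t ⊥ with rfl | ht
  · rw [ContinuousAt, invLog_bot, Metric.tendsto_nhds]
    intro ε hε
    rw [Filter.Eventually, EReal.mem_nhds_bot_iff]
    refine ⟨m - Real.exp ε⁻¹, fun t ht => ?_⟩
    rw [Set.mem_ofPred_eq, Real.dist_eq, sub_zero, abs_of_nonneg (invLog_nonneg m t)]
    rcases eq_or_ne t ⊥ with rfl | htb
    · rwa [invLog_bot]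
    have hexp := Real.exp_pos ε⁻¹
    have htr : t.toReal < m - Real.exp ε⁻¹ := by
      lift t to ℝ using ⟨(lt_of_lt_of_le ht le_top).ne, htb⟩
      exact EReal.coe_lt_coe_iff.1 (by simpa using ht)
    have htm : t ≤ m := by
      refine (le_of_lt ht).trans ?_
      exact_mod_cast (by linarith : m - Real.exp ε⁻¹ ≤ m)
    rw [invLog_of_le htb htm]
    have h1 : ε⁻¹ < Real.log (3 + m - t.toReal) := by
      rw [Real.lt_log_iff_exp_lt (by linarith)]
      linarith
    exact inv_lt_of_inv_lt₀ hε h1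
  · have hmin : min t (m : EReal) ≠ ⊥ := by
      rcases min_choice t (m : EReal) with h | h <;> rw [h]
      · exact ht
      · exact EReal.coe_ne_bot m
    have hmin' : min t (m : EReal) ≠ ⊤ := ((min_le_right _ _).trans_lt (EReal.coe_lt_top m)).ne
    have h1 : ContinuousAt (fun t : EReal => (min t (m : EReal)).toReal) t :=
      (EReal.tendsto_toReal hmin' hmin).comp
        (continuous_id.min continuous_const).continuousAt
    have h2 := one_lt_log_of_le (toReal_min_le m ht)
    have h3 : 3 + m - (min t (m : EReal)).toReal ≠ 0 := by
      have := toReal_min_le m ht; linarith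
    have h4 : ContinuousAt (fun t : EReal => (Real.log (3 + m - (min t (m : EReal)).toReal))⁻¹) t :=
      ((continuousAt_const.sub h1).log h3).inv₀
        (show Real.log (3 + m - (min t (m : EReal)).toReal) ≠ 0 by linarith)
    refine h4.congr ?_
    filter_upwards [isOpen_ne.mem_nhds ht] with s hs
    rw [invLog, if_neg hs]

/-- The function `θ² / log (3 + m - s)` lies above its tangents in `θ` and `s`. -/
theorem tangent_le_sq_mul_inv_log {m s s₀ θ τ : ℝ} (hs : s ≤ m) (hs₀ : s₀ ≤ m) :
    2 * τ * θ - τ ^ 2 * (Real.log (3 + m - s₀) - 1 + (3 + m) / (3 + m - s₀)) +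
      τ ^ 2 / (3 + m - s₀) * s ≤ θ ^ 2 * (Real.log (3 + m - s))⁻¹ := by
  have hL := one_lt_log_of_le hs
  have hS₀ : 0 < 3 + m - s₀ := by linarith
  have hS : 0 < 3 + m - s := by linarith
  -- Concavity: the logarithm lies below its tangent at s₀. The next bound, 2τθ - τ²L ≤ θ²/L, is (τL
  -- - θ)² ≥ 0.
  have h1 : Real.log (3 + m - s) ≤ Real.log (3 + m - s₀) - 1 + (3 + m - s) / (3 + m - s₀) := by
    have := Real.log_le_sub_one_of_pos (div_pos hS hS₀)
    rw [Real.log_div hS.ne' hS₀.ne'] at this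
    linarith
  have h2 : 2 * τ * θ - τ ^ 2 * Real.log (3 + m - s) ≤ θ ^ 2 * (Real.log (3 + m - s))⁻¹ := by
    set L := Real.log (3 + m - s)
    rw [← div_eq_mul_inv, le_div_iff₀ (by linarith)]
    nlinarith [sq_nonneg (τ * L - θ)]
  have h3 : τ ^ 2 * Real.log (3 + m - s) ≤
      τ ^ 2 * (Real.log (3 + m - s₀) - 1 + (3 + m - s) / (3 + m - s₀)) := by gcongr
  have h4 : (3 + m - s) / (3 + m - s₀) = (3 + m) / (3 + m - s₀) - s / (3 + m - s₀) := by ring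
  rw [h4] at h3
  calc _ = 2 * τ * θ - τ ^ 2 * (Real.log (3 + m - s₀) - 1 + ((3 + m) / (3 + m - s₀) -
        s / (3 + m - s₀))) := by ring
    _ ≤ _ := by linarith

/-- The equality case of `tangent_le_sq_mul_inv_log`: s = s₀ and τ = θ/L, which makes the square (τL
- θ)² vanish. -/
theorem tangent_eq_sq_mul_inv_log {m s θ : ℝ} (hs : s ≤ m) :
    2 * (θ * (Real.log (3 + m - s))⁻¹) * θ - (θ * (Real.log (3 + m - s))⁻¹) ^ 2 *
      (Real.log (3 + m - s) - 1 + (3 + m) / (3 + m - s)) +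
      (θ * (Real.log (3 + m - s))⁻¹) ^ 2 / (3 + m - s) * s =
      θ ^ 2 * (Real.log (3 + m - s))⁻¹ := by
  have hL := one_lt_log_of_le hs
  have hS : 3 + m - s ≠ 0 := by linarith
  set L := Real.log (3 + m - s)
  have hL0 : L ≠ 0 := by linarith
  field_simp
  ring

variable {E : Type*} [NormedAddCommGroup E] [NormedSpace ℂ E]

theorem contDiffAt_log_shift {X : Type*} [NormedAddCommGroup X] [NormedSpace ℝ X] {n : ℕ∞ω}
    {g : X → ℝ} {p : X} {m : ℝ} (hg : ContDiffAt ℝ n g p) (hm : g p ≤ m) :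
    ContDiffAt ℝ n (fun z => Real.log (3 + m - g z)) p :=
  (contDiffAt_const.sub hg).log (by linarith)

theorem levi_neg_log_shift {g : E → ℝ} {p : E} {m : ℝ} (hg : ContDiffAt ℝ 2 g p) (hm : g p ≤ m)
    (v : E) : levi (fun z => -Real.log (3 + m - g z)) p v = (3 + m - g p)⁻¹ * levi g p v +
      ((3 + m - g p)⁻¹) ^ 2 / 4 * ((fderiv ℝ g p v) ^ 2 + (fderiv ℝ g p (Complex.I • v)) ^ 2) := by
  have hne : 3 + m - g p ≠ 0 := by linarith
  have hd : ∀ y, 3 + m - y ≠ 0 → HasDerivAt (fun t => -Real.log (3 + m - t)) (3 + m - y)⁻¹ y := by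
    intro y hy
    have := (((hasDerivAt_id y).const_sub (3 + m)).log hy).neg
    refine this.congr_deriv ?_
    simp [neg_div]
  refine levi_comp_real hg (χ := fun t => -Real.log (3 + m - t)) (χ' := fun t => (3 + m - t)⁻¹)
    ?_ ?_ v
  · have hc : ContinuousAt (fun y : ℝ => 3 + m - y) (g p) := by fun_prop
    filter_upwards [hc.eventually_ne hne] with y hy using hd y hy
  · have := ((hasDerivAt_id (g p)).const_sub (3 + m)).inv hne
    refine this.congr_deriv ?_
    simp

/-- With L = log (3 + m - g) and τ = t(p)/L(p) frozen, t²/L - 2τt + τ²L = (t - τL)²/L is nonnegative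
near p and zero at p. Its Levi form is nonnegative at this local minimum, and no second derivative
of the quotient need be expanded. -/
theorem le_levi_sq_mul_inv_log {t g : E → ℝ} {p : E} {m : ℝ} (ht : ContDiffAt ℝ 2 t p)
    (hg : ContDiffAt ℝ 2 g p) (hm : g p < m) (v : E) :
    2 * (t p * (Real.log (3 + m - g p))⁻¹) * levi t p v +
      (t p * (Real.log (3 + m - g p))⁻¹) ^ 2 * levi (fun z => -Real.log (3 + m - g z)) p v ≤
      levi (fun z => t z ^ 2 * (Real.log (3 + m - g z))⁻¹) p v := by
  set τ := t p * (Real.log (3 + m - g p))⁻¹ with hτ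
  have hL0 := one_lt_log_of_le hm.le
  have hLc := contDiffAt_log_shift hg hm.le
  have hV : ContDiffAt ℝ 2 (fun z => t z ^ 2 * (Real.log (3 + m - g z))⁻¹) p :=
    (ht.pow 2).mul (hLc.inv (by linarith))
  have h1 : ContDiffAt ℝ 2 (fun z => -(2 * τ) * t z) p := contDiffAt_const.mul ht
  have h2 : ContDiffAt ℝ 2 (fun z => -τ ^ 2 * -Real.log (3 + m - g z)) p :=
    contDiffAt_const.mul hLc.neg
  have hmin : IsLocalMin (fun z => t z ^ 2 * (Real.log (3 + m - g z))⁻¹ +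
      (-(2 * τ) * t z + -τ ^ 2 * -Real.log (3 + m - g z))) p := by
    have hev := hg.continuousAt.eventually (gt_mem_nhds hm)
    filter_upwards [hev] with z hz
    have hL := one_lt_log_of_le hz.le
    have e : ∀ L t : ℝ, 1 < L → t ^ 2 * L⁻¹ + (-(2 * τ) * t + -τ ^ 2 * -L) =
        (t - τ * L) ^ 2 * L⁻¹ := by
      intro L t hL
      have : L ≠ 0 := by linarith
      field_simp
      ring
    rw [e _ _ hL, e _ _ hL0]
    have h0 : t p - τ * Real.log (3 + m - g p) = 0 := by
      have : Real.log (3 + m - g p) ≠ 0 := by linarith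
      rw [hτ]; field_simp; ring
    have : 0 ≤ (Real.log (3 + m - g z))⁻¹ := inv_nonneg.2 (by linarith)
    rw [h0, zero_pow two_ne_zero, zero_mul]
    exact mul_nonneg (sq_nonneg _) this
  have := hmin.levi_nonneg (hV.add (h1.add h2)) v
  rw [levi_add hV (h1.add h2), levi_add h1 h2, levi_const_mul _ ht, levi_const_mul _ hLc.neg] at this
  linarith

end InverseLog

/-! ### The glued sum and lower bounds for its Levi form off A. -/

section LocalPotentials

open Set Filter

/-- Plurisubharmonic functions `f j < m j` on a locally finite family of open sets `O j`, with
Kähler metrics complete along `A` as Levi forms off `A`, and smooth cutoff functions `θ j`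
supported in `O j`, one of which is `1` near any given point. -/
structure LocalPotentials (E : Type*) [NormedAddCommGroup E] [NormedSpace ℂ E]
    {M : Type*} [TopologicalSpace M] [ChartedSpace E M] (A : Set M) (J : Type*) where
  θ : J → M → ℝ
  O : J → Set M
  f : J → M → EReal
  m : J → ℝ
  smooth : ∀ j, ContMDiff 𝓘(ℝ, E) 𝓘(ℝ, ℝ) ∞ (θ j)
  nonneg : ∀ j x, 0 ≤ θ j x
  le_one : ∀ j x, θ j x ≤ 1
  locallyFinite : LocallyFinite fun j => tsupport (θ j)
  exists_eq_one : ∀ x, ∃ j, θ j =ᶠ[𝓝 x] 1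
  isOpen : ∀ j, IsOpen (O j)
  tsupport_subset : ∀ j, tsupport (θ j) ⊆ O j
  psh : ∀ j, IsPSHOn E (f j) (O j)
  lt : ∀ j, ∀ x ∈ O j, f j x < m j
  ne_bot : ∀ j, ∀ x ∈ O j \ A, f j x ≠ ⊥
  kahler : ∀ j, IsKahlerPotentialOn E (fun x => (f j x).toReal) (O j \ A)
  complete : ∀ j, IsLeviCompleteAlong E (fun x => (f j x).toReal) (O j) A

namespace LocalPotentials

variable {E : Type*} [NormedAddCommGroup E] [NormedSpace ℂ E]
  {M : Type*} [TopologicalSpace M] [ChartedSpace E M] {A : Set M} {J : Type*}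
  (P : LocalPotentials E A J)

/-- The indices whose cutoff function is supported at `x`. -/
noncomputable def idx (x : M) : Finset J := (P.locallyFinite.point_finite x).toFinset

theorem mem_idx {x : M} {j : J} : j ∈ P.idx x ↔ x ∈ tsupport (P.θ j) := by simp [idx]

theorem mem_of_mem_idx {x : M} {j : J} (h : j ∈ P.idx x) : x ∈ P.O j :=
  P.tsupport_subset j (P.mem_idx.1 h)

theorem eq_zero_of_notMem_idx {x : M} {j : J} (h : j ∉ P.idx x) : P.θ j x = 0 :=
  image_eq_zero_of_notMem_tsupport fun hx => h (P.mem_idx.2 hx)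

theorem eventually_idx_subset (x : M) : ∀ᶠ y in 𝓝 x, P.idx y ⊆ P.idx x := by
  filter_upwards [P.locallyFinite.eventually_subset (fun j => isClosed_tsupport _) x] with y hy
  intro j hj
  exact P.mem_idx.2 (hy (P.mem_idx.1 hj))

/-- The cut-off function `θ² / log (3 + m - f)`, which vanishes where `f = -∞`. -/
noncomputable def term (j : J) (x : M) : ℝ := P.θ j x ^ 2 * invLog (P.m j) (P.f j x)

noncomputable def total (x : M) : ℝ := ∑ᶠ j, P.term j x

/-- The function `-log (3 + m - f)`. -/
noncomputable def negLog (j : J) (x : M) : ℝ := -Real.log (3 + P.m j - (P.f j x).toReal)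

theorem term_nonneg (j : J) (x : M) : 0 ≤ P.term j x :=
  mul_nonneg (sq_nonneg _) (invLog_nonneg _ _)

theorem total_nonneg (x : M) : 0 ≤ P.total x := finsum_nonneg fun j => P.term_nonneg j x

theorem term_eq_zero {x : M} {j : J} (h : j ∉ P.idx x) : P.term j x = 0 := by
  simp [term, P.eq_zero_of_notMem_idx h]

theorem total_eq_sum {x : M} {s : Finset J} (h : P.idx x ⊆ s) :
    P.total x = ∑ j ∈ s, P.term j x :=
  finsum_eq_sum_of_support_subset _ fun j hj => by
    by_contra hjs
    exact hj (P.term_eq_zero fun hj' => hjs (h hj'))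

theorem eventually_total_eq (x : M) : P.total =ᶠ[𝓝 x] fun y => ∑ j ∈ P.idx x, P.term j y := by
  filter_upwards [P.eventually_idx_subset x] with y hy using P.total_eq_sum hy

theorem toReal_lt {j : J} {x : M} (hx : x ∈ P.O j) (h : P.f j x ≠ ⊥) :
    (P.f j x).toReal < P.m j := by
  have h1 := P.lt j x hx
  rw [← EReal.coe_toReal (h1.trans_le le_top).ne h] at h1
  exact EReal.coe_lt_coe_iff.1 h1

theorem invLog_eq {j : J} {x : M} (hx : x ∈ P.O j) (h : P.f j x ≠ ⊥) :
    invLog (P.m j) (P.f j x) = (Real.log (3 + P.m j - (P.f j x).toReal))⁻¹ :=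
  invLog_of_le h (P.lt j x hx).le

theorem eventually_mem_diff (hA : IsClosed A) {j : J} {x : M} (hx : x ∈ P.O j \ A) :
    ∀ᶠ y in 𝓝 x, y ∈ P.O j \ A :=
  ((P.isOpen j).sdiff hA).mem_nhds hx

theorem contMDiffAt_toReal (hA : IsClosed A) {j : J} {x : M} (hx : x ∈ P.O j \ A) :
    ContMDiffAt 𝓘(ℝ, E) 𝓘(ℝ, ℝ) ∞ (fun y => (P.f j y).toReal) x :=
  ((P.kahler j).1 x hx).contMDiffAt (P.eventually_mem_diff hA hx)

theorem eventually_term_eq (hA : IsClosed A) {j : J} {x : M} (hx : x ∈ P.O j \ A) :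
    P.term j =ᶠ[𝓝 x] fun y => P.θ j y ^ 2 * (Real.log (3 + P.m j - (P.f j y).toReal))⁻¹ := by
  filter_upwards [P.eventually_mem_diff hA hx] with y hy
  rw [term, P.invLog_eq hy.1 (P.ne_bot j y hy)]

section Manifold

variable [IsManifold 𝓘(ℂ, E) ω M]

theorem contMDiffAt_negLog (hA : IsClosed A) {j : J} {x : M} (hx : x ∈ P.O j \ A) :
    ContMDiffAt 𝓘(ℝ, E) 𝓘(ℝ, ℝ) ∞ (P.negLog j) x := by
  have h1 := (P.contMDiffAt_toReal hA hx).contDiffAt_chart le_rfl (chart_mem_atlas E x)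
    (mem_chart_source E x)
  refine contMDiffAt_of_contDiffAt_chart le_rfl (chart_mem_atlas E x) (mem_chart_source E x) ?_
  refine (contDiffAt_log_shift h1 (m := P.m j) ?_).neg
  rw [(chartAt E x).left_inv (mem_chart_source E x)]
  exact (P.toReal_lt hx.1 (P.ne_bot j x hx)).le

theorem contMDiffAt_term (hA : IsClosed A) {j : J} {x : M} (hx : x ∈ P.O j \ A) :
    ContMDiffAt 𝓘(ℝ, E) 𝓘(ℝ, ℝ) ∞ (P.term j) x := by
  have h1 := (P.contMDiffAt_negLog hA hx).contDiffAt_chart le_rfl (chart_mem_atlas E x)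
    (mem_chart_source E x)
  have h2 := ((P.smooth j) x).contDiffAt_chart le_rfl (chart_mem_atlas E x)
    (mem_chart_source E x)
  refine ContMDiffAt.congr_of_eventuallyEq ?_ (P.eventually_term_eq hA hx)
  refine contMDiffAt_of_contDiffAt_chart le_rfl (chart_mem_atlas E x) (mem_chart_source E x) ?_
  have hL := one_lt_log_of_le (P.toReal_lt hx.1 (P.ne_bot j x hx)).le
  have h3 : ContDiffAt ℝ ∞ (fun z => Real.log (3 + P.m j -
      (P.f j ((chartAt E x).symm z)).toReal)) (chartAt E x x) := by
    simpa [negLog] using h1.neg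
  refine (h2.pow 2).mul (h3.inv ?_)
  rw [(chartAt E x).left_inv (mem_chart_source E x)]
  linarith

theorem contMDiffAt_total (hA : IsClosed A) {x : M} (hx : x ∉ A) :
    ContMDiffAt 𝓘(ℝ, E) 𝓘(ℝ, ℝ) ∞ P.total x :=
  ContMDiffAt.congr_of_eventuallyEq
    (ContMDiffAt.sum fun _ hj => P.contMDiffAt_term hA ⟨P.mem_of_mem_idx hj, hx⟩)
    (P.eventually_total_eq x)

/-- For χ(t) = -log (3 + m - t) one has χ'' = χ'². The χ' term compares with the metric of f; the
χ'' term controls the squared differential. Both are used in the proof of completeness. -/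
theorem leviForm_negLog (hA : IsClosed A) {j : J} {x : M} (hx : x ∈ P.O j \ A) (v : E) :
    (3 + P.m j - (P.f j x).toReal)⁻¹ * leviForm (fun y => (P.f j y).toReal) x v ≤
      leviForm (P.negLog j) x v ∧
    (dform (P.negLog j) x v) ^ 2 ≤ 4 * leviForm (P.negLog j) x v := by
  have h2 : (2 : ℕ∞ω) ≤ (∞ : ℕ∞ω) := WithTop.coe_le_coe.2 (le_top (a := (2 : ℕ∞)))
  set g : E → ℝ := fun z => (P.f j ((chartAt E x).symm z)).toReal with hg
  have h1 : ContDiffAt ℝ 2 g (chartAt E x x) :=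
    ((P.contMDiffAt_toReal hA hx).of_le h2).contDiffAt_chart h2 (chart_mem_atlas E x)
      (mem_chart_source E x)
  have hgx : g (chartAt E x x) = (P.f j x).toReal := by
    simp only [hg, (chartAt E x).left_inv (mem_chart_source E x)]
  have hlt : g (chartAt E x x) < P.m j := hgx ▸ P.toReal_lt hx.1 (P.ne_bot j x hx)
  have e : leviForm (P.negLog j) x v = _ := levi_neg_log_shift h1 hlt.le v
  have hpos : 0 < 3 + P.m j - g (chartAt E x x) := by linarith
  have e1 : leviForm (fun y => (P.f j y).toReal) x v = levi g (chartAt E x x) v := rfl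
  have hnn : 0 ≤ levi g (chartAt E x x) v := by
    rcases eq_or_ne v 0 with rfl | hv
    · simp [levi]
    · exact ((P.kahler j).2 x hx v hv).le
  have hd : dform (P.negLog j) x v =
      (3 + P.m j - g (chartAt E x x))⁻¹ * fderiv ℝ g (chartAt E x x) v := by
    have h3 := (((h1.differentiableAt two_ne_zero).hasFDerivAt.const_sub (3 + P.m j)).log
      hpos.ne').neg
    have : dform (P.negLog j) x v = fderiv ℝ (fun z => -Real.log (3 + P.m j - g z))
      (chartAt E x x) v := rfl
    rw [this, HasFDerivAt.fderiv (f := fun z => -Real.log (3 + P.m j - g z)) h3]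
    simp
  rw [e, hd, e1, ← hgx]
  have hinv := inv_nonneg.2 hpos.le
  set s := (3 + P.m j - g (chartAt E x x))⁻¹
  have := mul_nonneg hinv hnn
  have h4 := mul_nonneg (sq_nonneg s) (sq_nonneg (fderiv ℝ g (chartAt E x x) (Complex.I • v)))
  have h5 := mul_nonneg (sq_nonneg s) (sq_nonneg (fderiv ℝ g (chartAt E x x) v))
  constructor <;> nlinarith

/-- Since 0 ≤ τ ≤ 1, the error 2τ levi θ of `le_levi_sq_mul_inv_log` is bounded independently of f,
hence uniformly up to A. -/
theorem le_leviForm_term (hA : IsClosed A) {j : J} {x : M} (hx : x ∈ P.O j \ A) (v : E) :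
    -(2 * |leviForm (P.θ j) x v|) +
      (P.θ j x * (Real.log (3 + P.m j - (P.f j x).toReal))⁻¹) ^ 2 * leviForm (P.negLog j) x v ≤
      leviForm (P.term j) x v := by
  have h2 : (2 : ℕ∞ω) ≤ (∞ : ℕ∞ω) := WithTop.coe_le_coe.2 (le_top (a := (2 : ℕ∞)))
  have hl := (chartAt E x).left_inv (mem_chart_source E x)
  have h1 := ((P.contMDiffAt_toReal hA hx).of_le h2).contDiffAt_chart h2 (chart_mem_atlas E x)
      (mem_chart_source E x)
  have ht := (((P.smooth j) x).of_le h2).contDiffAt_chart h2 (chart_mem_atlas E x)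
    (mem_chart_source E x)
  have hlt := P.toReal_lt hx.1 (P.ne_bot j x hx)
  have key := le_levi_sq_mul_inv_log ht h1 (m := P.m j) (by rwa [hl]) v
  rw [hl] at key
  rw [leviForm_congr (P.eventually_term_eq hA hx) v]
  refine le_trans ?_ key
  have hL := one_lt_log_of_le hlt.le
  set τ := P.θ j x * (Real.log (3 + P.m j - (P.f j x).toReal))⁻¹ with hτ
  have hτ0 : 0 ≤ τ := mul_nonneg (P.nonneg j x) (inv_nonneg.2 (by linarith))
  have hτ1 : τ ≤ 1 := mul_le_one₀ (P.le_one j x) (inv_nonneg.2 (by linarith))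
    (inv_le_one_of_one_le₀ hL.le)
  have h3 : -(2 * |leviForm (P.θ j) x v|) ≤ 2 * τ * leviForm (P.θ j) x v := by
    have := neg_abs_le (leviForm (P.θ j) x v)
    have h4 := abs_nonneg (leviForm (P.θ j) x v)
    nlinarith
  have e2 : leviForm (P.θ j) x v =
    levi (fun z => P.θ j ((chartAt E x).symm z)) (chartAt E x x) v := rfl
  rw [e2] at h3 ⊢
  exact add_le_add_left h3 _

theorem le_leviForm_add_total (hA : IsClosed A) {Ψ : M → ℝ}
    (hΨ : ContMDiff 𝓘(ℝ, E) 𝓘(ℝ, ℝ) ∞ Ψ) {x : M} (hx : x ∉ A) (v : E) :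
    leviForm Ψ x v - ∑ j ∈ P.idx x, 2 * |leviForm (P.θ j) x v| +
      ∑ j ∈ P.idx x, (P.θ j x * (Real.log (3 + P.m j - (P.f j x).toReal))⁻¹) ^ 2 *
        leviForm (P.negLog j) x v ≤ leviForm (fun y => Ψ y + P.total y) x v := by
  have h2 : (2 : ℕ∞ω) ≤ (∞ : ℕ∞ω) := WithTop.coe_le_coe.2 (le_top (a := (2 : ℕ∞)))
  have hO : ∀ j ∈ P.idx x, x ∈ P.O j \ A := fun j hj => ⟨P.mem_of_mem_idx hj, hx⟩
  rw [leviForm_add ((hΨ x).of_le h2) ((P.contMDiffAt_total hA hx).of_le h2),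
    leviForm_congr (P.eventually_total_eq x),
    leviForm_sum _ fun j hj => (P.contMDiffAt_term hA (hO j hj)).of_le h2]
  have := Finset.sum_le_sum fun j hj => P.le_leviForm_term hA (hO j hj) v
  rw [Finset.sum_add_distrib, Finset.sum_neg_distrib] at this
  linarith

theorem leviForm_negLog_nonneg (hA : IsClosed A) {j : J} {x : M} (hx : x ∈ P.O j \ A) (v : E) :
    0 ≤ leviForm (P.negLog j) x v := by
  have := (P.leviForm_negLog hA hx v).2
  nlinarith [sq_nonneg (dform (P.negLog j) x v)]

end Manifold

end LocalPotentials

end LocalPotentials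

/-! ### Plurisubharmonicity of the glued function across A. -/

section Plurisubharmonicity

open Set Filter Metric MeasureTheory

namespace LocalPotentials

variable {E : Type*} [NormedAddCommGroup E] [NormedSpace ℂ E]
  {M : Type*} [TopologicalSpace M] [ChartedSpace E M] {A : Set M} {J : Type*}
  (P : LocalPotentials E A J)

/-- With θ² frozen at x, a continuous monotone function of f remains, which is upper semicontinuous.
As `invLog` takes values in [0, 1], freezing costs at most |θ(z)² - θ(x)²|. -/
theorem upperSemicontinuousAt_term {j : J} {x : M} (hx : x ∈ P.O j) :
    UpperSemicontinuousAt (P.term j) x := by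
  have hf : UpperSemicontinuousAt (P.f j) x := by
    have := (P.psh j).1 x hx
    intro y hy
    have h := this y hy
    rwa [nhdsWithin_eq_nhds.2 ((P.isOpen j).mem_nhds hx)] at h
  have hm : Monotone fun t => P.θ j x ^ 2 * invLog (P.m j) t := fun s t h =>
    mul_le_mul_of_nonneg_left (monotone_invLog _ h) (sq_nonneg _)
  have h1 : UpperSemicontinuousAt (fun z => P.θ j x ^ 2 * invLog (P.m j) (P.f j z)) x :=
    (continuous_const.mul (continuous_invLog (P.m j))).continuousAt.comp_upperSemicontinuousAt
      hf hm
  have h2 : ContinuousAt (fun z => |P.θ j z ^ 2 - P.θ j x ^ 2|) x := by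
    have := (P.smooth j).continuous
    exact Continuous.continuousAt (by fun_prop)
  have h3 := h1.add h2.upperSemicontinuousAt
  intro y hy
  have h4 := h3 y (by simpa [term] using hy)
  filter_upwards [h4] with z hz
  refine lt_of_le_of_lt ?_ hz
  have e1 := invLog_nonneg (P.m j) (P.f j z)
  have e2 := invLog_le_one (P.m j) (P.f j z)
  have e3 := le_abs_self (P.θ j z ^ 2 - P.θ j x ^ 2)
  have e4 := abs_nonneg (P.θ j z ^ 2 - P.θ j x ^ 2)
  rw [term]
  nlinarith

theorem upperSemicontinuous_total : UpperSemicontinuous P.total := by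
  intro x y hy
  have h : UpperSemicontinuousAt (fun z => ∑ j ∈ P.idx x, P.term j z) x :=
    upperSemicontinuousAt_sum fun j hj => P.upperSemicontinuousAt_term (P.mem_of_mem_idx hj)
  have := h y (by
    change ∑ j ∈ P.idx x, P.term j x < y
    rwa [← P.total_eq_sum (Finset.Subset.refl _)])
  filter_upwards [this, P.eventually_total_eq x] with z hz1 hz2
  rwa [hz2]

theorem continuous_total (h : ∀ j, ContinuousOn (P.f j) (P.O j)) : Continuous P.total := by
  rw [continuous_iff_continuousAt]
  intro x
  refine ContinuousAt.congr ?_ (P.eventually_total_eq x).symm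
  refine tendsto_finsetSum _ fun j hj => ?_
  have hj' := P.mem_of_mem_idx hj
  exact ((P.smooth j).continuous.pow 2).continuousAt.mul
    ((continuous_invLog (P.m j)).continuousAt.comp
      ((h j).continuousAt ((P.isOpen j).mem_nhds hj')))

theorem eventually_le_circleMean {j : J} {x : M} (hx : x ∈ P.O j)
    {c : OpenPartialHomeomorph M E} (hc : c ∈ atlas E M) (hxc : x ∈ c.source) (b : E) :
    ∀ᶠ r : ℝ in 𝓝[>] 0, P.f j (c.symm (c x)) ≤
      circleMean (fun z => P.f j (c.symm z)) (c x) ((r : ℂ) • b) := by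
  have h1 : ∀ᶠ z in 𝓝 (c x), z ∈ c.target ∧ c.symm z ∈ P.O j := by
    have h0 : ∀ᶠ z in 𝓝 (c x), z ∈ c.target := c.open_target.mem_nhds (c.map_source hxc)
    refine h0.and ?_
    have := c.continuousAt_symm (c.map_source hxc)
    refine this.eventually ((P.isOpen j).mem_nhds ?_)
    rwa [c.left_inv hxc]
  obtain ⟨ε, hε, hball⟩ := Metric.eventually_nhds_iff_ball.1 h1
  have h2 : ∀ᶠ r : ℝ in 𝓝 0, ‖r‖ * ‖b‖ < ε := by
    have : Continuous fun r : ℝ => ‖r‖ * ‖b‖ := by fun_prop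
    exact this.continuousAt.eventually (gt_mem_nhds (by simpa using hε))
  filter_upwards [mem_nhdsWithin_of_mem_nhds h2] with r hr
  refine (P.psh j).2.2 c hc (c x) ((r : ℂ) • b) fun ζ hζ => hball _ ?_
  rw [mem_ball_iff_norm, add_sub_cancel_left, norm_smul, norm_smul, Complex.norm_real]
  calc ‖ζ‖ * (‖r‖ * ‖b‖) ≤ 1 * (‖r‖ * ‖b‖) := by gcongr
    _ < ε := by rwa [one_mul]

variable [IsManifold 𝓘(ℂ, E) ω M]

theorem eventually_lt_integral {Ψ : M → ℝ} (hΨ : ContMDiff 𝓘(ℝ, E) 𝓘(ℝ, ℝ) ∞ Ψ)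
    (hΨ0 : ∀ x, 0 ≤ Ψ x)
    (hlevi : ∀ x (v : E), v ≠ 0 → ∑ j ∈ P.idx x, 2 * |leviForm (P.θ j) x v| < leviForm Ψ x v)
    {c : OpenPartialHomeomorph M E} (hc : c ∈ atlas E M) {x : M} (hxc : x ∈ c.source) {b : E}
    (hb : b ≠ 0) :
    ∀ᶠ r : ℝ in 𝓝[>] 0, Ψ (c.symm (c x)) + P.total (c.symm (c x)) <
      ∫ θ in Ioc (0 : ℝ) 1, (Ψ (c.symm (c x + (r * unitExp θ : ℂ) • b)) +
        P.total (c.symm (c x + (r * unitExp θ : ℂ) • b))) := by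
  classical
  have h2 : (2 : ℕ∞ω) ≤ (∞ : ℕ∞ω) := WithTop.coe_le_coe.2 (le_top (a := (2 : ℕ∞)))
  have hl := c.left_inv hxc
  -- Terms with f = -∞ at x vanish at x and are nonnegative elsewhere, so the support function may
  -- omit them.
  let s : Finset J := {j ∈ P.idx x | P.f j x ≠ ⊥}
  have hs : ∀ j ∈ s, x ∈ P.O j ∧ P.f j x ≠ ⊥ := fun j hj =>
    ⟨P.mem_of_mem_idx (Finset.mem_filter.1 hj).1, (Finset.mem_filter.1 hj).2⟩
  let y : J → ℝ := fun j => (P.f j x).toReal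
  have hy : ∀ j ∈ s, y j ≤ P.m j := fun j hj => (P.toReal_lt (hs j hj).1 (hs j hj).2).le
  let τ : J → ℝ := fun j => P.θ j x * (Real.log (3 + P.m j - y j))⁻¹
  let K : J → ℝ := fun j =>
    τ j ^ 2 * (Real.log (3 + P.m j - y j) - 1 + (3 + P.m j) / (3 + P.m j - y j))
  -- σ' is Ψ plus the smooth part of the tangents of `tangent_le_sq_mul_inv_log`; their remaining
  -- part is the multiple τ² / (3 + m - y) of f, passed below as κ.
  let σ : M → ℝ := fun z => Ψ z + ∑ j ∈ s, 2 * τ j * P.θ j z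
  let σ' : M → ℝ := fun z => σ z + -∑ j ∈ s, K j
  have hσ : ContMDiff 𝓘(ℝ, E) 𝓘(ℝ, ℝ) ∞ σ :=
    hΨ.add (ContMDiff.sum fun j _ => contMDiff_const.mul (P.smooth j))
  have hσ' : ContMDiffAt 𝓘(ℝ, E) 𝓘(ℝ, ℝ) 2 σ' x := ((hσ.add contMDiff_const) x).of_le h2
  have hθ2 : ∀ j, ContMDiffAt 𝓘(ℝ, E) 𝓘(ℝ, ℝ) 2 (P.θ j) x := fun j => ((P.smooth j) x).of_le h2
  have hpos : ∀ w : E, w ≠ 0 → 0 < leviForm σ' x w := by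
    intro w hw
    have e0 : leviForm (fun _ : M => -∑ j ∈ s, K j) x w = 0 := levi_const _ _ _
    have e1 : leviForm σ' x w = leviForm Ψ x w + ∑ j ∈ s, 2 * τ j * leviForm (P.θ j) x w := by
      have e2 : ∀ j ∈ s, ContMDiffAt 𝓘(ℝ, E) 𝓘(ℝ, ℝ) 2 (fun z => 2 * τ j * P.θ j z) x :=
        fun j _ => contMDiffAt_const.mul (hθ2 j)
      rw [leviForm_add ((hσ x).of_le h2) contMDiffAt_const, e0, add_zero,
        leviForm_add ((hΨ x).of_le h2) (ContMDiffAt.sum e2), leviForm_sum _ e2]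
      simp only [leviForm_const_mul _ (hθ2 _)]
    have e2 : ∑ j ∈ s, -(2 * |leviForm (P.θ j) x w|) ≤
        ∑ j ∈ s, 2 * τ j * leviForm (P.θ j) x w := by
      refine Finset.sum_le_sum fun j hj => ?_
      have hL := one_lt_log_of_le (hy j hj)
      have hi := inv_nonneg.2 (zero_le_one.trans hL.le)
      have h0 : 0 ≤ τ j := mul_nonneg (P.nonneg j x) hi
      have h1 : τ j ≤ 1 := mul_le_one₀ (P.le_one j x) hi (inv_le_one_of_one_le₀ hL.le)
      have := neg_abs_le (leviForm (P.θ j) x w)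
      have h4 := abs_nonneg (leviForm (P.θ j) x w)
      nlinarith
    have e3 : ∑ j ∈ s, 2 * |leviForm (P.θ j) x w| ≤ ∑ j ∈ P.idx x, 2 * |leviForm (P.θ j) x w| :=
      Finset.sum_le_sum_of_subset_of_nonneg (Finset.filter_subset _ _)
        fun j _ _ => by positivity
    have := hlevi x w hw
    rw [Finset.sum_neg_distrib] at e2
    rw [e1]
    linarith
  let O : Set E := c.target ∩ c.symm ⁻¹' {z | P.idx z ⊆ P.idx x ∧ ∀ j ∈ P.idx x, z ∈ P.O j}
  have hOc : ContinuousOn c.symm O := c.continuousOn_symm.mono inter_subset_left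
  have hO : O ∈ 𝓝 (c x) := by
    refine inter_mem (c.open_target.mem_nhds (c.map_source hxc)) ?_
    have h1 := c.continuousAt_symm (c.map_source hxc)
    rw [ContinuousAt, hl] at h1
    refine h1.eventually ((P.eventually_idx_subset x).and ?_)
    exact (Finset.eventually_all _).2 fun j hj => (P.isOpen j).mem_nhds (P.mem_of_mem_idx hj)
  have husc : UpperSemicontinuousOn (fun z => Ψ (c.symm z) + P.total (c.symm z)) O := by
    have h1 : UpperSemicontinuous fun z => Ψ z + P.total z :=
      hΨ.continuous.upperSemicontinuous.add P.upperSemicontinuous_total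
    exact (upperSemicontinuousOn_univ_iff.2 h1).comp hOc (mapsTo_univ _ _)
  refine eventually_lt_integral_of_support s (S := fun z => σ' (c.symm z))
    (u := fun z => Ψ (c.symm z) + P.total (c.symm z))
    (f := fun j z => P.f j (c.symm z)) (κ := fun j => τ j ^ 2 / (3 + P.m j - y j))
    (M := P.m) hO husc
    (m := 0) (fun z _ => add_nonneg (hΨ0 _) (P.total_nonneg _)) (hσ'.contDiffAt_chart h2 hc hxc)
    ?_ ?_ ?_ ?_ ?_ ?_ ?_ ?_
  · rw [levi_transition hσ' hc (chart_mem_atlas E x) hxc (mem_chart_source E x)]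
    refine hpos _ fun h => hb ?_
    have := fderiv_transition_comp hc (chart_mem_atlas E x) hxc (mem_chart_source E x) b
    rw [h, map_zero] at this
    exact this.symm
  · intro j hj
    exact div_nonneg (sq_nonneg _) (by linarith [hy j hj])
  · intro j hj
    exact (P.psh j).1.comp hOc fun z hz => hz.2.2 j (Finset.mem_filter.1 hj).1
  · intro j hj z hz
    exact (P.lt j _ (hz.2.2 j (Finset.mem_filter.1 hj).1)).le
  · intro j hj
    simp only [hl]
    exact (hs j hj).2
  · intro j hj
    exact P.eventually_le_circleMean (hs j hj).1 hc hxc b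
  · intro z hz hbot
    have e1 : ∑ j ∈ s, P.term j (c.symm z) ≤ P.total (c.symm z) := by
      rw [P.total_eq_sum hz.2.1]
      exact Finset.sum_le_sum_of_subset_of_nonneg (Finset.filter_subset _ _)
        fun j _ _ => P.term_nonneg j _
    refine le_trans ?_ (add_le_add_right e1 _)
    simp only [σ', σ]
    rw [← Finset.sum_neg_distrib, add_assoc, add_assoc, ← Finset.sum_add_distrib,
      ← Finset.sum_add_distrib]
    refine add_le_add_right (Finset.sum_le_sum fun j hj => ?_) _
    have hzO := hz.2.2 j (Finset.mem_filter.1 hj).1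
    rw [term, P.invLog_eq hzO (hbot j hj)]
    have := tangent_le_sq_mul_inv_log (θ := P.θ j (c.symm z)) (τ := τ j)
      (P.toReal_lt hzO (hbot j hj)).le (hy j hj)
    simp only [K]
    linarith
  · simp only [hl, σ', σ]
    have e1 : P.total x = ∑ j ∈ s, P.term j x := by
      rw [P.total_eq_sum (Finset.Subset.refl _)]
      symm
      refine Finset.sum_subset (Finset.filter_subset _ _) fun j hj hjs => ?_
      have : P.f j x = ⊥ := by
        by_contra h
        exact hjs (Finset.mem_filter.2 ⟨hj, h⟩)
      rw [term, this, invLog_bot, mul_zero]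
    rw [e1, ← Finset.sum_neg_distrib, add_assoc, add_assoc, ← Finset.sum_add_distrib,
      ← Finset.sum_add_distrib]
    congr 1
    refine Finset.sum_congr rfl fun j hj => ?_
    rw [term, P.invLog_eq (hs j hj).1 (hs j hj).2]
    have := tangent_eq_sq_mul_inv_log (θ := P.θ j x) (hy j hj)
    simp only [K, τ, y] at this ⊢
    linarith

theorem isPSHOn_add_total {Ψ : M → ℝ} (hΨ : ContMDiff 𝓘(ℝ, E) 𝓘(ℝ, ℝ) ∞ Ψ)
    (hΨ0 : ∀ x, 0 ≤ Ψ x)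
    (hlevi : ∀ x (v : E), v ≠ 0 → ∑ j ∈ P.idx x, 2 * |leviForm (P.θ j) x v| < leviForm Ψ x v) :
    IsPSHOn E (fun x => ((Ψ x + P.total x : ℝ) : EReal)) univ := by
  have husc : UpperSemicontinuous fun z => Ψ z + P.total z :=
    hΨ.continuous.upperSemicontinuous.add P.upperSemicontinuous_total
  refine ⟨upperSemicontinuousOn_univ_iff.2 (continuous_coe_real_ereal.comp_upperSemicontinuous
    husc fun s t h => EReal.coe_le_coe_iff.2 h), fun x _ => EReal.coe_ne_top _, ?_⟩
  intro c hc a b hab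
  let u : ℂ → ℝ := fun ζ => Ψ (c.symm (a + ζ • b)) + P.total (c.symm (a + ζ • b))
  have hcont : ContinuousOn (fun ζ : ℂ => c.symm (a + ζ • b)) (closedBall 0 1) := by
    refine c.continuousOn_symm.comp (f := fun ζ : ℂ => a + ζ • b) (by fun_prop) fun ζ hζ => ?_
    exact (hab ζ (by simpa using hζ)).1
  have hu : UpperSemicontinuousOn u (closedBall 0 1) :=
    (upperSemicontinuousOn_univ_iff.2 husc).comp hcont (mapsTo_univ _ _)
  have hu0 : ∀ ζ, 0 ≤ u ζ := fun ζ => add_nonneg (hΨ0 _) (P.total_nonneg _)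
  obtain ⟨B, hB⟩ : ∃ B, ∀ ζ ∈ closedBall (0 : ℂ) 1, u ζ ≤ B := by
    obtain ⟨ζ₀, _, h⟩ := UpperSemicontinuousOn.exists_isMaxOn
      (nonempty_closedBall.2 zero_le_one) (isCompact_closedBall 0 1) hu
    exact ⟨u ζ₀, h⟩
  have hint : IntegrableOn (fun θ => u (unitExp θ)) (Ioc (0 : ℝ) 1) :=
    hu.integrableOn_comp (fun ζ _ => hu0 ζ) hB continuous_unitExp fun θ => by
      simp [norm_unitExp]
  rw [circleMean_coe (u := fun z => Ψ (c.symm z) + P.total (c.symm z)) hint,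
    EReal.coe_le_coe_iff]
  have e0 : Ψ (c.symm a) + P.total (c.symm a) = u 0 := by simp [u]
  rw [e0]
  -- A degenerate disc is a point; the strict local inequality needs a nonzero direction.
  rcases eq_or_ne b 0 with rfl | hb
  · simp [u]
  refine le_integral_unitExp_of_local hu (m := 0) (fun ζ _ => hu0 ζ) fun ζ hζ => ?_
  have hmem := (hab ζ hζ.le).1
  have h1 := P.eventually_lt_integral hΨ hΨ0 hlevi hc (c.map_target hmem) hb
  rw [c.right_inv hmem] at h1
  have h3 : ∀ᶠ r : ℝ in 𝓝[>] 0, r ≤ 1 - ‖ζ‖ :=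
    mem_nhdsWithin_of_mem_nhds (Iic_mem_nhds (by linarith))
  obtain ⟨r, hr1, hr2, hr3⟩ := (h1.and (h3.and self_mem_nhdsWithin)).exists
  refine ⟨r, hr3, by linarith, ?_⟩
  simp only [u, add_smul, ← add_assoc]
  exact hr1

end LocalPotentials

end Plurisubharmonicity

/-! ### Construction of the local data and of the dominating function Ψ. -/

section Existence

open Set Filter

universe u

variable {E : Type*} [NormedAddCommGroup E] [NormedSpace ℂ E]
  {M : Type u} [TopologicalSpace M] [ChartedSpace E M] {A : Set M}

theorem IsPSHOn.mono {f : M → EReal} {U V : Set M} (h : IsPSHOn E f U) (hVU : V ⊆ U) :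
    IsPSHOn E f V :=
  ⟨h.1.mono hVU, fun x hx => h.2.1 x (hVU hx), fun c hc a b hab =>
    h.2.2 c hc a b fun ζ hζ => ⟨(hab ζ hζ).1, hVU (hab ζ hζ).2⟩⟩

theorem IsKahlerPotentialOn.mono {f : M → ℝ} {U V : Set M} (h : IsKahlerPotentialOn E f U)
    (hVU : V ⊆ U) : IsKahlerPotentialOn E f V :=
  ⟨h.1.mono hVU, fun x hx => h.2 x (hVU hx)⟩

/-- A curve inside a compact K ⊆ V and inside a compact K' ⊆ U \ A lies in K ∩ K' ⊆ V \ A, which is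
compact in a Hausdorff space. -/
theorem IsLeviCompleteAlong.mono [T2Space M] {f : M → ℝ} {U V : Set M}
    (h : IsLeviCompleteAlong E f U A) (hVU : V ⊆ U) : IsLeviCompleteAlong E f V A := by
  rintro γ hγ hmaps ⟨K, hK, hKV, hγK⟩ hnot
  refine h γ hγ (hmaps.mono_right (sdiff_subset_sdiff_left hVU)) ⟨K, hK, hKV.trans hVU, hγK⟩ ?_
  rintro ⟨K', hK', hKU', hγK'⟩
  exact hnot ⟨K ∩ K', hK.inter hK', fun x hx => ⟨hKV hx.1, (hKU' hx.2).2⟩,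
    fun t ht => ⟨hγK ht, hγK' ht⟩⟩

variable [IsManifold 𝓘(ℂ, E) ω M] [FiniteDimensional ℂ E] [SecondCountableTopology M]

theorem sigmaCompactSpace_of_chartedSpace (E : Type*) [NormedAddCommGroup E] [NormedSpace ℂ E]
    [FiniteDimensional ℂ E] (M : Type*) [TopologicalSpace M] [ChartedSpace E M]
    [SecondCountableTopology M] : SigmaCompactSpace M := by
  have : ProperSpace E := FiniteDimensional.proper ℂ E
  have : LocallyCompactSpace M := ChartedSpace.locallyCompactSpace E M
  infer_instance

variable (E M) in
-- A partition of unity gives a smooth ρ above the index at which a point enters a compact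
-- exhaustion; sublevel sets then lie in single members of it.
theorem exists_smooth_exhaustion [T2Space M] : ∃ ρ : M → ℝ, ContMDiff 𝓘(ℝ, E) 𝓘(ℝ, ℝ) ∞ ρ ∧
    ∀ R : ℝ, IsCompact {x | ρ x ≤ R} := by
  have : ProperSpace E := FiniteDimensional.proper ℂ E
  have : LocallyCompactSpace M := ChartedSpace.locallyCompactSpace E M
  have : SigmaCompactSpace M := sigmaCompactSpace_of_chartedSpace E M
  have := isManifold_real E M
  let K : CompactExhaustion M := default
  obtain ⟨ρ, hρ⟩ := exists_contMDiffMap_forall_mem_convex_of_local_const 𝓘(ℝ, E) (n := (⊤ : ℕ∞))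
    (t := fun x : M => Ici (K.find x : ℝ)) (fun x => convex_Ici _) fun x => by
      obtain ⟨n, hn⟩ := K.exists_mem_nhds x
      refine ⟨n, ?_⟩
      filter_upwards [hn] with y hy
      exact mem_Ici.2 (Nat.cast_le.2 (K.mem_iff_find_le.1 hy))
  refine ⟨ρ, ρ.contMDiff, fun R => ?_⟩
  refine (K.isCompact ⌊R⌋₊).of_isClosed_subset
    (isClosed_le ρ.contMDiff.continuous continuous_const) fun x hx => ?_
  exact K.mem_iff_find_le.2 (Nat.le_floor ((hρ x).trans hx))

theorem LocalPotentials.exists_dominating {J : Type*} (P : LocalPotentials E A J)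
    (hM : IsStein E M) {ρ : M → ℝ} (hρ : ContMDiff 𝓘(ℝ, E) 𝓘(ℝ, ℝ) ∞ ρ) :
    ∃ Ψ : M → ℝ, ContMDiff 𝓘(ℝ, E) 𝓘(ℝ, ℝ) ∞ Ψ ∧ (∀ x, 0 ≤ Ψ x) ∧
      ∀ q, ∃ p, ∀ᶠ x in 𝓝 q, x ∈ (chartAt E p).source ∧ ∀ v : E,
        ‖tcoord p x v‖ ^ 2 + dform ρ x v ^ 2 + ∑ j ∈ P.idx x, 2 * |leviForm (P.θ j) x v| ≤
          leviForm Ψ x v := by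
  have h2 : (2 : ℕ∞ω) ≤ (∞ : ℕ∞ω) := WithTop.coe_le_coe.2 (le_top (a := (2 : ℕ∞)))
  choose B hB0 hB using fun (j : J) (p : M) =>
    exists_leviForm_bound ((P.smooth j p).of_le h2) (mem_chart_source E p)
  choose R hR0 hR using fun p : M =>
    exists_leviForm_bound ((hρ p).of_le h2) (mem_chart_source E p)
  let N : M → Set M := fun p => {x | P.idx x ⊆ P.idx p ∧
    (∀ j ∈ P.idx p, ∀ v : E, |leviForm (P.θ j) x v| ≤ B j p * ‖tcoord p x v‖ ^ 2) ∧
    ∀ v : E, |dform ρ x v| ≤ R p * ‖tcoord p x v‖}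
  have hN : ∀ p, N p ∈ 𝓝 p := by
    intro p
    refine (P.eventually_idx_subset p).and (((Finset.eventually_all _).2 fun j _ => ?_).and ?_)
    · exact (hB j p).mono fun x hx v => (hx v).1
    · exact (hR p).mono fun x hx v => (hx v).2
  obtain ⟨Ψ, hΨ, hΨ0, hdom⟩ := hM.exists_psh_dominating hN
    -- The summands pay for the coordinate norm, for dρ² and for the cutoff errors, in this order.
    -- On N p only indices from `P.idx p` occur, so one finite sum suffices.
    fun p => 1 + R p ^ 2 + ∑ j ∈ P.idx p, 2 * B j p
  refine ⟨Ψ, hΨ, hΨ0, fun q => ?_⟩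
  obtain ⟨p, W, hW, hWN, hWΨ⟩ := hdom q
  refine ⟨p, ?_⟩
  filter_upwards [hW] with x hx
  refine ⟨(hWN hx).2, fun v => ?_⟩
  obtain ⟨h1, h3, h4⟩ := (hWN hx).1
  have e1 : dform ρ x v ^ 2 ≤ R p ^ 2 * ‖tcoord p x v‖ ^ 2 := by
    rw [← mul_pow, ← sq_abs]
    exact pow_le_pow_left₀ (abs_nonneg _) (h4 v) 2
  have e2 : ∑ j ∈ P.idx x, 2 * |leviForm (P.θ j) x v| ≤
      ∑ j ∈ P.idx p, 2 * B j p * ‖tcoord p x v‖ ^ 2 :=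
    (Finset.sum_le_sum_of_subset_of_nonneg h1 fun j _ _ => by positivity).trans
      (Finset.sum_le_sum fun j hj => by have := h3 j hj v; linarith)
  have e3 := hWΨ x hx v
  rw [add_mul, add_mul, Finset.sum_mul] at e3
  linarith

/-- By upper semicontinuity each local function is below a real constant near a point of its domain.
A bump covering is used because it provides, near every point, a cutoff identically 1; completeness
relies on this. -/
theorem LocalPotentials.exists_of_cover [T2Space M] {ι : Type*} {U : ι → Set M}
    (hUopen : ∀ i, IsOpen (U i)) (hUcover : ⋃ i, U i = univ) {φ : ι → M → EReal}
    (hpsh : ∀ i, IsPSHOn E (φ i) (U i)) (hreal : ∀ i, ∀ x ∈ U i \ A, φ i x ≠ ⊥)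
    (hkahler : ∀ i, IsKahlerPotentialOn E (fun x => (φ i x).toReal) (U i \ A))
    (hcomplete : ∀ i, IsLeviCompleteAlong E (fun x => (φ i x).toReal) (U i) A) :
    ∃ (J : Type u) (P : LocalPotentials E A J), (∀ i, ContinuousOn (φ i) (U i)) →
      ∀ j, ContinuousOn (P.f j) (P.O j) := by
  have : SigmaCompactSpace M := sigmaCompactSpace_of_chartedSpace E M
  have := isManifold_real E M
  choose i hi using fun p : M => mem_iUnion.1 (hUcover.symm ▸ mem_univ p : p ∈ ⋃ i, U i)
  have hm : ∀ p, ∃ m : ℝ, φ (i p) p < m := fun p => by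
    obtain ⟨m, hm, _⟩ := EReal.lt_iff_exists_real_btwn.1 ((hpsh (i p)).2.1 p (hi p)).lt_top
    exact ⟨m, hm⟩
  choose m hm using hm
  let V : M → Set M := fun p => {x | x ∈ U (i p) ∧ φ (i p) x < m p}
  have hVU : ∀ p, V p ⊆ U (i p) := fun p x hx => hx.1
  have hV : ∀ p, IsOpen (V p) := by
    intro p
    rw [isOpen_iff_mem_nhds]
    intro x hx
    have h1 := (hUopen (i p)).mem_nhds hx.1
    have h2 := (hpsh (i p)).1 x hx.1 (m p) hx.2
    rw [nhdsWithin_eq_nhds.2 h1] at h2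
    exact inter_mem h1 h2
  obtain ⟨J, s, hs⟩ := SmoothBumpCovering.exists_isSubordinate 𝓘(ℝ, E) (isClosed_univ (X := M))
    (U := V) fun p _ => (hV p).mem_nhds ⟨hi p, hm p⟩
  exact ⟨J,
    { θ := fun j => s j
      O := fun j => V (s.c j)
      f := fun j => φ (i (s.c j))
      m := fun j => m (s.c j)
      smooth := fun j => (s j).contMDiff
      nonneg := fun j _ => (s j).nonneg
      le_one := fun j _ => (s j).le_one
      locallyFinite := s.locallyFinite.closure
      exists_eq_one := fun x => ⟨_, s.eventuallyEq_one x (mem_univ x)⟩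
      isOpen := fun j => hV _
      tsupport_subset := hs
      psh := fun j => (hpsh _).mono (hVU _)
      lt := fun j x hx => hx.2
      ne_bot := fun j x hx => hreal _ x ⟨hVU _ hx.1, hx.2⟩
      kahler := fun j => (hkahler _).mono (sdiff_subset_sdiff_left (hVU _))
      complete := fun j => (hcomplete _).mono (hVU _) },
    fun h j => (h _).mono (hVU _)⟩

end Existence

/-! ### Lengths of curves for a Levi form. -/

section CurveLength

open Set Filter MeasureTheory

variable {E : Type*} [NormedAddCommGroup E] [NormedSpace ℂ E]
  {M : Type*} [TopologicalSpace M] [ChartedSpace E M]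

/-- The length of tangent vectors for the Levi form of `f`. -/
noncomputable abbrev leviENorm (f : M → ℝ) (x : M) : ENorm (TangentSpace 𝓘(ℝ, E) x) :=
  ⟨fun v => ENNReal.ofReal (Real.sqrt (leviForm (E := E) f x v))⟩

theorem leviForm_smul (f : M → ℝ) (x : M) (c : ℝ) (v : E) :
    leviForm f x (c • v) = c ^ 2 * leviForm f x v := levi_smul _ _ _ _

/-- Homogeneity lets the reparametrization results for `Manifold.pathELength` apply to `leviLength`.
-/
theorem enormSMulClass_leviENorm (f : M → ℝ) (x : M) :
    @ENormSMulClass ℝ (TangentSpace 𝓘(ℝ, E) x) _ (leviENorm f x) _ := by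
  let _ := leviENorm (E := E) f x
  refine ⟨fun c v => ?_⟩
  change ENNReal.ofReal (Real.sqrt (leviForm (E := E) f x (c • v))) =
    ‖c‖ₑ * ENNReal.ofReal (Real.sqrt (leviForm (E := E) f x v))
  have e : leviForm (E := E) f x (c • v) = c ^ 2 * leviForm (E := E) f x v := leviForm_smul (E := E) f x c v
  rw [e, Real.sqrt_mul (sq_nonneg c), Real.sqrt_sq_eq_abs, ENNReal.ofReal_mul (abs_nonneg c),
    ← Real.norm_eq_abs, ofReal_norm]

theorem leviLength_comp_of_monotoneOn (f : M → ℝ) {γ : ℝ → M} {ψ : ℝ → ℝ} {a b : ℝ} (h : a ≤ b)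
    (hψ : MonotoneOn ψ (Icc a b)) (hψ' : DifferentiableOn ℝ ψ (Icc a b))
    (hγ : ContMDiffOn 𝓘(ℝ, ℝ) 𝓘(ℝ, E) 1 γ (Icc (ψ a) (ψ b))) :
    leviLength E f (γ ∘ ψ) a b = leviLength E f γ (ψ a) (ψ b) := by
  let _ := leviENorm (E := E) f
  have := enormSMulClass_leviENorm (E := E) f
  have key := Manifold.pathELength_comp_of_monotoneOn (I := 𝓘(ℝ, E)) h hψ hψ'
    (hγ.mdifferentiableOn one_ne_zero)
  rwa [Manifold.pathELength_eq_lintegral_mfderiv_Ioo,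
    Manifold.pathELength_eq_lintegral_mfderiv_Ioo] at key

theorem leviLength_congr (f : M → ℝ) {γ γ' : ℝ → M} {a b : ℝ} (h : EqOn γ γ' (Ioo a b)) :
    leviLength E f γ a b = leviLength E f γ' a b := by
  let _ := leviENorm (E := E) f
  have key := Manifold.pathELength_congr_Ioo (I := 𝓘(ℝ, E)) h
  rwa [Manifold.pathELength_eq_lintegral_mfderiv_Ioo,
    Manifold.pathELength_eq_lintegral_mfderiv_Ioo] at key

theorem leviLength_mono_interval (f : M → ℝ) (γ : ℝ → M) {a b a' b' : ℝ} (h : a' ≤ a)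
    (h' : b ≤ b') : leviLength E f γ a b ≤ leviLength E f γ a' b' :=
  lintegral_mono_set (Ioo_subset_Ioo h h')

/-- If the metric of `g` is at most a constant times that of `f` along a curve, the same holds for
the lengths. -/
theorem leviLength_le_mul {f g : M → ℝ} {γ : ℝ → M} {a b K : ℝ} (hK : 0 ≤ K)
    (h : ∀ t ∈ Ioo a b, ∀ v : E, leviForm g (γ t) v ≤ K * leviForm f (γ t) v) :
    leviLength E g γ a b ≤ ENNReal.ofReal √K * leviLength E f γ a b := by
  rw [leviLength, leviLength, ← lintegral_const_mul' _ _ ENNReal.ofReal_ne_top]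
  refine setLIntegral_mono' measurableSet_Ioo fun t ht => ?_
  rw [← ENNReal.ofReal_mul (Real.sqrt_nonneg _), ← Real.sqrt_mul hK]
  exact ENNReal.ofReal_le_ofReal (Real.sqrt_le_sqrt (h t ht _))

theorem mdifferentiableAt_of_contMDiffOn_Icc {γ : ℝ → M} {a b t : ℝ}
    (hγ : ContMDiffOn 𝓘(ℝ, ℝ) 𝓘(ℝ, E) 1 γ (Icc a b)) (ht : t ∈ Ioo a b) :
    MDifferentiableAt 𝓘(ℝ, ℝ) 𝓘(ℝ, E) γ t :=
  (hγ.contMDiffAt (Icc_mem_nhds ht.1 ht.2)).mdifferentiableAt one_ne_zero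

theorem exists_curve_of_leviEDist_lt {f : M → ℝ} {S : Set M} {x y : M} {r : ℝ≥0∞}
    (h : leviEDist E f S x y < r) : ∃ γ : ℝ → M,
      ContMDiffOn 𝓘(ℝ, ℝ) 𝓘(ℝ, E) 1 γ (Icc 0 1) ∧ MapsTo γ (Icc 0 1) S ∧ γ 0 = x ∧ γ 1 = y ∧
        leviLength E f γ 0 1 < r := by
  rw [leviEDist] at h
  simp only [iInf_lt_iff] at h
  obtain ⟨γ, ⟨h1, h2, h3, h4⟩, h5⟩ := h
  exact ⟨γ, h1, h2, h3, h4, h5⟩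

variable [IsManifold 𝓘(ℂ, E) ω M]

/-- A function whose differential is bounded by the metric is Lipschitz along curves. -/
theorem ofReal_abs_sub_le_leviLength {f h : M → ℝ} {γ : ℝ → M} {a b K : ℝ} (hab : a ≤ b)
    (hK : 0 ≤ K) (hγ : ContMDiffOn 𝓘(ℝ, ℝ) 𝓘(ℝ, E) 1 γ (Icc a b))
    (hh : ∀ t ∈ Icc a b, ContMDiffAt 𝓘(ℝ, E) 𝓘(ℝ, ℝ) 1 h (γ t))
    (hle : ∀ t ∈ Icc a b, ∀ v : E, dform h (γ t) v ^ 2 ≤ K * leviForm f (γ t) v) :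
    ENNReal.ofReal |h (γ b) - h (γ a)| ≤ ENNReal.ofReal √K * leviLength E f γ a b := by
  have hc : ContDiffOn ℝ 1 (fun t => h (γ t)) (Icc a b) := by
    rw [← contMDiffOn_iff_contDiffOn]
    exact fun t ht => (hh t ht).comp_contMDiffWithinAt t (hγ t ht)
  have h1 := enorm_sub_le_lintegral_deriv_of_contDiffOn_Icc hc hab
  rw [← Real.norm_eq_abs, ofReal_norm]
  refine h1.trans ?_
  rw [← restrict_Ioo_eq_restrict_Icc, leviLength, ← lintegral_const_mul' _ _ ENNReal.ofReal_ne_top]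
  refine setLIntegral_mono' measurableSet_Ioo fun t ht => ?_
  have hd := hasDerivAt_comp_curve (mdifferentiableAt_of_contMDiffOn_Icc hγ ht)
    (hh t (Ioo_subset_Icc_self ht))
  rw [hd.deriv, ← ENNReal.ofReal_mul (Real.sqrt_nonneg _), ← Real.sqrt_mul hK,
    ← ofReal_norm, Real.norm_eq_abs]
  refine ENNReal.ofReal_le_ofReal ?_
  rw [← Real.sqrt_sq_eq_abs]
  exact Real.sqrt_le_sqrt (hle t (Ioo_subset_Icc_self ht) _)

theorem ofReal_abs_sub_le_of_leviEDist_lt {f h : M → ℝ} {S : Set M} {K : ℝ} (hK : 0 ≤ K)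
    (hh : ∀ x ∈ S, ContMDiffAt 𝓘(ℝ, E) 𝓘(ℝ, ℝ) 1 h x)
    (hle : ∀ x ∈ S, ∀ v : E, dform h x v ^ 2 ≤ K * leviForm f x v) {x y : M} {r : ℝ≥0∞}
    (hr : leviEDist E f S x y < r) :
    ENNReal.ofReal |h y - h x| ≤ ENNReal.ofReal √K * r := by
  obtain ⟨γ, h1, h2, rfl, rfl, h5⟩ := exists_curve_of_leviEDist_lt hr
  refine (ofReal_abs_sub_le_leviLength zero_le_one hK h1 (fun t ht => hh _ (h2 ht))
    fun t ht => hle _ (h2 ht)).trans ?_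
  gcongr

end CurveLength

/-! ### Joining infinitely many curves. -/

section Concatenation

open Set Filter MeasureTheory

variable {E : Type*} [NormedAddCommGroup E] [NormedSpace ℂ E]
  {M : Type*} [TopologicalSpace M] [ChartedSpace E M]

/-- A smooth step function, `0` for `s ≤ 1 / 3` and `1` for `2 / 3 ≤ s`. -/
noncomputable def smoothStep (s : ℝ) : ℝ := Real.smoothTransition (3 * s - 1)

theorem smoothStep_of_le {s : ℝ} (h : s ≤ 1 / 3) : smoothStep s = 0 :=
  Real.smoothTransition.zero_of_nonpos (by linarith)

theorem smoothStep_of_ge {s : ℝ} (h : 2 / 3 ≤ s) : smoothStep s = 1 :=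
  Real.smoothTransition.one_of_one_le (by linarith)

theorem smoothStep_mem (s : ℝ) : smoothStep s ∈ Icc (0 : ℝ) 1 :=
  ⟨Real.smoothTransition.nonneg _, Real.smoothTransition.le_one _⟩

theorem contDiff_smoothStep : ContDiff ℝ 1 smoothStep :=
  Real.smoothTransition.contDiff.comp (by fun_prop)

theorem monotone_smoothStep : Monotone smoothStep := fun s t h =>
  Real.smoothTransition.monotone (by linarith)

/-- Infinitely many curves, each beginning where the preceding one ends, can be joined to a `C¹`
curve on `[0, 1)`. -/
theorem exists_concatenation {γ : ℕ → ℝ → M}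
    (hγ : ∀ k, ContMDiffOn 𝓘(ℝ, ℝ) 𝓘(ℝ, E) 1 (γ k) (Icc 0 1))
    (hend : ∀ k, γ k 1 = γ (k + 1) 0) : ∃ Γ : ℝ → M,
      ContMDiffOn 𝓘(ℝ, ℝ) 𝓘(ℝ, E) 1 Γ (Ico 0 1) ∧
      (∀ t ∈ Ico (0 : ℝ) 1, ∃ k, ∃ s ∈ Icc (0 : ℝ) 1, Γ t = γ k s) ∧
      (∀ k, ∃ t ∈ Ico (0 : ℝ) 1, Γ t = γ k 0) ∧
      ∀ f : M → ℝ, leviLength E f Γ 0 1 ≤ ∑' k, leviLength E f (γ k) 0 1 := by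
  let G : ℝ → M := fun s => γ ⌊s⌋₊ (smoothStep (s - ⌊s⌋₊))
  -- For k - 1/3 < s < k the preceding curve already rests at its end point, so one smooth formula
  -- is valid around the joint s = k. For k = 0 the natural floor of a negative number is 0.
  have hG : ∀ (k : ℕ) (s : ℝ), k - 1 / 3 < s → s < k + 1 → G s = γ k (smoothStep (s - k)) := by
    intro k s h1 h2
    rcases le_or_gt (k : ℝ) s with h | h
    · have : ⌊s⌋₊ = k := (Nat.floor_eq_iff ((Nat.cast_nonneg k).trans h)).2 ⟨h, h2⟩
      simp only [G, this]
    · cases k with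
      | zero =>
        have : ⌊s⌋₊ = 0 := Nat.floor_of_nonpos (by simpa using h.le)
        simp only [G, this]
      | succ m =>
        push_cast at h1 h
        have h3 : (m : ℝ) ≤ s := by linarith
        have : ⌊s⌋₊ = m := (Nat.floor_eq_iff ((Nat.cast_nonneg m).trans h3)).2 ⟨h3, h⟩
        simp only [G, this]
        rw [smoothStep_of_ge (by linarith), smoothStep_of_le (by push_cast; linarith), hend]
  have hσ : ∀ t : ℝ, t < 1 → HasDerivAt (fun t => t / (1 - t)) (1 / (1 - t) ^ 2) t := by
    intro t ht
    have h0 : 1 - t ≠ 0 := by linarith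
    refine ((hasDerivAt_id t).div ((hasDerivAt_id t).const_sub 1) h0).congr_deriv ?_
    simp
  have hσc : ∀ t : ℝ, t < 1 → ContDiffAt ℝ 1 (fun t : ℝ => t / (1 - t)) t := fun t ht =>
    contDiffAt_id.div (contDiffAt_const.sub contDiffAt_id) (by simp; linarith)
  have hmono : MonotoneOn (fun t : ℝ => t / (1 - t)) (Iio 1) := by
    intro s hs t ht hst
    have h1 : 0 < 1 - s := sub_pos.2 hs
    have h2 : 0 < 1 - t := sub_pos.2 ht
    change s / (1 - s) ≤ t / (1 - t)
    rw [div_le_div_iff₀ h1 h2]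
    nlinarith
  have hgsm : ∀ k : ℕ, ContMDiff 𝓘(ℝ, ℝ) 𝓘(ℝ, E) 1 fun s : ℝ => γ k (smoothStep (s - k)) := by
    intro k
    rw [← contMDiffOn_univ]
    refine (hγ k).comp (f := fun s : ℝ => smoothStep (s - k)) ?_ fun s _ => smoothStep_mem _
    exact (contDiff_smoothStep.comp (contDiff_id.sub contDiff_const)).contMDiff.contMDiffOn
  have hτ : ∀ k : ℕ, (k / (k + 1) : ℝ) / (1 - k / (k + 1)) = k := by
    intro k
    have : (k + 1 : ℝ) ≠ 0 := by positivity
    field_simp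
    simp
  have hτ0 : ∀ k : ℕ, (0 : ℝ) ≤ k / (k + 1) := fun k => by positivity
  have hτ1 : ∀ k : ℕ, (k / (k + 1) : ℝ) < 1 := fun k => by
    rw [div_lt_one (by positivity)]; linarith
  -- The substitution t / (1 - t) maps [0, 1) onto [0, ∞), and time k corresponds to t = k / (k +
  -- 1).
  refine ⟨fun t => G (t / (1 - t)), ?_, ?_, ?_, ?_⟩
  · intro t ht
    refine ContMDiffAt.contMDiffWithinAt ?_
    have hs : 0 ≤ t / (1 - t) := div_nonneg ht.1 (sub_nonneg.2 ht.2.le)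
    set s := t / (1 - t)
    have hGs : ContMDiffAt 𝓘(ℝ, ℝ) 𝓘(ℝ, E) 1 G s := by
      refine (hgsm ⌊s⌋₊ s).congr_of_eventuallyEq ?_
      have h1 := Nat.floor_le hs
      filter_upwards [Ioo_mem_nhds (by linarith : (⌊s⌋₊ : ℝ) - 1 / 3 < s) (Nat.lt_floor_add_one s)]
        with y hy using hG _ y hy.1 hy.2
    exact hGs.comp t (hσc t ht.2).contMDiffAt
  · exact fun t _ => ⟨_, _, smoothStep_mem _, rfl⟩
  · intro k
    refine ⟨k / (k + 1), ⟨hτ0 k, hτ1 k⟩, ?_⟩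
    change G (k / (k + 1) / (1 - k / (k + 1))) = γ k 0
    rw [hτ, hG k k (by linarith) (by linarith), sub_self, smoothStep_of_le (by norm_num)]
  · intro f
    have hcov : Ioo (0 : ℝ) 1 ⊆
        ⋃ k : ℕ, Ico (k / (k + 1) : ℝ) ((k + 1 : ℕ) / ((k + 1 : ℕ) + 1)) := by
      intro t ht
      have h0 : 0 < 1 - t := sub_pos.2 ht.2
      have hs : 0 ≤ t / (1 - t) := div_nonneg ht.1.le h0.le
      refine mem_iUnion.2 ⟨⌊t / (1 - t)⌋₊, ?_, ?_⟩
      · have := Nat.floor_le hs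
        rw [le_div_iff₀ h0] at this
        rw [div_le_iff₀ (by positivity)]
        linarith
      · have := Nat.lt_floor_add_one (t / (1 - t))
        rw [div_lt_iff₀ h0] at this
        rw [lt_div_iff₀ (by positivity)]
        push_cast
        linarith
    refine (lintegral_mono_set hcov).trans ((lintegral_iUnion_le _ _).trans ?_)
    refine ENNReal.tsum_le_tsum fun k => le_of_eq ?_
    rw [← restrict_Ioo_eq_restrict_Ico]
    set a : ℝ := k / (k + 1)
    set b : ℝ := (k + 1 : ℕ) / ((k + 1 : ℕ) + 1)
    have ha : a / (1 - a) = k := hτ k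
    have hb : b / (1 - b) = k + 1 := (hτ (k + 1)).trans (by push_cast; rfl)
    have hb1 : b < 1 := hτ1 (k + 1)
    have hab : a ≤ b := by
      have h1 : 0 < 1 - a := sub_pos.2 (hτ1 k)
      have h2 : 0 < 1 - b := sub_pos.2 hb1
      rw [div_eq_iff h1.ne'] at ha
      rw [div_eq_iff h2.ne'] at hb
      have : (0 : ℝ) ≤ k := Nat.cast_nonneg k
      nlinarith
    let ψ : ℝ → ℝ := fun t => smoothStep (t / (1 - t) - k)
    have hψa : ψ a = 0 := by
      simp only [ψ, ha, sub_self]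
      exact smoothStep_of_le (by norm_num)
    have hψb : ψ b = 1 := by
      simp only [ψ, hb, add_sub_cancel_left]
      exact smoothStep_of_ge (by norm_num)
    have e1 := leviLength_comp_of_monotoneOn (E := E) f (γ := γ k) (ψ := ψ) hab
      (fun s hs t ht hst => monotone_smoothStep (sub_le_sub_right
        (hmono (hs.2.trans_lt hb1) (ht.2.trans_lt hb1) hst) _))
      (fun t ht => ((contDiff_smoothStep.differentiable one_ne_zero _).comp t
        ((hσ t (ht.2.trans_lt hb1)).differentiableAt.sub_const _)).differentiableWithinAt)
      (by rw [hψa, hψb]; exact hγ k)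
    rw [hψa, hψb] at e1
    rw [← e1]
    refine leviLength_congr f fun t ht => ?_
    have h1 : t < 1 := ht.2.trans hb1
    have h2 := hmono ((ht.1.trans h1).trans_le le_rfl) h1 ht.1.le
    have h3 : t / (1 - t) < k + 1 := by
      rw [← hb, div_lt_div_iff₀ (by linarith) (by linarith)]
      nlinarith [ht.2]
    simp only [ha] at h2
    exact hG k _ (by linarith) h3

end Concatenation

/-! ### Comparison of the metric with bump functions and with the topology of M. -/

section Completeness

open Set Filter MeasureTheory

variable {E : Type*} [NormedAddCommGroup E] [NormedSpace ℂ E]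
  {M : Type*} [TopologicalSpace M] [ChartedSpace E M]

theorem dform_congr {f g : M → ℝ} {x : M} (h : f =ᶠ[𝓝 x] g) (v : E) :
    dform f x v = dform g x v := by
  have h1 : Tendsto (chartAt E x).symm (𝓝 (chartAt E x x)) (𝓝 x) := by
    have := (chartAt E x).continuousAt_symm (mem_chart_target E x)
    rwa [ContinuousAt, (chartAt E x).left_inv (mem_chart_source E x)] at this
  have h2 : (fun z => f ((chartAt E x).symm z)) =ᶠ[𝓝 (chartAt E x x)]
      fun z => g ((chartAt E x).symm z) := h1.eventually h
  rw [dform, dform, h2.fderiv_eq]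

theorem dform_zero (x : M) (v : E) : dform (0 : M → ℝ) x v = 0 := by
  have : dform (0 : M → ℝ) x v = fderiv ℝ (fun _ : E => (0 : ℝ)) (chartAt E x x) v := rfl
  simp [this]

variable [IsManifold 𝓘(ℂ, E) ω M]

theorem dform_comp {f : M → ℝ} {x : M} (hf : ContMDiffAt 𝓘(ℝ, E) 𝓘(ℝ, ℝ) 1 f x) {χ : ℝ → ℝ}
    {χ' : ℝ} (hχ : HasDerivAt χ χ' (f x)) (v : E) :
    dform (fun y => χ (f y)) x v = χ' * dform f x v := by
  have h1 : (1 : ℕ∞ω) ≤ (∞ : ℕ∞ω) := by exact_mod_cast le_top (a := (1 : ℕ∞))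
  have hd := ((hf.contDiffAt_chart h1 (chart_mem_atlas E x)
    (mem_chart_source E x)).differentiableAt one_ne_zero).hasFDerivAt
  have hχ' : HasDerivAt χ χ' (f ((chartAt E x).symm (chartAt E x x))) := by
    rwa [(chartAt E x).left_inv (mem_chart_source E x)]
  have := (HasDerivAt.comp_hasFDerivAt (f := fun z => f ((chartAt E x).symm z)) _ hχ' hd).fderiv
  rw [Function.comp_def] at this
  rw [dform, this]
  rfl

theorem exists_bump [FiniteDimensional ℂ E] [T2Space M] {x : M} {V : Set M} (hV : V ∈ 𝓝 x) :
    ∃ χ : M → ℝ, ContMDiff 𝓘(ℝ, E) 𝓘(ℝ, ℝ) ∞ χ ∧ HasCompactSupport χ ∧ tsupport χ ⊆ V ∧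
      χ =ᶠ[𝓝 x] 1 := by
  have := isManifold_real E M
  obtain ⟨χ, -, hχ⟩ := (SmoothBumpFunction.nhds_basis_tsupport (I := 𝓘(ℝ, E)) x).mem_iff.1 hV
  exact ⟨χ, χ.contMDiff, χ.hasCompactSupport, hχ, χ.eventuallyEq_one⟩

/-- Locally dχ is bounded by the coordinate norm, which the metric dominates up to A; compactness of
the support makes the constant uniform. -/
theorem exists_dform_sq_le {A : Set M} {Φ ρ χ : M → ℝ}
    (hloc : ∀ q, ∃ p, ∀ᶠ x in 𝓝 q, x ∈ (chartAt E p).source ∧ (x ∉ A → ∀ v : E,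
      ‖tcoord p x v‖ ^ 2 + dform ρ x v ^ 2 ≤ leviForm Φ x v))
    (hχ : ContMDiff 𝓘(ℝ, E) 𝓘(ℝ, ℝ) ∞ χ)
    (hc : HasCompactSupport χ) :
    ∃ K : ℝ, 0 ≤ K ∧ ∀ x ∉ A, ∀ v : E, dform χ x v ^ 2 ≤ K * leviForm Φ x v := by
  have h2 : (2 : ℕ∞ω) ≤ (∞ : ℕ∞ω) := WithTop.coe_le_coe.2 (le_top (a := (2 : ℕ∞)))
  have hnn : ∀ x ∉ A, ∀ v : E, 0 ≤ leviForm Φ x v := by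
    intro x hx v
    obtain ⟨p, hp⟩ := hloc x
    exact le_trans (by positivity) (hp.self_of_nhds.2 hx v)
  have key : ∃ K : ℝ, 0 ≤ K ∧ ∀ x ∈ tsupport χ, x ∉ A → ∀ v : E,
      dform χ x v ^ 2 ≤ K * leviForm Φ x v := by
    refine hc.isCompact.induction_on (p := fun S => ∃ K : ℝ, 0 ≤ K ∧ ∀ x ∈ S, x ∉ A → ∀ v : E,
      dform χ x v ^ 2 ≤ K * leviForm Φ x v) ⟨0, le_rfl, by simp⟩ ?_ ?_ ?_
    · rintro S T hST ⟨K, hK, h⟩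
      exact ⟨K, hK, fun x hx => h x (hST hx)⟩
    · rintro S T ⟨K, hK, h⟩ ⟨K', hK', h'⟩
      refine ⟨max K K', le_max_of_le_left hK, fun x hx hxA v => ?_⟩
      rcases hx with hx | hx
      · exact (h x hx hxA v).trans
          (mul_le_mul_of_nonneg_right (le_max_left _ _) (hnn x hxA v))
      · exact (h' x hx hxA v).trans
          (mul_le_mul_of_nonneg_right (le_max_right _ _) (hnn x hxA v))
    · intro q _
      obtain ⟨p, hp⟩ := hloc q
      obtain ⟨B, hB, hbound⟩ := exists_leviForm_bound ((hχ q).of_le h2) hp.self_of_nhds.1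
      refine ⟨_, mem_nhdsWithin_of_mem_nhds (hp.and hbound), B ^ 2, by positivity,
        fun x hx hxA v => ?_⟩
      have e1 := hx.1.2 hxA v
      have e2 := (hx.2 v).2
      calc dform χ x v ^ 2 = |dform χ x v| ^ 2 := (sq_abs _).symm
        _ ≤ (B * ‖tcoord p x v‖) ^ 2 := pow_le_pow_left₀ (abs_nonneg _) e2 2
        _ = B ^ 2 * ‖tcoord p x v‖ ^ 2 := mul_pow _ _ _
        _ ≤ B ^ 2 * leviForm Φ x v := by
          refine mul_le_mul_of_nonneg_left ?_ (sq_nonneg _)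
          have := sq_nonneg (dform ρ x v)
          linarith
  obtain ⟨K, hK, h⟩ := key
  refine ⟨K, hK, fun x hx v => ?_⟩
  by_cases hxs : x ∈ tsupport χ
  · exact h x hxs hx v
  · rw [dform_congr (notMem_tsupport_iff_eventuallyEq.1 hxs), dform_zero]
    have := mul_nonneg hK (hnn x hx v)
    simpa using this

/-- Near x, segments in the chart have length at most √B times the coordinate distance. -/
theorem tendsto_leviEDist {Φ : M → ℝ} {A : Set M} (hA : IsClosed A) {x : M} (hx : x ∉ A)
    (hΦ : ContMDiffAt 𝓘(ℝ, E) 𝓘(ℝ, ℝ) 2 Φ x) :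
    Tendsto (fun y => leviEDist E Φ Aᶜ y x) (𝓝 x) (𝓝 0) := by
  have := isManifold_real E M
  obtain ⟨B, hB, hbound⟩ := exists_leviForm_bound hΦ (mem_chart_source E x)
  set c := chartAt E x
  have hxc : x ∈ c.source := mem_chart_source E x
  have h1 : ∀ᶠ z in 𝓝 (c x), z ∈ c.target ∧ c.symm z ∈ Aᶜ ∧ ∀ v : E,
      |leviForm Φ (c.symm z) v| ≤ B * ‖tcoord x (c.symm z) v‖ ^ 2 := by
    have h0 : ∀ᶠ z in 𝓝 (c x), z ∈ c.target := c.open_target.mem_nhds (c.map_source hxc)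
    have hs := c.continuousAt_symm (c.map_source hxc)
    rw [ContinuousAt, c.left_inv hxc] at hs
    exact h0.and ((hs.eventually (hA.isOpen_compl.mem_nhds hx)).and
      ((hs.eventually hbound).mono fun z hz v => (hz v).1))
  obtain ⟨ε, hε, hball⟩ := Metric.eventually_nhds_iff_ball.1 h1
  have hcx : ContinuousAt c x := c.continuousAt hxc
  have hlim : Tendsto (fun y => ENNReal.ofReal (√B * ‖c x - c y‖)) (𝓝 x) (𝓝 0) := by
    have : ContinuousAt (fun y => ENNReal.ofReal (√B * ‖c x - c y‖)) x :=
      ENNReal.continuous_ofReal.continuousAt.comp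
        (continuousAt_const.mul (continuousAt_const.sub hcx).norm)
    simpa [ContinuousAt] using this
  refine tendsto_of_tendsto_of_tendsto_of_le_of_le' tendsto_const_nhds hlim
    (Eventually.of_forall fun _ => zero_le) ?_
  filter_upwards [c.open_source.mem_nhds hxc, hcx.eventually (Metric.ball_mem_nhds _ hε)]
    with y hy hyb
  let ℓ : ℝ → E := fun t => c y + t • (c x - c y)
  have hℓ : ∀ t ∈ Icc (0 : ℝ) 1, ℓ t ∈ Metric.ball (c x) ε := fun t ht =>
    (convex_ball (c x) ε).add_smul_sub_mem hyb (Metric.mem_ball_self hε) ht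
  have hγ : ContMDiffOn 𝓘(ℝ, ℝ) 𝓘(ℝ, E) 1 (fun t => c.symm (ℓ t)) (Icc 0 1) := by
    have h2 : ContMDiffOn 𝓘(ℝ, E) 𝓘(ℝ, E) 1 c.symm c.target :=
      (contMDiffOn_chart_symm (n := (∞ : ℕ∞ω))).of_le (by exact_mod_cast le_top (a := (1 : ℕ∞)))
    refine h2.comp (f := ℓ) ?_ fun t ht => (hball _ (hℓ t ht)).1
    rw [contMDiffOn_iff_contDiffOn]
    fun_prop
  have hle : leviEDist E Φ Aᶜ y x ≤ leviLength E Φ (fun t => c.symm (ℓ t)) 0 1 := by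
    refine iInf₂_le _ ⟨hγ, fun t ht => (hball _ (hℓ t ht)).2.1, ?_, ?_⟩
    · simp [ℓ, c.left_inv hy]
    · simp [ℓ, c.left_inv hxc]
  refine hle.trans ?_
  calc leviLength E Φ (fun t => c.symm (ℓ t)) 0 1
      ≤ ∫⁻ t in Ioo (0 : ℝ) 1, ENNReal.ofReal (√B * ‖c x - c y‖) := by
        refine setLIntegral_mono' measurableSet_Ioo fun t ht => ENNReal.ofReal_le_ofReal ?_
        have hb := hball _ (hℓ t (Ioo_subset_Icc_self ht))
        have hd := hasDerivAt_chart_comp_curve (mdifferentiableAt_of_contMDiffOn_Icc hγ ht)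
          (p := x) (c.map_target hb.1)
        have hd' : HasDerivAt (fun s => c (c.symm (ℓ s))) (c x - c y) t := by
          have h3 : HasDerivAt ℓ (c x - c y) t :=
            (((hasDerivAt_id t).smul_const (c x - c y)).const_add (c y)).congr_deriv
              (one_smul ℝ _)
          refine h3.congr_of_eventuallyEq ?_
          filter_upwards [Ioo_mem_nhds ht.1 ht.2] with s hs
          exact c.right_inv (hball _ (hℓ s (Ioo_subset_Icc_self hs))).1
        have e := hd.unique hd'
        have h4 := (le_abs_self _).trans (hb.2.2 (mfderiv 𝓘(ℝ, ℝ) 𝓘(ℝ, E)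
          (fun t => c.symm (ℓ t)) t (1 : ℝ)))
        rw [e] at h4
        refine (Real.sqrt_le_sqrt h4).trans_eq ?_
        rw [Real.sqrt_mul hB, Real.sqrt_sq (norm_nonneg _)]
    _ = ENNReal.ofReal (√B * ‖c x - c y‖) := by simp

end Completeness

/-! ### Limits of Cauchy sequences and a criterion for completeness. -/

section LimitOfCauchySequence

open Set Filter MeasureTheory

variable {E : Type*} [NormedAddCommGroup E] [NormedSpace ℂ E]
  {M : Type*} [TopologicalSpace M] [ChartedSpace E M] [IsManifold 𝓘(ℂ, E) ω M]
  [FiniteDimensional ℂ E] [T2Space M]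

theorem exists_ennreal_mul_lt_one (K : ℝ) :
    ∃ ε : ℝ≥0∞, 0 < ε ∧ ε ≠ ⊤ ∧ ENNReal.ofReal √K * ε < 1 := by
  have h0 := Real.sqrt_nonneg K
  refine ⟨ENNReal.ofReal (√K + 1)⁻¹, by positivity, ENNReal.ofReal_ne_top, ?_⟩
  rw [← ENNReal.ofReal_mul h0, ENNReal.ofReal_lt_one, ← div_eq_mul_inv, div_lt_one (by positivity)]
  linarith

/-- A Cauchy sequence for the geodesic distance converges in the topology of the manifold, if its
terms lie in a compact set. -/
theorem tendsto_of_leviEDist_cauchy {A : Set M} {Φ ρ : M → ℝ}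
    (hloc : ∀ q, ∃ p, ∀ᶠ x in 𝓝 q, x ∈ (chartAt E p).source ∧ (x ∉ A → ∀ v : E,
      ‖tcoord p x v‖ ^ 2 + dform ρ x v ^ 2 ≤ leviForm Φ x v))
    {u : ℕ → M}
    (hcau : ∀ ε : ℝ≥0∞, 0 < ε → ∃ N, ∀ m ≥ N, ∀ n ≥ N, leviEDist E Φ Aᶜ (u m) (u n) < ε)
    {x : M} (hx : MapClusterPt x atTop u) : Tendsto u atTop (𝓝 x) := by
  have h1 : (1 : ℕ∞ω) ≤ (∞ : ℕ∞ω) := by exact_mod_cast le_top (a := (1 : ℕ∞))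
  intro V hV
  obtain ⟨χ, hχ, hχc, hχV, hχ1⟩ := exists_bump (E := E) hV
  obtain ⟨K, hK, hχK⟩ := exists_dform_sq_le hloc hχ hχc
  -- χ is √K-Lipschitz for the distance, so within distance ε of a point where χ = 1 it cannot
  -- vanish: later terms cannot leave V.
  obtain ⟨ε, hε, -, hKε⟩ := exists_ennreal_mul_lt_one K
  obtain ⟨N, hN⟩ := hcau ε hε
  obtain ⟨m, hm1, hm⟩ := ((hx.frequently hχ1).and_eventually (eventually_ge_atTop N)).exists
  refine mem_map.2 (mem_of_superset (Ici_mem_atTop N) fun n hn => hχV (subset_tsupport χ ?_))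
  intro h0
  have := ofReal_abs_sub_le_of_leviEDist_lt hK (fun y _ => (hχ y).of_le h1)
    (fun y hy => hχK y hy) (hN m hm n hn)
  rw [h0, hm1] at this
  simp only [Pi.one_apply, zero_sub, abs_neg, abs_one, ENNReal.ofReal_one] at this
  exact absurd this (not_le.2 hKε)

/-- If a Cauchy sequence for the geodesic distance converges to `x`, there are `C¹` curves
`[0, 1) → M \ A` of finite length that accumulate at `x` and stay in a compact subset of a given
neighbourhood of `x`. -/
theorem exists_curve_of_tendsto {A : Set M} {Φ ρ : M → ℝ}
    (hloc : ∀ q, ∃ p, ∀ᶠ x in 𝓝 q, x ∈ (chartAt E p).source ∧ (x ∉ A → ∀ v : E,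
      ‖tcoord p x v‖ ^ 2 + dform ρ x v ^ 2 ≤ leviForm Φ x v))
    {u : ℕ → M}
    (hcau : ∀ ε : ℝ≥0∞, 0 < ε → ∃ N, ∀ m ≥ N, ∀ n ≥ N, leviEDist E Φ Aᶜ (u m) (u n) < ε)
    {x : M} (hx : Tendsto u atTop (𝓝 x)) {V : Set M} (hV : V ∈ 𝓝 x) :
    ∃ Γ : ℝ → M, ContMDiffOn 𝓘(ℝ, ℝ) 𝓘(ℝ, E) 1 Γ (Ico 0 1) ∧ MapsTo Γ (Ico 0 1) Aᶜ ∧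
      (∃ Q, IsCompact Q ∧ Q ⊆ V ∧ MapsTo Γ (Ico 0 1) Q) ∧ x ∈ closure (Γ '' Ico 0 1) ∧
      leviLength E Φ Γ 0 1 < ⊤ := by
  have h1 : (1 : ℕ∞ω) ≤ (∞ : ℕ∞ω) := by exact_mod_cast le_top (a := (1 : ℕ∞))
  obtain ⟨χ, hχ, hχc, hχV, hχ1⟩ := exists_bump (E := E) hV
  obtain ⟨K, hK, hχK⟩ := exists_dform_sq_le hloc hχ hχc
  obtain ⟨ε, hε, hε', hKε⟩ := exists_ennreal_mul_lt_one K
  obtain ⟨δ, hδ, hδε⟩ := ENNReal.exists_pos_sum_of_countable' hε.ne' ℕ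
  choose N hN using fun k => hcau (δ k) (hδ k)
  obtain ⟨N₀, hN₀⟩ := eventually_atTop.1 (hx.eventually hχ1)
  -- The cumulative sum makes n monotone, so both ends of the k-th piece lie beyond N k and the
  -- piece can be chosen shorter than δ k. All pieces start where χ = 1.
  let n : ℕ → ℕ := fun k => N₀ + k + ∑ i ∈ Finset.range (k + 1), N i
  have hn : ∀ k, n k ≤ n (k + 1) := fun k => by
    simp only [n, Finset.sum_range_succ]; omega
  have hnN : ∀ k, N k ≤ n k := fun k => by
    simp only [n, Finset.sum_range_succ]; omega
  have hnN₀ : ∀ k, N₀ ≤ n k := fun k => by simp only [n]; omega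
  have hnt : Tendsto n atTop atTop :=
    tendsto_atTop_mono (fun k => by simp only [n]; omega : ∀ k, k ≤ n k) tendsto_id
  choose γ hγ hγA hγ0 hγ1 hγδ using fun k => exists_curve_of_leviEDist_lt
    (hN k (n k) (hnN k) (n (k + 1)) ((hnN k).trans (hn k)))
  obtain ⟨Γ, hΓ, hΓγ, hγΓ, hΓl⟩ := exists_concatenation hγ fun k => by rw [hγ1, hγ0]
  refine ⟨Γ, hΓ, ?_, ⟨tsupport χ, hχc.isCompact, hχV, ?_⟩, ?_, ?_⟩
  · intro t ht
    obtain ⟨k, s, hs, e⟩ := hΓγ t ht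
    rw [e]
    exact hγA k hs
  · intro t ht
    obtain ⟨k, s, hs, e⟩ := hΓγ t ht
    rw [e]
    refine subset_tsupport χ fun h0 => ?_
    have hsub : Icc 0 s ⊆ Icc (0 : ℝ) 1 := Icc_subset_Icc_right hs.2
    have h2 := ofReal_abs_sub_le_leviLength hs.1 hK ((hγ k).mono hsub)
      (fun y _ => (hχ _).of_le h1) (fun y hy => hχK _ (hγA k (hsub hy)))
    rw [h0, hγ0, hN₀ _ (hnN₀ k)] at h2
    simp only [Pi.one_apply, zero_sub, abs_neg, abs_one, ENNReal.ofReal_one] at h2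
    refine absurd h2 (not_le.2 (lt_of_le_of_lt ?_ hKε))
    gcongr
    exact ((leviLength_mono_interval Φ (γ k) le_rfl hs.2).trans (hγδ k).le).trans
      ((ENNReal.le_tsum k).trans hδε.le)
  · refine mem_closure_of_tendsto (hx.comp hnt) (Eventually.of_forall fun k => ?_)
    obtain ⟨t, ht, e⟩ := hγΓ k
    exact ⟨t, ht, e.trans (hγ0 k)⟩
  · exact ((hΓl Φ).trans (ENNReal.tsum_le_tsum fun k => (hγδ k).le)).trans_lt
      (hδε.trans hε'.lt_top)

/-- Completeness of the metric of `Φ` off `A`, if it dominates the differential of an exhaustion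
function and, locally, the coordinates, and if every curve accumulating at a point of `A` has
infinite length. -/
theorem isLeviComplete_of_lower_bound [SecondCountableTopology M] {A : Set M} (hA : IsClosed A)
    {Φ ρ : M → ℝ}
    (hΦ : ∀ x ∉ A, ContMDiffAt 𝓘(ℝ, E) 𝓘(ℝ, ℝ) 2 Φ x)
    (hρ : ContMDiff 𝓘(ℝ, E) 𝓘(ℝ, ℝ) ∞ ρ) (hρc : ∀ R : ℝ, IsCompact {x | ρ x ≤ R})
    (hloc : ∀ q, ∃ p, ∀ᶠ x in 𝓝 q, x ∈ (chartAt E p).source ∧ (x ∉ A → ∀ v : E,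
      ‖tcoord p x v‖ ^ 2 + dform ρ x v ^ 2 ≤ leviForm Φ x v))
    (htop : ∀ x ∈ A, ∃ V ∈ 𝓝 x, ∀ Γ : ℝ → M, ContMDiffOn 𝓘(ℝ, ℝ) 𝓘(ℝ, E) 1 Γ (Ico 0 1) →
      MapsTo Γ (Ico 0 1) Aᶜ → (∃ Q, IsCompact Q ∧ Q ⊆ V ∧ MapsTo Γ (Ico 0 1) Q) →
      x ∈ closure (Γ '' Ico 0 1) → leviLength E Φ Γ 0 1 = ⊤) :
    IsLeviComplete E Φ Aᶜ := by
  have h1 : (1 : ℕ∞ω) ≤ (∞ : ℕ∞ω) := by exact_mod_cast le_top (a := (1 : ℕ∞))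
  intro u _ hcau
  obtain ⟨x, hx⟩ : ∃ x, MapClusterPt x atTop u := by
    -- ρ is 1-Lipschitz for the distance, so the tail of the sequence lies in a compact sublevel set
    -- of ρ.
    obtain ⟨N, hN⟩ := hcau 1 one_pos
    have hle : ∀ n ≥ N, ρ (u n) ≤ ρ (u N) + 1 := by
      intro n hn
      have hbound : ∀ y ∈ Aᶜ, ∀ v : E, dform ρ y v ^ 2 ≤ 1 * leviForm Φ y v := by
        intro y hy v
        obtain ⟨p, hp⟩ := hloc y
        have := hp.self_of_nhds.2 hy v
        have h2 := sq_nonneg ‖tcoord p y v‖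
        linarith
      have := ofReal_abs_sub_le_of_leviEDist_lt zero_le_one (fun y _ => (hρ y).of_le h1)
        hbound (hN N le_rfl n hn)
      rw [Real.sqrt_one, mul_one, ENNReal.ofReal_one, ENNReal.ofReal_le_one] at this
      linarith [le_abs_self (ρ (u n) - ρ (u N))]
    obtain ⟨x, -, hx⟩ := (hρc (ρ (u N) + 1)).exists_mapClusterPt (u := u) (f := atTop)
      (le_principal_iff.2 (mem_map.2 (mem_of_superset (Ici_mem_atTop N) hle)))
    exact ⟨x, hx⟩
  have hlim := tendsto_of_leviEDist_cauchy hloc hcau hx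
  by_cases hxA : x ∈ A
  · obtain ⟨V, hV, hVtop⟩ := htop x hxA
    obtain ⟨Γ, h2, h3, h4, h5, h6⟩ := exists_curve_of_tendsto hloc hcau hlim hV
    exact absurd (hVtop Γ h2 h3 h4 h5) h6.ne
  · exact ⟨x, hxA, (tendsto_leviEDist hA hxA (hΦ x hxA)).comp hlim⟩

end LimitOfCauchySequence

/-! ### Infinite length of curves accumulating at A, and the main theorem. -/

section MainTheorem

open Set Filter

namespace LocalPotentials

variable {E : Type*} [NormedAddCommGroup E] [NormedSpace ℂ E]
  {M : Type*} [TopologicalSpace M] [ChartedSpace E M] {A : Set M} {J : Type*}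
  (P : LocalPotentials E A J) [IsManifold 𝓘(ℂ, E) ω M]

/-- Curves near a point `x ∈ A` that accumulate at `x` have infinite length, if the metric of `Φ`
dominates the Levi form of `-log (3 + m - f)`, divided by `log (3 + m - f) ^ 2`. -/
theorem leviLength_eq_top [T2Space M] (hA : IsClosed A) (j : J) {Φ : M → ℝ} {Q : Set M}
    (hQ : IsCompact Q) (hQO : Q ⊆ P.O j)
    (hΦ : ∀ y ∈ Q \ A, ∀ v : E, ((Real.log (3 + P.m j - (P.f j y).toReal))⁻¹) ^ 2 *
      leviForm (P.negLog j) y v ≤ leviForm Φ y v)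
    {Γ : ℝ → M} (hΓ : ContMDiffOn 𝓘(ℝ, ℝ) 𝓘(ℝ, E) 1 Γ (Ico 0 1)) (hΓA : MapsTo Γ (Ico 0 1) Aᶜ)
    (hΓQ : MapsTo Γ (Ico 0 1) Q) {x : M} (hx : x ∈ A) (hxΓ : x ∈ closure (Γ '' Ico 0 1)) :
    leviLength E Φ Γ 0 1 = ⊤ := by
  have h1 : (1 : ℕ∞ω) ≤ (∞ : ℕ∞ω) := by exact_mod_cast le_top (a := (1 : ℕ∞))
  by_contra hfin
  have hmem : ∀ t ∈ Ico (0 : ℝ) 1, Γ t ∈ P.O j \ A := fun t ht => ⟨hQO (hΓQ ht), hΓA ht⟩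
  let L : M → ℝ := fun y => Real.log (3 + P.m j - (P.f j y).toReal)
  have hL : ∀ y ∈ P.O j \ A, 1 < L y := fun y hy =>
    one_lt_log_of_le (P.toReal_lt hy.1 (P.ne_bot j y hy)).le
  have hLneg : ∀ y, L y = -P.negLog j y := fun y => (neg_neg _).symm
  have hexpL : ∀ y ∈ P.O j \ A, Real.exp (L y) = 3 + P.m j - (P.f j y).toReal := fun y hy =>
    Real.exp_log (by linarith [P.toReal_lt hy.1 (P.ne_bot j y hy)])
  -- h = log L satisfies (dh)² = L⁻² (dL)² ≤ 4 L⁻² levi(-L) ≤ 4 levi Φ on Q \ A, so it is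
  -- 2-Lipschitz along the curve.
  let h : M → ℝ := fun y => Real.log (-P.negLog j y)
  have hderiv : ∀ y ∈ P.O j \ A,
      HasDerivAt (fun s => Real.log (-s)) ((P.negLog j y)⁻¹) (P.negLog j y) := by
    intro y hy
    have h2 : -P.negLog j y ≠ 0 := by rw [← hLneg]; linarith [hL y hy]
    refine ((hasDerivAt_id (P.negLog j y)).neg.log h2).congr_deriv ?_
    simp [neg_div]
  have hhsm : ∀ y ∈ P.O j \ A, ContMDiffAt 𝓘(ℝ, E) 𝓘(ℝ, ℝ) 1 h y := by
    intro y hy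
    have h2 : -P.negLog j y ≠ 0 := by rw [← hLneg]; linarith [hL y hy]
    have h3 : ContDiffAt ℝ 1 (fun s => Real.log (-s)) (P.negLog j y) :=
      contDiffAt_id.neg.log h2
    exact h3.contMDiffAt.comp y ((P.contMDiffAt_negLog hA hy).of_le h1)
  have hdh : ∀ y ∈ Q \ A, ∀ v : E, dform h y v ^ 2 ≤ 4 * leviForm Φ y v := by
    intro y hy v
    have hyO : y ∈ P.O j \ A := ⟨hQO hy.1, hy.2⟩
    rw [dform_comp ((P.contMDiffAt_negLog hA hyO).of_le h1) (hderiv y hyO), mul_pow]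
    have h2 := (P.leviForm_negLog hA hyO v).2
    have h3 := hΦ y hy v
    have e : (P.negLog j y)⁻¹ ^ 2 = (L y)⁻¹ ^ 2 := by rw [hLneg, inv_neg, neg_sq]
    rw [e]
    have := mul_le_mul_of_nonneg_left h2 (sq_nonneg (L y)⁻¹)
    simp only [L] at this ⊢
    linarith
  set C := leviLength E Φ Γ 0 1
  have hbound : ∀ t ∈ Ico (0 : ℝ) 1, L (Γ t) ≤ Real.exp (h (Γ 0) + 2 * C.toReal) := by
    intro t ht
    have hsub : Icc 0 t ⊆ Ico (0 : ℝ) 1 := fun s hs => ⟨hs.1, hs.2.trans_lt ht.2⟩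
    have h2 := ofReal_abs_sub_le_leviLength (f := Φ) ht.1 (by norm_num : (0 : ℝ) ≤ 4)
      (hΓ.mono hsub) (fun s hs => hhsm _ (hmem s (hsub hs)))
      (fun s hs => hdh _ ⟨hΓQ (hsub hs), hΓA (hsub hs)⟩)
    have h3 : ENNReal.ofReal |h (Γ t) - h (Γ 0)| ≤ ENNReal.ofReal (2 * C.toReal) := by
      refine h2.trans ?_
      rw [show (4 : ℝ) = 2 ^ 2 by norm_num, Real.sqrt_sq zero_le_two,
        ENNReal.ofReal_mul zero_le_two, ENNReal.ofReal_toReal hfin]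
      gcongr
      exact leviLength_mono_interval Φ Γ le_rfl ht.2.le
    rw [ENNReal.ofReal_le_ofReal_iff (by positivity)] at h3
    have h4 := (le_abs_self _).trans h3
    have h5 : Real.exp (h (Γ t)) = L (Γ t) := by
      simp only [h, ← hLneg]
      exact Real.exp_log (by linarith [hL _ (hmem t ht)])
    rw [← h5]
    exact Real.exp_le_exp.2 (by linarith)
  set Λ := Real.exp (h (Γ 0) + 2 * C.toReal)
  -- With L ≤ Λ along the curve: levi f ≤ exp L · levi(-L) ≤ exp Λ · Λ² · levi Φ.
  have hlen := leviLength_le_mul (E := E) (f := Φ) (g := fun y => (P.f j y).toReal) (γ := Γ)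
    (a := 0) (b := 1) (K := Real.exp Λ * Λ ^ 2) (by positivity) fun t ht v => by
      have ht' := Ioo_subset_Ico_self ht
      have h2 := hmem t ht'
      have h3 := hΦ _ ⟨hΓQ ht', hΓA ht'⟩ v
      have h4 := (P.leviForm_negLog hA h2 v).1
      have h5 := P.leviForm_negLog_nonneg hA h2 v
      have h6 := hbound t ht'
      have h7 := hL _ h2
      rw [← hexpL _ h2] at h4
      change (L (Γ t))⁻¹ ^ 2 * _ ≤ _ at h3
      have hL0 : 0 < L (Γ t) := by linarith
      rw [inv_mul_le_iff₀ (Real.exp_pos _)] at h4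
      rw [inv_pow, inv_mul_le_iff₀ (by positivity)] at h3
      have h8 : 0 ≤ leviForm Φ (Γ t) v := by
        refine le_trans (mul_nonneg (sq_nonneg _) h5) (hΦ _ ⟨hΓQ ht', hΓA ht'⟩ v)
      calc leviForm (fun y => (P.f j y).toReal) (Γ t) v
          ≤ Real.exp (L (Γ t)) * leviForm (P.negLog j) (Γ t) v := h4
        _ ≤ Real.exp Λ * (Λ ^ 2 * leviForm Φ (Γ t) v) := by
          refine mul_le_mul (Real.exp_le_exp.2 h6) (h3.trans ?_) h5 (Real.exp_pos _).le
          exact mul_le_mul_of_nonneg_right (pow_le_pow_left₀ hL0.le h6 2) h8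
        _ = _ := by ring
  -- A compact subset of O \ A containing the curve would be closed, hence contain the accumulation
  -- point x ∈ A.
  have hinf := P.complete j Γ hΓ hmem ⟨Q, hQ, hQO, hΓQ⟩ (by
    rintro ⟨Q', hQ', hQ'O, hΓQ'⟩
    exact (hQ'O (closure_minimal (image_subset_iff.2 hΓQ') hQ'.isClosed hxΓ)).2 hx)
  rw [hinf, top_le_iff] at hlen
  exact ENNReal.mul_ne_top ENNReal.ofReal_ne_top hfin hlen

end LocalPotentials

end MainTheorem

theorem theorem1p1
    {E : Type*} [NormedAddCommGroup E] [NormedSpace ℂ E] [FiniteDimensional ℂ E]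
    {M : Type*} [TopologicalSpace M] [T2Space M] [SecondCountableTopology M]
    [ChartedSpace E M] [IsManifold 𝓘(ℂ, E) ω M]
    (hM : IsStein E M)
    (A : Set M) (hA : IsClosed A)
    {ι : Type*} (U : ι → Set M) (hUopen : ∀ i, IsOpen (U i))
    (hUcover : ⋃ i, U i = Set.univ) (hUfin : LocallyFinite U)
    (φ : ι → M → EReal)
    (hpsh : ∀ i, IsPSHOn E (φ i) (U i))
    (hreal : ∀ i, ∀ x ∈ U i \ A, φ i x ≠ ⊥)
    (hkahler : ∀ i, IsKahlerPotentialOn E (fun x => (φ i x).toReal) (U i \ A))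
    (hcomplete : ∀ i, IsLeviCompleteAlong E (fun x => (φ i x).toReal) (U i) A) :
    ∃ Φ : M → ℝ,
      IsPSHOn E (fun x => (Φ x : EReal)) Set.univ ∧
      IsKahlerPotentialOn E Φ Aᶜ ∧
      IsLeviComplete E Φ Aᶜ ∧
      BddBelow (Set.range Φ) ∧
      ((∀ i, ContinuousOn (φ i) (U i)) → Continuous Φ) := by
  have h2 : (2 : ℕ∞ω) ≤ (∞ : ℕ∞ω) := WithTop.coe_le_coe.2 (le_top (a := (2 : ℕ∞)))
  obtain ⟨J, P, hPcont⟩ := LocalPotentials.exists_of_cover hUopen hUcover hpsh hreal hkahler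
    hcomplete
  obtain ⟨ρ, hρ, hρc⟩ := exists_smooth_exhaustion E M
  obtain ⟨Ψ, hΨ, hΨ0, hdom⟩ := P.exists_dominating hM hρ
  have hlevi : ∀ x (v : E), v ≠ 0 →
      ∑ j ∈ P.idx x, 2 * |leviForm (P.θ j) x v| < leviForm Ψ x v := by
    intro x v hv
    obtain ⟨p, hp⟩ := hdom x
    obtain ⟨hxp, h⟩ := hp.self_of_nhds
    have h3 := norm_pos_iff.2 (tcoord_ne_zero hxp hv)
    have h4 := sq_nonneg (dform ρ x v)
    have h5 := h v
    have h6 : 0 < ‖tcoord p x v‖ ^ 2 := by positivity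
    linarith
  have hnn : ∀ x ∉ A, ∀ v : E, ∀ j ∈ P.idx x,
      0 ≤ (P.θ j x * (Real.log (3 + P.m j - (P.f j x).toReal))⁻¹) ^ 2 *
        leviForm (P.negLog j) x v := fun x hx v j hj =>
    mul_nonneg (sq_nonneg _) (P.leviForm_negLog_nonneg hA ⟨P.mem_of_mem_idx hj, hx⟩ v)
  have hlower : ∀ x ∉ A, ∀ v : E, leviForm Ψ x v -
      ∑ j ∈ P.idx x, 2 * |leviForm (P.θ j) x v| ≤ leviForm (fun y => Ψ y + P.total y) x v := by
    intro x hx v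
    have h3 := P.le_leviForm_add_total hA hΨ hx v
    have h4 := Finset.sum_nonneg (hnn x hx v)
    linarith
  have hsmooth : ∀ x ∉ A, ContMDiffAt 𝓘(ℝ, E) 𝓘(ℝ, ℝ) ∞ (fun y => Ψ y + P.total y) x :=
    fun x hx => (hΨ x).add (P.contMDiffAt_total hA hx)
  refine ⟨fun x => Ψ x + P.total x, P.isPSHOn_add_total hΨ hΨ0 hlevi,
    ⟨fun x hx => (hsmooth x hx).contMDiffWithinAt, fun x hx v hv =>
      (sub_pos.2 (hlevi x v hv)).trans_le (hlower x hx v)⟩, ?_, ⟨0, ?_⟩,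
    fun h => hΨ.continuous.add (P.continuous_total (hPcont h))⟩
  · refine isLeviComplete_of_lower_bound hA (fun x hx => (hsmooth x hx).of_le h2) hρ hρc
      (fun q => ?_) fun x hx => ?_
    · obtain ⟨p, hp⟩ := hdom q
      refine ⟨p, hp.mono fun x hx => ⟨hx.1, fun hxA v => ?_⟩⟩
      have h3 := hx.2 v
      have h4 := hlower x hxA v
      linarith
    · obtain ⟨j, hj⟩ := P.exists_eq_one x
      have hone : ∀ y, P.θ j y = 1 → j ∈ P.idx y := fun y hy =>
        P.mem_idx.2 (subset_tsupport _ (by simp [hy]))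
      -- Where θⱼ = 1 the multiplier τ equals 1/L, so the single term j already gives the bound L⁻²
      -- levi(-L); all else is nonnegative.
      refine ⟨{y | P.θ j y = 1}, hj, fun Γ hΓ hΓA ⟨Q, hQ, hQV, hΓQ⟩ hxΓ =>
        P.leviLength_eq_top hA j hQ (fun y hy => P.mem_of_mem_idx (hone y (hQV hy)))
          (fun y hy v => ?_) hΓ hΓA hΓQ hx hxΓ⟩
      have hy1 : P.θ j y = 1 := hQV hy.1
      have h3 := P.le_leviForm_add_total hA hΨ hy.2 v
      have h4 := Finset.single_le_sum (hnn y hy.2 v) (hone y hy1)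
      rcases eq_or_ne v 0 with rfl | hv
      · simp [leviForm]
      have h5 := hlevi y v hv
      rw [hy1, one_mul] at h4
      linarith
  · rintro _ ⟨x, rfl⟩
    exact add_nonneg (hΨ0 x) (P.total_nonneg x)
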